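/- Conventions. All monoids are commutative, with identity. A monoid $H$ is unit-cancellative if $a=au$ with $a,u\in H$ implies that $u$ is a unit. An atom is a non-unit that is not a product of two non-units; $H$ is atomic if every non-unit is a finite product of atoms. A factorization of $a\in H$ is a finite multiset $z$ of atoms of $H_{\mathrm{red}}=H/H^\times$ with product $aH^\times$; $|z|$ is its length, and $\mathsf L(a)\subset\mathbb N_0$ is the set of all lengths of factorizations of $a$ (so $\mathsf L(a)=\{0\}$ for units). $H$ is half-factorial if it is atomic and $|\mathsf L(a)|=1$ for all $a\in H$. The elasticity of $H$ is $\rho(H)=\sup_{a\in H}\rho(\mathsf L(a))$, where $\rho(L)=\sup L/\min L$ and $\rho(\{0\})=1$; it is accepted if $\rho(H)=\rho(\mathsf L(a))$ for some $a\in H$. The distance of two factorizations $z,z'$ is $\mathsf d(z,z')=\max\{|z\setminus z'|,|z'\setminus z|\}$ (multiset differences). The catenary degree $\mathsf c(H)$ is the supremum over $a\in H$ of the least $N\in\mathbb N_0\cup\{\infty\}$ such that any two factorizations $z,z'$ of $a$ are connected by a finite sequence $z=z_0,\dots,z_k=z'$ of factorizations of $a$ with $\mathsf d(z_{i-1},z_i)\le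 N$ for all $i$; for the monotone catenary degree $\mathsf c_{\mathrm{mon}}(H)$ one requires in addition $|z_0|\le\dots\le|z_k|$ or $|z_0|\ge\dots\ge|z_k|$. A Krull monoid is a cancellative, completely integrally closed monoid with the ascending chain condition on divisorial ideals. A transfer homomorphism $\theta\colon H\to B$ is a monoid homomorphism with $B=\theta(H)B^\times$ and $\theta^{-1}(B^\times)=H^\times$ such that whenever $\theta(u)=bc$ there are $v,w\in H$ with $u=vw$, $\theta(v)\in bB^\times$, $\theta(w)\in cB^\times$. $H$ is transfer Krull if it has a transfer homomorphism to a Krull monoid. Let $R$ be an order in a Dedekind domain $S$, i.e. $R\subset S$ is a subring with the same quotient field $K$ and $S$ is a finitely generated $R$-module. Suppose that $R$ is stable, i.e. every non-zero ideal $I$ of $R$ is invertible as an ideal of $(I:I)=\{x\in K\mid xI\subset I\}$. Let $\mathcal I(R)$ be the monoid of non-zero ideals and $\mathcal I^*(R)$ the monoid of invertible ideals of $R$, let $\overline R$ be the integral closure of $R$ in $K$, and let $\mathfrak X(\cdot)$ denote the set of minimal non-zero prime ideals. **Theorem.** The monoids $\mathcal I(R)$ and $\mathcal I^*(R)$ are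 unit-cancellative and atomic, and the following hold. 1. The following are equivalent: (a) $\mathcal I(R)$ is transfer Krull; (b) $\mathcal I^*(R)$ is transfer Krull; (c) $\mathcal I^*(R)$ is half-factorial; (d) $\mathcal I(R)$ is half-factorial; (e) $\mathsf c(\mathcal I(R))\le 2$; (f) $\mathsf c(\mathcal I^*(R))\le 2$. 2. $\mathsf c_{\mathrm{mon}}(\mathcal I^*(R))<\infty$. 3. $\mathcal I^*(R)$ has finite elasticity if and only if $\pi\colon\mathfrak X(\overline R)\to\mathfrak X(R)$, $\mathfrak P\mapsto\mathfrak P\cap R$, is bijective. If this holds, then the elasticity of $\mathcal I^*(R)$ is accepted. -/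

import Mathlib

open scoped ENNReal nonZeroDivisors

namespace MonoidArith

section Monoid

variable (H : Type*) [CommMonoid H]

/-- `H` is unit-cancellative: `a = a * u` forces `u` to be a unit. -/
def IsUnitCancellative : Prop := ∀ a u : H, a = a * u → IsUnit u

/-- `H` is atomic: every non-unit is a finite product of atoms. -/
def IsAtomicMonoid : Prop :=
  ∀ a : H, ¬ IsUnit a → ∃ s : Multiset H, (∀ u ∈ s, Irreducible u) ∧ s.prod = a

variable {H}

/-- The set `Z(a)` of factorizations of `a`: formal (unordered) products of atoms of the
associated reduced monoid `H_red`, whose value in `H_red` is the class of `a`. -/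
def factorizations (a : H) : Set (Multiset (Associates H)) :=
  {z | (∀ u ∈ z, Irreducible u) ∧ z.prod = Associates.mk a}

/-- The set of lengths `L(a)`; it is `{0}` if `a` is a unit. -/
def lengths (a : H) : Set ℕ := {k | ∃ z ∈ factorizations a, Multiset.card z = k}

variable (H)

/-- `H` is half-factorial: it is atomic, and every set of lengths is a singleton. -/
def IsHalfFactorial : Prop := IsAtomicMonoid H ∧ ∀ a : H, ∃ k : ℕ, lengths a = {k}

/-- The elasticity `sup L / min L` of a set of lengths, with value `1` for `L = {0}`. -/
noncomputable def setElasticity (L : Set ℕ) : ℝ≥0∞ :=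
  open Classical in
  if L = {0} then 1 else (⨆ k ∈ L, (k : ℝ≥0∞)) / ((sInf L : ℕ) : ℝ≥0∞)

/-- The elasticity of `H`. -/
noncomputable def elasticity : ℝ≥0∞ := ⨆ a : H, setElasticity (lengths a)

/-- The elasticity of `H` is accepted: it is attained by some set of lengths. -/
def ElasticityAccepted : Prop := ∃ a : H, setElasticity (lengths a) = elasticity H

variable {H}

/-- The distance of two factorizations: cancel the common part (with multiplicity), and take the
larger one of the lengths of what remains. -/
noncomputable def factDist (z z' : Multiset (Associates H)) : ℕ :=
  open Classical in max (Multiset.card (z - z')) (Multiset.card (z' - z))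

/-- `c 0, …, c k` is an `N`-chain of factorizations of `a` from `z` to `z'`. -/
def IsChainOfFact (a : H) (N : ℕ∞) (z z' : Multiset (Associates H)) (k : ℕ)
    (c : ℕ → Multiset (Associates H)) : Prop :=
  c 0 = z ∧ c k = z' ∧ (∀ i ≤ k, c i ∈ factorizations a) ∧
    ∀ i < k, (factDist (c i) (c (i + 1)) : ℕ∞) ≤ N

/-- The lengths along `c 0, …, c k` are weakly increasing or weakly decreasing. -/
def IsMonotoneSeq (k : ℕ) (c : ℕ → Multiset (Associates H)) : Prop :=
  (∀ i < k, Multiset.card (c i) ≤ Multiset.card (c (i + 1))) ∨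
    (∀ i < k, Multiset.card (c (i + 1)) ≤ Multiset.card (c i))

/-- The catenary degree `c(a)`. -/
noncomputable def catenaryDegreeOf (a : H) : ℕ∞ :=
  sInf {N | ∀ z ∈ factorizations a, ∀ z' ∈ factorizations a, ∃ k c, IsChainOfFact a N z z' k c}

/-- The monotone catenary degree `c_mon(a)`. -/
noncomputable def monotoneCatenaryDegreeOf (a : H) : ℕ∞ :=
  sInf {N | ∀ z ∈ factorizations a, ∀ z' ∈ factorizations a,
    ∃ k c, IsChainOfFact a N z z' k c ∧ IsMonotoneSeq k c}

variable (H)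

/-- The catenary degree `c(H)`. -/
noncomputable def catenaryDegree : ℕ∞ := ⨆ a : H, catenaryDegreeOf a

/-- The monotone catenary degree `c_mon(H)`. -/
noncomputable def monotoneCatenaryDegree : ℕ∞ := ⨆ a : H, monotoneCatenaryDegreeOf a

/-- The image of `H` in its quotient group. -/
def inQuot : Set (Algebra.GrothendieckGroup H) := Set.range (Algebra.GrothendieckGroup.of (M := H))

variable {H}

/-- `A⁻¹ = (H : A)` inside the quotient group of `H`. -/
def invSet (A : Set (Algebra.GrothendieckGroup H)) : Set (Algebra.GrothendieckGroup H) :=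
  {z | ∀ a ∈ A, z * a ∈ inQuot H}

variable (H)

/-- `A` is a divisorial ideal of `H`: `A ⊆ H` and `A = (A⁻¹)⁻¹`. -/
def IsDivisorialIdeal (A : Set (Algebra.GrothendieckGroup H)) : Prop :=
  A ⊆ inQuot H ∧ invSet (invSet A) = A

/-- A Krull monoid: cancellative, completely integrally closed, and with the ascending chain
condition on divisorial ideals. -/
structure IsKrullMonoid : Prop where
  cancel : IsCancelMul H
  completelyIntegrallyClosed : ∀ x : Algebra.GrothendieckGroup H,
    (∃ c ∈ inQuot H, ∀ n : ℕ, 0 < n → c * x ^ n ∈ inQuot H) → x ∈ inQuot H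
  mori : ∀ A : ℕ → Set (Algebra.GrothendieckGroup H), (∀ n, IsDivisorialIdeal H (A n)) →
    Monotone A → ∃ n, ∀ m, n ≤ m → A m = A n

variable {H}

/-- Transfer homomorphisms. -/
structure IsTransferHom {B : Type*} [CommMonoid B] (θ : H →* B) : Prop where
  surj : ∀ b : B, ∃ h : H, ∃ e : B, IsUnit e ∧ b = θ h * e
  isUnit_iff : ∀ h : H, IsUnit (θ h) ↔ IsUnit h
  lift : ∀ (u : H) (b c : B), θ u = b * c →
    ∃ v w : H, u = v * w ∧ (∃ e, IsUnit e ∧ θ v = b * e) ∧ (∃ e, IsUnit e ∧ θ w = c * e)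

end Monoid

/-- `H` is transfer Krull: there is a transfer homomorphism to a Krull monoid `B`. Nothing is lost
by taking `B` in the universe of `H`: one may always pass to `B_red`, onto which `H` maps. -/
def IsTransferKrull.{u} (H : Type u) [CommMonoid H] : Prop :=
  ∃ (B : Type u) (_ : CommMonoid B) (θ : H →* B), IsKrullMonoid B ∧ IsTransferHom θ

end MonoidArith

namespace OrderIdeals

section Domain

variable (R : Type*) [CommRing R] [IsDomain R]

/-- The monoid `I(R)` of non-zero ideals of the domain `R`. -/
def nonzeroIdeals : Submonoid (Ideal R) where
  carrier := {I | I ≠ ⊥}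
  one_mem' := one_ne_zero (α := Ideal R)
  mul_mem' := fun hI hJ => mul_ne_zero (M₀ := Ideal R) hI hJ

/-- The monoid `I*(R)` of invertible ideals of `R`: the ideals that are units in the monoid of
fractional ideals. -/
def invertibleIdeals : Submonoid (Ideal R) where
  carrier := {I | IsUnit (I : FractionalIdeal R⁰ (FractionRing R))}
  one_mem' := by simp
  mul_mem' := fun hI hJ => by
    simpa only [Set.mem_ofPred_eq, FractionalIdeal.coeIdeal_mul] using IsUnit.mul hI hJ

/-- An ideal `I` of `R` is stable if it is invertible as an ideal of the overring `(I : I)`, that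
is, `I * ((I : I) : I) = (I : I)`. Here `A / B` is the colon module `(A : B)` in the quotient
field. -/
def IsStableIdeal (I : Ideal R) : Prop :=
  let M : Submodule R (FractionRing R) := IsLocalization.coeSubmodule (FractionRing R) I
  M * ((M / M) / M) = M / M

/-- `R` is a stable domain: every non-zero ideal is stable. -/
def IsStableDomain : Prop := ∀ I : Ideal R, I ≠ ⊥ → IsStableIdeal R I

/-- The set `X(R)` of minimal elements among the non-zero prime ideals. -/
def minimalNonzeroPrimes : Set (Ideal R) := {P | Minimal (fun Q : Ideal R => Q.IsPrime ∧ Q ≠ ⊥) P}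

/-- `R` is an order in `S`: `R ⊆ S`, the quotient fields of `R` and `S` coincide, and `S` is a
finitely generated `R`-module. -/
structure IsOrderIn (S : Type*) [CommRing S] [Algebra R S] : Prop where
  injective : Function.Injective (algebraMap R S)
  isFraction : ∀ s : S, ∃ a b : R, b ≠ 0 ∧ algebraMap R S b * s = algebraMap R S a
  finite : Module.Finite R S

/-- The integral closure of `R` in its quotient field. -/
abbrev intClosure : Subalgebra R (FractionRing R) := integralClosure R (FractionRing R)

end Domain

end OrderIdeals

/-!
The proof is local. An order `R` in a Dedekind domain `S` is noetherian of dimension at most one, so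
`I(R)` and `I*(R)` are coproducts of the corresponding monoids of the localizations at the non-zero
maximal ideals `P` (`nonzeroIdealsDecomp`, `invertibleIdealsDecomp`). The localization at `P` is a
local domain inside a semilocal principal ideal domain, its invertible ideals are principal, and
stability says that every non-zero ideal `J` of it contains an `a` with `J ^ 2 = a J`
(`exists_stable_generator`, `IsOrderIn.isStableLocalOrder`). For its maximal ideal `M` this gives
`M ^ 2 = m M`: the product of two non-units is `m` times a non-unit, and `m` has the smallest value
among all non-units, for each valuation of the principal ideal domain. There are two types of
localizations (`IsOrderIn.splitData_or_nonsplitData`).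

* If at least two primes of `S` lie over `P`, then every element of large value is a product of just
  two atoms (`SplitData`): whether a factor is an atom is decided by its residue at one prime, and a
  unit of the semilocal ring has prescribed residues at two primes. So the elasticity is infinite.
* If only one prime lies over `P`, the values of atoms range from `r`, the value of `m`, to some `s`,
  and every element of value `2 * s` is a product of two atoms (`NonsplitData`). This rests on
  stability of a second ideal, and on the fact that the units of a local ring are products of two
  units outside of a given proper subring that is closed under inverses (`exists_unit_factors`). The
  elasticity of this component is `s / r`, which is attained by a power of `m`.

A localization is good if it is of the second type with `r = s`. All but finitely many are, as
only those that contain the conductor can be bad. In the good case, `merge` transforms any factorization into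
copies of `m` and one more atom by steps that exchange two atoms, for invertible ideals and for all
non-zero ideals (`twoConnected_of_additive`). In every other case a power of `m` is a product of
another number of atoms `u` with `u / m` almost integral (`HasBadRelation`); this excludes catenary
degree two, half-factoriality, and a transfer homomorphism to a Krull monoid, in which the images of
all these atoms would be associated. So the six properties either all hold or all fail.

For the monotone catenary degree, factorizations at the remaining localizations are brought into a
normal form with boundedly many atoms other than `m` (and, for one valuation, another atom `w₀`).
Hence factorizations of close lengths are at bounded distance (`CloseLengths`), and lengths far from
the extremal ones can be shifted by a fixed amount, or any multiple of it, in steps of bounded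
distance (`Shiftable`). Shifting finitely many components by a common amount, one up and one down,
links factorizations in the coproduct monotonically (`Decomp.exists_upConn_glue`).
-/

set_option linter.unusedSectionVars false

/-! ### Steps between products of atoms -/

namespace MonoidArith

open Multiset Relation

section Steps

variable {E : Type*} [CommMonoid E]

/-- `z` and `z'` are products of atoms with the same value, which agree up to a common part and at
most `N` atoms on either side. -/
def Near (N : ℕ) (z z' : Multiset E) : Prop :=
  ∃ x y y' : Multiset E, z = x + y ∧ z' = x + y' ∧ card y ≤ N ∧ card y' ≤ N ∧
    y.prod = y'.prod ∧ (∀ u ∈ y, Irreducible u) ∧ ∀ u ∈ y', Irreducible u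

/-- One step between factorizations of the same length, of distance at most `N`. -/
def EqStep (N : ℕ) (z z' : Multiset E) : Prop := Near N z z' ∧ card z = card z'

/-- One step between factorizations which does not decrease the length, of distance at most `N`. -/
def UpStep (N : ℕ) (z z' : Multiset E) : Prop := Near N z z' ∧ card z ≤ card z'

/-- Two factorizations are linked by steps of distance at most `N` that keep the length. -/
def EqConn (N : ℕ) : Multiset E → Multiset E → Prop := ReflTransGen (EqStep N)

/-- Two factorizations are linked by steps of distance at most `N` that never decrease the
length. -/
def UpConn (N : ℕ) : Multiset E → Multiset E → Prop := ReflTransGen (UpStep N)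

variable {N N' : ℕ} {z z' a a' b b' : Multiset E}

theorem Near.of_small (h : z.prod = z'.prod) (hz : ∀ u ∈ z, Irreducible u)
    (hz' : ∀ u ∈ z', Irreducible u) (h1 : card z ≤ N) (h2 : card z' ≤ N) : Near N z z' :=
  ⟨0, z, z', by simp, by simp, h1, h2, h, hz, hz'⟩

theorem Near.refl (N : ℕ) (z : Multiset E) : Near N z z :=
  ⟨z, 0, 0, by simp, by simp, by simp, by simp, rfl, by simp, by simp⟩

theorem Near.symm (h : Near N z z') : Near N z' z := by
  obtain ⟨x, y, y', h1, h2, h3, h4, h5, h6, h7⟩ := h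
  exact ⟨x, y', y, h2, h1, h4, h3, h5.symm, h7, h6⟩

theorem Near.mono (h : Near N z z') (hN : N ≤ N') : Near N' z z' := by
  obtain ⟨x, y, y', h1, h2, h3, h4, h5⟩ := h
  exact ⟨x, y, y', h1, h2, h3.trans hN, h4.trans hN, h5⟩

theorem Near.prod_eq (h : Near N z z') : z.prod = z'.prod := by
  obtain ⟨x, y, y', rfl, rfl, -, -, h, -⟩ := h
  simp [h]

theorem Near.atoms (h : Near N z z') (hz : ∀ u ∈ z, Irreducible u) : ∀ u ∈ z', Irreducible u := by
  obtain ⟨x, y, y', rfl, rfl, -, -, -, -, h⟩ := h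
  intro u hu
  rcases Multiset.mem_add.1 hu with hu | hu
  · exact hz u (Multiset.mem_add.2 (Or.inl hu))
  · exact h u hu

theorem Near.add (h : Near N a a') (h' : Near N' b b') : Near (N + N') (a + b) (a' + b') := by
  obtain ⟨x, y, y', rfl, rfl, h3, h4, h5, h6, h7⟩ := h
  obtain ⟨x₁, y₁, y₁', rfl, rfl, k3, k4, k5, k6, k7⟩ := h'
  refine ⟨x + x₁, y + y₁, y' + y₁', by abel, by abel, ?_, ?_, ?_, ?_, ?_⟩
  · simp only [card_add]; omega
  · simp only [card_add]; omega
  · simp [h5, k5]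
  · intro u hu
    rcases Multiset.mem_add.1 hu with hu | hu
    exacts [h6 u hu, k6 u hu]
  · intro u hu
    rcases Multiset.mem_add.1 hu with hu | hu
    exacts [h7 u hu, k7 u hu]

theorem Near.add_left (c : Multiset E) (h : Near N z z') : Near N (c + z) (c + z') := by
  simpa using (Near.refl 0 c).add h

theorem Near.map {F : Type*} [CommMonoid F] (σ : E →* F)
    (hσ : ∀ u, Irreducible u → Irreducible (σ u)) (h : Near N z z') :
    Near N (z.map σ) (z'.map σ) := by
  obtain ⟨x, y, y', rfl, rfl, h3, h4, h5, h6, h7⟩ := h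
  refine ⟨x.map σ, y.map σ, y'.map σ, by simp, by simp, by simpa, by simpa, ?_, ?_, ?_⟩
  · rw [Multiset.prod_hom, Multiset.prod_hom, h5]
  · intro u hu
    obtain ⟨w, hw, rfl⟩ := Multiset.mem_map.1 hu
    exact hσ w (h6 w hw)
  · intro u hu
    obtain ⟨w, hw, rfl⟩ := Multiset.mem_map.1 hu
    exact hσ w (h7 w hw)

theorem EqConn.refl (N : ℕ) (z : Multiset E) : EqConn N z z := ReflTransGen.refl

theorem EqConn.trans {z'' : Multiset E} (h : EqConn N z z') (h' : EqConn N z' z'') :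
    EqConn N z z'' := ReflTransGen.trans h h'

theorem EqStep.conn (h : EqStep N z z') : EqConn N z z' := ReflTransGen.single h

theorem EqConn.symm (h : EqConn N z z') : EqConn N z' z := by
  induction h with
  | refl => exact EqConn.refl _ _
  | tail _ h ih => exact EqConn.trans (ReflTransGen.single ⟨h.1.symm, h.2.symm⟩) ih

theorem EqConn.mono (h : EqConn N z z') (hN : N ≤ N') : EqConn N' z z' :=
  ReflTransGen.mono (fun _ _ h => ⟨h.1.mono hN, h.2⟩) _ _ h

theorem EqConn.prod_eq (h : EqConn N z z') : z.prod = z'.prod := by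
  induction h with
  | refl => rfl
  | tail _ h ih => exact ih.trans h.1.prod_eq

theorem EqConn.card_eq (h : EqConn N z z') : card z = card z' := by
  induction h with
  | refl => rfl
  | tail _ h ih => exact ih.trans h.2

theorem EqConn.atoms (h : EqConn N z z') (hz : ∀ u ∈ z, Irreducible u) :
    ∀ u ∈ z', Irreducible u := by
  induction h with
  | refl => exact hz
  | tail _ h ih => exact h.1.atoms ih

theorem EqConn.add_left (c : Multiset E) (h : EqConn N z z') : EqConn N (c + z) (c + z') :=
  ReflTransGen.lift (c + ·) (fun _ _ h => ⟨h.1.add_left c, by simp [h.2]⟩) _ _ h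

theorem EqConn.add (h : EqConn N a a') (h' : EqConn N b b') : EqConn N (a + b) (a' + b') :=
  (h'.add_left a).trans (by simpa [add_comm] using h.add_left b')

theorem EqConn.map {F : Type*} [CommMonoid F] (σ : E →* F)
    (hσ : ∀ u, Irreducible u → Irreducible (σ u)) (h : EqConn N z z') :
    EqConn N (z.map σ) (z'.map σ) :=
  ReflTransGen.lift (Multiset.map σ) (fun _ _ h => ⟨h.1.map σ hσ, by simp [h.2]⟩) _ _ h

theorem EqConn.up (h : EqConn N z z') : UpConn N z z' :=
  ReflTransGen.mono (fun _ _ h => ⟨h.1, h.2.le⟩) _ _ h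

theorem UpConn.mono (h : UpConn N z z') (hN : N ≤ N') : UpConn N' z z' :=
  ReflTransGen.mono (fun _ _ h => ⟨h.1.mono hN, h.2⟩) _ _ h

theorem UpConn.add_left (c : Multiset E) (h : UpConn N z z') : UpConn N (c + z) (c + z') :=
  ReflTransGen.lift (c + ·) (fun _ _ h => ⟨h.1.add_left c, by simp [h.2]⟩) _ _ h

/-- If every large collection of atoms with property `q` contains a part that can be rewritten,
at equal length, with fewer atoms of that kind, then every factorization can be rewritten such that
only few atoms of that kind are left. -/
theorem exists_eqConn_card_filter_le {q : E → Prop} [DecidablePred q] {B N : ℕ}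
    (H : ∀ T : Multiset E, (∀ u ∈ T, Irreducible u) → (∀ u ∈ T, q u) → B < card T →
      ∃ S ≤ T, ∃ S', EqStep N S S' ∧ card (S'.filter q) < card S)
    (z : Multiset E) (hz : ∀ u ∈ z, Irreducible u) :
    ∃ z₁, EqConn N z z₁ ∧ card (z₁.filter q) ≤ B := by
  induction hn : card (z.filter q) using Nat.strong_induction_on generalizing z with
  | _ n ih =>
    by_cases hB : n ≤ B
    · exact ⟨z, EqConn.refl _ _, hn.trans_le hB⟩
    · obtain ⟨S, hS, S', hSS', hlt⟩ := H (z.filter q)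
        (fun u hu => hz u (Multiset.mem_of_mem_filter hu))
        (fun u hu => (Multiset.mem_filter.1 hu).2) (by omega)
      obtain ⟨R, hR⟩ := Multiset.le_iff_exists_add.1 hS
      have hzR : z = (z.filter (fun u => ¬ q u) + R) + S := by
        conv_lhs => rw [← Multiset.filter_add_not q z, hR]
        abel
      have hstep : EqConn N z ((z.filter (fun u => ¬ q u) + R) + S') := by
        conv_lhs => rw [hzR]
        exact hSS'.conn.add_left _
      have hR' : card (R.filter q) ≤ card R := Multiset.card_le_card (Multiset.filter_le _ _)
      have hcard : n = card S + card R := by rw [← hn, hR, card_add]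
      obtain ⟨z₁, h1, h2⟩ := ih (card (((z.filter (fun u => ¬ q u) + R) + S').filter q)) (by
        have h0 : (z.filter (fun u => ¬ q u)).filter q = 0 := by
          rw [Multiset.filter_filter, Multiset.filter_eq_nil]
          tauto
        simp only [Multiset.filter_add, card_add, h0, card_zero]
        omega) _ (hstep.atoms hz) rfl
      exact ⟨z₁, hstep.trans h1, h2⟩

end Steps

/-- A multiset of elements carrying labels below `n`, each label at most `K` times, has at most
`n * K` elements. -/
theorem card_le_of_count_le {E : Type*} (T : Multiset E) (g : E → ℕ) (n K : ℕ)
    (hg : ∀ u ∈ T, g u < n) (hK : ∀ j, card (T.filter (fun u => g u = j)) ≤ K) : card T ≤ n * K := by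
  have h1 : ∑ j ∈ (T.map g).toFinset, (T.map g).count j = card (T.map g) :=
    Multiset.toFinset_sum_count_eq _
  rw [← Multiset.card_map g T, ← h1]
  calc ∑ j ∈ (T.map g).toFinset, (T.map g).count j ≤ ∑ j ∈ Finset.range n, (T.map g).count j := by
        apply Finset.sum_le_sum_of_subset
        intro j hj
        simp only [Multiset.mem_toFinset, Multiset.mem_map] at hj
        obtain ⟨u, hu, rfl⟩ := hj
        exact Finset.mem_range.2 (hg u hu)
    _ ≤ ∑ j ∈ Finset.range n, K := by
        apply Finset.sum_le_sum
        intro j _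
        rw [Multiset.count_map]
        simpa [eq_comm] using hK j
    _ = n * K := by simp

/-! ### Monoids with valuations -/

/-- The arithmetic of the monoid of non-zero principal ideals of a one-dimensional local domain
which is stable and whose integral closure is finite: `v i` are the valuations belonging to the
maximal ideals of the integral closure, `m` generates the maximal ideal `M` as an ideal of its
endomorphism ring, and `f` bounds the exponents of the conductor. The field `merge` says that
`M ^ 2 = m M`, and `dvd` that the conductor lies in the domain. -/
structure ValData (E : Type*) [CommMonoid E] (ι : Type*) where
  m : E
  irr : Irreducible m
  cancel : ∀ x y z : E, x * y = x * z → y = z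
  v : ι → E → ℕ
  v_one : ∀ i, v i 1 = 0
  v_mul : ∀ i x y, v i (x * y) = v i x + v i y
  pos : ∀ i, 1 ≤ v i m
  le : ∀ i u, ¬ IsUnit u → v i m ≤ v i u
  merge : ∀ u u', ¬ IsUnit u → ¬ IsUnit u' → ∃ w, ¬ IsUnit w ∧ u * u' = m * w
  f : ℕ
  dvd : ∀ u w, (∀ i, v i w + f ≤ v i u) → w ∣ u

/-- The case of several valuations: every element of large value is a product of two atoms. -/
structure SplitData (E : Type*) [CommMonoid E] (ι : Type*) extends ValData E ι where
  flex : ∀ u w, (∀ i, v i w + f ≤ v i u) → ∃ X Y, Irreducible X ∧ Irreducible Y ∧ u = w * (X * Y)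

/-- The case of one valuation: here `s` is the maximal value of an atom, and every element of value
`2 * s` is a product of two atoms. -/
structure NonsplitData (E : Type*) [CommMonoid E] extends ValData E Unit where
  s : ℕ
  w₀ : E
  irr_w₀ : Irreducible w₀
  v_w₀ : v () w₀ = s
  le_s : ∀ u, Irreducible u → v () u ≤ s
  flex : ∀ u w, v () u = v () w + 2 * s → ∃ X Y, Irreducible X ∧ Irreducible Y ∧ u = w * (X * Y)

namespace ValData

variable {E : Type*} [CommMonoid E] {ι : Type*} (D : ValData E ι)

theorem v_prod (i : ι) (z : Multiset E) : D.v i z.prod = (z.map (D.v i)).sum := by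
  induction z using Multiset.induction_on with
  | empty => simp [D.v_one]
  | cons a z ih => simp [D.v_mul, ih]

theorem v_pow (i : ι) (x : E) (n : ℕ) : D.v i (x ^ n) = n * D.v i x := by
  induction n with
  | zero => simp [D.v_one]
  | succ n ih => rw [pow_succ, D.v_mul, ih]; ring

theorem card_mul_le (i : ι) (z : Multiset E) (hz : ∀ u ∈ z, Irreducible u) :
    card z * D.v i D.m ≤ D.v i z.prod := by
  rw [D.v_prod]
  induction z using Multiset.induction_on with
  | empty => simp
  | cons a z ih =>
    have h1 := ih fun u hu => hz u (Multiset.mem_cons_of_mem hu)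
    have h2 := D.le i a (hz a (Multiset.mem_cons_self _ _)).not_isUnit
    simp only [card_cons, map_cons, sum_cons]
    linarith

/-- A non-unit of value less than twice the minimal one is an atom. -/
theorem irreducible_of_lt (i : ι) (u : E) (hu : ¬ IsUnit u) (h : D.v i u < 2 * D.v i D.m) :
    Irreducible u := by
  refine ⟨hu, fun a b hab => ?_⟩
  by_contra! hcon
  have h1 := D.le i a hcon.1
  have h2 := D.le i b hcon.2
  rw [hab, D.v_mul] at h
  omega

/-- Two atoms of minimal value at `i` can be replaced by `m` and another atom. -/
theorem merge_atoms (i : ι) (u u' : E) (hu : Irreducible u) (hu' : Irreducible u')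
    (h : D.v i u = D.v i D.m) (h' : D.v i u' = D.v i D.m) :
    ∃ w, Irreducible w ∧ u * u' = D.m * w := by
  obtain ⟨w, hw, e⟩ := D.merge u u' hu.not_isUnit hu'.not_isUnit
  refine ⟨w, D.irreducible_of_lt i w hw ?_, e⟩
  have := congrArg (D.v i) e
  rw [D.v_mul, D.v_mul] at this
  have := D.pos i
  omega

theorem near_of_prod_eq (D : ValData E ι) {N : ℕ} {x y y' : Multiset E}
    (h : (x + y).prod = (x + y').prod)
    (hy : ∀ u ∈ y, Irreducible u) (hy' : ∀ u ∈ y', Irreducible u) (h1 : card y ≤ N)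
    (h2 : card y' ≤ N) : Near N (x + y) (x + y') :=
  ⟨x, y, y', rfl, rfl, h1, h2, D.cancel _ _ _ (by simpa using h), hy, hy'⟩

theorem eqStep_merge [DecidableEq E] (i : ι) (u u' : E) (hu : Irreducible u) (hu' : Irreducible u')
    (h : D.v i u = D.v i D.m) (h' : D.v i u' = D.v i D.m) :
    ∃ S', EqStep 2 {u, u'} S' ∧ card (S'.filter (· ≠ D.m)) < 2 := by
  obtain ⟨w, hw, e⟩ := D.merge_atoms i u u' hu hu' h h'
  refine ⟨{D.m, w}, ⟨Near.of_small (by simpa using e) (by simp [hu, hu']) (by simp [hw, D.irr])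
    (by simp) (by simp), by simp⟩, ?_⟩
  · have : card (({w} : Multiset E).filter (· ≠ D.m)) ≤ card ({w} : Multiset E) :=
      Multiset.card_le_card (Multiset.filter_le _ _)
    have e2 : ({D.m, w} : Multiset E) = D.m ::ₘ {w} := rfl
    rw [e2, Multiset.filter_cons_of_neg _ (by simp)]
    simpa [Nat.lt_succ_iff] using this

end ValData

/-- Factorizations of the same element whose lengths differ by at most `C` are, after steps of
bounded distance that keep the lengths, within bounded distance of each other. -/
def CloseLengths (E : Type*) [CommMonoid E] : Prop :=
  ∀ C : ℕ, ∃ N, ∀ z z' : Multiset E, (∀ u ∈ z, Irreducible u) → (∀ u ∈ z', Irreducible u) →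
    z.prod = z'.prod → card z ≤ card z' + C → card z' ≤ card z + C →
    ∃ z₁ z₁', EqConn N z z₁ ∧ EqConn N z' z₁' ∧ Near N z₁ z₁'

/-- For `z`, `z'` factorizations of the same element, `z` shorter than `z'` by at least `C`, one can
lengthen `z` and shorten `z'` by exactly `Δ`, in steps of distance at most `N` of which only the last
one changes the length. -/
def ShiftBound (E : Type*) [CommMonoid E] (Δ C N : ℕ) : Prop :=
  ∀ z z' : Multiset E, (∀ u ∈ z, Irreducible u) → (∀ u ∈ z', Irreducible u) →
    z.prod = z'.prod → card z + C ≤ card z' →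
    (∃ z₁ z₂, EqConn N z z₁ ∧ Near N z₁ z₂ ∧ card z₂ = card z + Δ) ∧
    (∃ z₁ z₂, EqConn N z' z₁ ∧ Near N z₁ z₂ ∧ card z₂ + Δ = card z')

/-- Lengths of factorizations can be shifted by `Δ` in steps of bounded distance, unless they are
close to the maximal or minimal length. -/
def Shiftable (E : Type*) [CommMonoid E] (Δ : ℕ) : Prop := ∃ C N, ShiftBound E Δ C N

end MonoidArith

/-! ### Several valuations -/

namespace MonoidArith

open Multiset Relation

theorem exists_le_card {α : Type*} (T : Multiset α) {n : ℕ} (h : n ≤ card T) :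
    ∃ S ≤ T, card S = n := by
  induction T using Quotient.inductionOn with
  | h l =>
    refine ⟨(l.take n : List α), Multiset.coe_le.2 (List.take_sublist n l).subperm, ?_⟩
    simpa using h

theorem exists_pair_le {α : Type*} {q : α → Prop} [DecidablePred q] (T : Multiset α)
    (h : 2 ≤ card (T.filter q)) : ∃ u u', ({u, u'} : Multiset α) ≤ T ∧ q u ∧ q u' := by
  obtain ⟨S, hS, hc⟩ := exists_le_card _ h
  obtain ⟨u, u', rfl⟩ := Multiset.card_eq_two.1 hc
  refine ⟨u, u', hS.trans (Multiset.filter_le _ _), ?_, ?_⟩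
  · exact (Multiset.mem_filter.1 (Multiset.mem_of_le hS (by simp))).2
  · exact (Multiset.mem_filter.1 (Multiset.mem_of_le hS (by simp))).2

namespace SplitData

variable {E : Type*} [CommMonoid E] {ι : Type*} (D : SplitData E ι)

/-- Every factorization can be rewritten, at equal length, with at most `f + 3` atoms other than `m`.
Two atoms of minimal value for a common valuation are merged into `m` and one more atom; if there are
no two such atoms for any valuation, then `f + 4` atoms have a product of value large enough to be of
the form `m ^ (f + 2) * (X * Y)` with two atoms `X`, `Y`. -/
theorem normal_form [DecidableEq E] (z : Multiset E) (hz : ∀ u ∈ z, Irreducible u) :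
    ∃ z₁, EqConn (D.f + 4) z z₁ ∧ card (z₁.filter (· ≠ D.m)) ≤ D.f + 3 := by
  classical
  refine exists_eqConn_card_filter_le (fun T hT hTm hB => ?_) z hz
  by_cases hi : ∃ i, 2 ≤ card (T.filter (fun u => D.v i u = D.v i D.m))
  · obtain ⟨i, hi⟩ := hi
    obtain ⟨u, u', hle, hu, hu'⟩ := exists_pair_le T hi
    obtain ⟨S', h1, h2⟩ := D.eqStep_merge i u u' (hT u (Multiset.mem_of_le hle (by simp)))
      (hT u' (Multiset.mem_of_le hle (by simp))) hu hu'
    exact ⟨_, hle, S', ⟨h1.1.mono (by omega), h1.2⟩, by simpa using h2⟩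
  · push Not at hi
    obtain ⟨S, hS, hc⟩ := exists_le_card T (n := D.f + 4) (by omega)
    have hSa : ∀ u ∈ S, Irreducible u := fun u hu => hT u (Multiset.mem_of_le hS hu)
    -- all but one of the atoms in `S` have more than the minimal value at `i`
    have hval : ∀ i, card S * D.v i D.m + card S ≤ D.v i S.prod + 1 := by
      intro i
      have h1 : card (S.filter (fun u => D.v i u = D.v i D.m)) ≤ 1 :=
        (Multiset.card_le_card (Multiset.filter_le_filter _ hS)).trans
          (Nat.lt_succ_iff.1 (hi i))
      have h2 : ∀ S : Multiset E, (∀ u ∈ S, Irreducible u) →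
          card S * D.v i D.m + card S ≤
            D.v i S.prod + card (S.filter (fun u => D.v i u = D.v i D.m)) := by
        intro S
        induction S using Multiset.induction_on with
        | empty => simp [D.v_one]
        | cons a S ih =>
          intro h
          have h3 := ih fun u hu => h u (Multiset.mem_cons_of_mem hu)
          have h4 := D.le i a (h a (Multiset.mem_cons_self _ _)).not_isUnit
          by_cases ha : D.v i a = D.v i D.m
          · rw [Multiset.filter_cons_of_pos (p := fun u => D.v i u = D.v i D.m) _ ha]
            simp only [card_cons, prod_cons, D.v_mul]
            linarith
          · rw [Multiset.filter_cons_of_neg (p := fun u => D.v i u = D.v i D.m) _ ha]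
            have : D.v i D.m + 1 ≤ D.v i a := by omega
            simp only [card_cons, prod_cons, D.v_mul]
            linarith
      have := h2 S hSa
      omega
    obtain ⟨X, Y, hX, hY, e⟩ := D.flex S.prod (D.m ^ (D.f + 2)) (by
      intro i
      have := hval i
      rw [hc] at this
      rw [D.v_pow]
      linarith)
    refine ⟨S, hS, replicate (D.f + 2) D.m + {X, Y},
      ⟨Near.of_small ?_ hSa ?_ hc.le (by simp), ?_⟩, ?_⟩
    · simp only [e, prod_add, prod_replicate, insert_eq_cons, prod_cons, prod_singleton]
    · intro u hu
      simp only [mem_add, mem_replicate, insert_eq_cons, mem_cons, mem_singleton] at hu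
      rcases hu with hu | rfl | rfl
      exacts [hu.2 ▸ D.irr, hX, hY]
    · simp [hc]
    · have h0 : (replicate (D.f + 2) D.m).filter (· ≠ D.m) = 0 := by
        rw [Multiset.filter_eq_nil]
        intro a ha
        simp [Multiset.eq_of_mem_replicate ha]
      have h1 : card (({X, Y} : Multiset E).filter (· ≠ D.m)) ≤ card ({X, Y} : Multiset E) :=
        Multiset.card_le_card (Multiset.filter_le _ _)
      rw [Multiset.filter_add, card_add, h0, hc]
      simp only [insert_eq_cons, card_cons, card_singleton, card_zero] at h1 ⊢
      omega

/-- Up to steps of bounded distance that keep the length, every factorization consists of copies of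
`m` and boundedly many other atoms. -/
theorem normal_form' (z : Multiset E) (hz : ∀ u ∈ z, Irreducible u) :
    ∃ α T, EqConn (D.f + 4) z (replicate α D.m + T) ∧ card T ≤ D.f + 3 ∧
      ∀ u ∈ T, Irreducible u := by
  classical
  obtain ⟨z₁, h1, h2⟩ := D.normal_form z hz
  refine ⟨count D.m z₁, z₁.filter (· ≠ D.m), ?_, h2, fun u hu =>
    h1.atoms hz u (Multiset.mem_of_mem_filter hu)⟩
  rwa [← Multiset.filter_eq', Multiset.filter_add_not]

/-- In normal form, two factorizations of close lengths differ in a bounded number of copies of `m` and a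
bounded number of other atoms. -/
theorem closeLengths (D : SplitData E ι) : CloseLengths E := by
  intro C
  refine ⟨2 * (D.f + 4) + C, fun z z' hz hz' hp h1 h2 => ?_⟩
  obtain ⟨α, T, k1, k2, k3⟩ := D.normal_form' z hz
  obtain ⟨α', T', k1', k2', k3'⟩ := D.normal_form' z' hz'
  refine ⟨_, _, k1.mono (by omega), k1'.mono (by omega), ?_⟩
  have c1 := k1.card_eq
  have c1' := k1'.card_eq
  simp only [card_add, card_replicate] at c1 c1'
  have p : (replicate α D.m + T).prod = (replicate α' D.m + T').prod := by
    rw [← k1.prod_eq, ← k1'.prod_eq, hp]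
  obtain ⟨k, rfl | rfl⟩ : ∃ k, α = α' + k ∨ α' = α + k := by
    rcases le_total α α' with h | h
    · exact ⟨α' - α, Or.inr (by omega)⟩
    · exact ⟨α - α', Or.inl (by omega)⟩
  · rw [replicate_add, add_assoc] at p ⊢
    refine D.near_of_prod_eq p ?_ k3' ?_ (by omega)
    · intro u hu
      rcases Multiset.mem_add.1 hu with hu | hu
      exacts [Multiset.eq_of_mem_replicate hu ▸ D.irr, k3 u hu]
    · simp only [card_add, card_replicate]; omega
  · rw [replicate_add, add_assoc] at p ⊢
    refine D.near_of_prod_eq p k3 ?_ (by omega) ?_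
    · intro u hu
      rcases Multiset.mem_add.1 hu with hu | hu
      exacts [Multiset.eq_of_mem_replicate hu ▸ D.irr, k3' u hu]
    · simp only [card_add, card_replicate]; omega

/-- A factorization far from maximal length is lengthened by replacing the atoms `T` other than `m` by
`m ^ (card T + Δ - 2)` and two atoms; a factorization far from minimal length is shortened by
replacing `m ^ (Δ + 2)` by two atoms. -/
theorem shiftable (D : SplitData E ι) (q : ℕ) (hq : 1 ≤ q) : Shiftable E (q * (D.f + 2)) := by
  set Δ := q * (D.f + 2) with hΔ
  have hΔf : D.f + 2 ≤ Δ := by rw [hΔ]; exact Nat.le_mul_of_pos_left _ hq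
  have hXY : ∀ X Y : E, Irreducible X → Irreducible Y → ∀ n, ∀ u ∈ replicate n D.m + {X, Y},
      Irreducible u := by
    intro X Y hX hY n u hu
    simp only [mem_add, mem_replicate, insert_eq_cons, mem_cons, mem_singleton] at hu
    rcases hu with hu | rfl | rfl
    exacts [hu.2 ▸ D.irr, hX, hY]
  refine ⟨2 * Δ + D.f + 10, 2 * Δ + D.f + 10, fun z z' hz hz' hp hC => ⟨?_, ?_⟩⟩
  · obtain ⟨α, T, k1, k2, k3⟩ := D.normal_form' z hz
    have c1 := k1.card_eq
    simp only [card_add, card_replicate] at c1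
    -- as `z'` is much longer than `z`, the value of `T` is much larger than `card T` times that of `m`
    obtain ⟨X, Y, hX, hY, e⟩ := D.flex T.prod (D.m ^ (card T + Δ - 2)) (by
      intro i
      have h1 := D.card_mul_le i z' hz'
      have h2 : D.v i z'.prod = α * D.v i D.m + D.v i T.prod := by
        rw [← hp, k1.prod_eq, prod_add, D.v_mul, prod_replicate, D.v_pow]
      have h3 : (α + card T + (2 * Δ + D.f + 10)) * D.v i D.m ≤ card z' * D.v i D.m :=
        Nat.mul_le_mul_right _ (by omega)
      have h4 := D.pos i
      rw [D.v_pow]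
      have h5 : (card T + Δ - 2) * D.v i D.m + (Δ + D.f) * D.v i D.m ≤
          (card T + (2 * Δ + D.f + 10)) * D.v i D.m := by
        rw [← add_mul]; exact Nat.mul_le_mul_right _ (by omega)
      have h6 : (Δ + D.f) * 1 ≤ (Δ + D.f) * D.v i D.m := Nat.mul_le_mul_left _ h4
      have h7 : (α + card T + (2 * Δ + D.f + 10)) * D.v i D.m =
        α * D.v i D.m + (card T + (2 * Δ + D.f + 10)) * D.v i D.m := by ring
      omega)
    refine ⟨_, replicate α D.m + (replicate (card T + Δ - 2) D.m + {X, Y}), k1.mono (by omega),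
      (Near.of_small ?_ k3 (hXY X Y hX hY _) (by omega) ?_).add_left _, ?_⟩
    · simp only [e, prod_add, prod_replicate, insert_eq_cons, prod_cons, prod_singleton]
    · simp; omega
    · simp; omega
  · obtain ⟨α, T, k1, k2, k3⟩ := D.normal_form' z' hz'
    have c1 := k1.card_eq
    simp only [card_add, card_replicate] at c1
    obtain ⟨X, Y, hX, hY, e⟩ := D.flex (D.m ^ (Δ + 2)) 1 (by
      intro i
      have h4 := D.pos i
      rw [D.v_pow, D.v_one]
      have : (Δ + 2) * 1 ≤ (Δ + 2) * D.v i D.m := Nat.mul_le_mul_left _ h4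
      omega)
    have hα : α = (α - (Δ + 2)) + (Δ + 2) := by omega
    refine ⟨_, (replicate (α - (Δ + 2)) D.m + T) + {X, Y}, k1.mono (by omega), ?_, ?_⟩
    · have h : replicate α D.m + T = (replicate (α - (Δ + 2)) D.m + T) + replicate (Δ + 2) D.m := by
        conv_lhs => rw [hα, replicate_add]
        abel
      rw [h]
      refine (Near.of_small ?_ ?_ ?_ ?_ ?_).add_left _
      · simp only [e, one_mul, prod_replicate, insert_eq_cons, prod_cons, prod_singleton]
      · intro u hu; exact Multiset.eq_of_mem_replicate hu ▸ D.irr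
      · simp [hX, hY]
      · simp; omega
      · simp
    · simp; omega

end SplitData

end MonoidArith

/-! ### One valuation -/

namespace MonoidArith

open Multiset Relation

namespace NonsplitData

variable {E : Type*} [CommMonoid E]

/-- The minimal value of a non-unit. -/
def r (D : NonsplitData E) : ℕ := D.v () D.m

variable (D : NonsplitData E)

theorem one_le_r : 1 ≤ D.r := D.pos ()

theorem r_le_s : D.r ≤ D.s := D.le_s D.m D.irr

theorem v_prod_le (z : Multiset E) (hz : ∀ u ∈ z, Irreducible u) :
    D.v () z.prod ≤ card z * D.s := by
  rw [D.v_prod]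
  induction z using Multiset.induction_on with
  | empty => simp
  | cons a z ih =>
    have h1 := ih fun u hu => hz u (Multiset.mem_cons_of_mem hu)
    have h2 := D.le_s a (hz a (Multiset.mem_cons_self _ _))
    simp only [card_cons, map_cons, sum_cons]
    linarith

theorem atoms_replicate_add {X Y : E} (hX : Irreducible X) (hY : Irreducible Y) (a b : ℕ) :
    ∀ u ∈ replicate a D.m + replicate b D.w₀ + {X, Y}, Irreducible u := by
  intro u hu
  simp only [mem_add, mem_replicate, insert_eq_cons, mem_cons, mem_singleton] at hu
  rcases hu with (hu | hu) | rfl | rfl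
  exacts [hu.2 ▸ D.irr, hu.2 ▸ D.irr_w₀, hX, hY]

/-- Every factorization can be rewritten, at equal length, such that boundedly many atoms different from
`m` and `w₀` are left. Among many atoms, many have the same value `j`. If `j = r`, two of them are
merged into `m` and another atom; otherwise `4 * (s - r)` of them have the same value as a product of
`4 * (s - j)` copies of `m` and `4 * (j - r)` atoms of value `s`, of which all but two can be taken to
be `w₀`. -/
theorem normal_form [DecidableEq E] (hrs : D.r < D.s) (z : Multiset E)
    (hz : ∀ u ∈ z, Irreducible u) :
    ∃ z₁, EqConn (4 * D.s) z z₁ ∧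
      card (z₁.filter (fun u => u ≠ D.m ∧ u ≠ D.w₀)) ≤ (D.s + 1) * (4 * D.s) := by
  classical
  refine exists_eqConn_card_filter_le (fun T hT hTm hB => ?_) z hz
  have hr1 := D.one_le_r
  obtain ⟨j, hj⟩ : ∃ j, 4 * D.s < card (T.filter (fun u => D.v () u = j)) := by
    by_contra! hcon
    exact absurd (card_le_of_count_le T (D.v ()) _ _
      (fun u hu => Nat.lt_succ_of_le (D.le_s u (hT u hu))) hcon) (not_le.2 hB)
  by_cases hjr : j = D.r
  · obtain ⟨u, u', hle, hu, hu'⟩ := exists_pair_le (q := fun u => D.v () u = j) T (by omega)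
    obtain ⟨S', h1, h2⟩ := D.eqStep_merge () u u' (hT u (Multiset.mem_of_le hle (by simp)))
      (hT u' (Multiset.mem_of_le hle (by simp))) (hu.trans hjr) (hu'.trans hjr)
    refine ⟨_, hle, S', ⟨h1.1.mono (by omega), h1.2⟩, ?_⟩
    have : card (S'.filter (fun u => u ≠ D.m ∧ u ≠ D.w₀)) ≤ card (S'.filter (· ≠ D.m)) :=
      Multiset.card_le_card (Multiset.monotone_filter_right _ fun _ h => h.1)
    simp only [insert_eq_cons, card_cons, card_singleton]
    omega
  · obtain ⟨x, hx⟩ : ∃ x, D.s = D.r + x := ⟨D.s - D.r, by omega⟩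
    obtain ⟨S, hS, hc⟩ := exists_le_card (T.filter (fun u => D.v () u = j)) (n := 4 * x) (by omega)
    have hST : S ≤ T := hS.trans (Multiset.filter_le _ _)
    have hSa : ∀ u ∈ S, Irreducible u := fun u hu => hT u (Multiset.mem_of_le hST hu)
    have hSv : ∀ u ∈ S, D.v () u = j := fun u hu =>
      (Multiset.mem_filter.1 (Multiset.mem_of_le hS hu)).2
    have hv : D.v () S.prod = 4 * x * j := by
      rw [D.v_prod, Multiset.map_congr rfl hSv]
      simp [hc]
    obtain ⟨u, hu⟩ := Multiset.card_pos_iff_exists_mem.1 (show 0 < card S by omega)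
    have hjs : j ≤ D.s := hSv u hu ▸ D.le_s u (hSa u hu)
    have hjr' : D.r ≤ j := hSv u hu ▸ D.le () u (hSa u hu).not_isUnit
    obtain ⟨e, rfl⟩ : ∃ e, j = D.r + (e + 1) := ⟨j - D.r - 1, by omega⟩
    obtain ⟨y, rfl⟩ : ∃ y, x = y + (e + 1) := ⟨x - (e + 1), by omega⟩
    obtain ⟨X, Y, hX, hY, h⟩ := D.flex S.prod (D.m ^ (4 * y) * D.w₀ ^ (4 * e + 2)) (by
      have h1 : D.v () D.m = D.r := rfl
      rw [hv, D.v_mul, D.v_pow, D.v_pow, D.v_w₀, hx, h1]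
      ring)
    refine ⟨S, hST, replicate (4 * y) D.m + replicate (4 * e + 2) D.w₀ + {X, Y},
      ⟨Near.of_small ?_ hSa (D.atoms_replicate_add hX hY _ _) (by omega) ?_, ?_⟩, ?_⟩
    · simp only [h, prod_add, prod_replicate, insert_eq_cons, prod_cons, prod_singleton]
    · simp only [card_add, card_replicate, insert_eq_cons, card_cons, card_singleton]; omega
    · simp only [card_add, card_replicate, insert_eq_cons, card_cons, card_singleton]; omega
    · have h0 : (replicate (4 * y) D.m + replicate (4 * e + 2) D.w₀).filter
          (fun u => u ≠ D.m ∧ u ≠ D.w₀) = 0 := by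
        rw [Multiset.filter_eq_nil]
        intro a ha
        rcases Multiset.mem_add.1 ha with ha | ha
        · simp [Multiset.eq_of_mem_replicate ha]
        · simp [Multiset.eq_of_mem_replicate ha]
      have h1 : card (({X, Y} : Multiset E).filter (fun u => u ≠ D.m ∧ u ≠ D.w₀)) ≤
          card ({X, Y} : Multiset E) := Multiset.card_le_card (Multiset.filter_le _ _)
      rw [Multiset.filter_add, card_add, h0, hc]
      simp only [insert_eq_cons, card_cons, card_singleton, card_zero] at h1 ⊢
      omega

/-- Up to steps of bounded distance that keep the length, every factorization consists of copies of
`m`, copies of `w₀`, and boundedly many other atoms. -/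
theorem normal_form' (hrs : D.r < D.s) (z : Multiset E) (hz : ∀ u ∈ z, Irreducible u) :
    ∃ α β T, EqConn (4 * D.s) z (replicate α D.m + replicate β D.w₀ + T) ∧
      card T ≤ (D.s + 1) * (4 * D.s) ∧ ∀ u ∈ T, Irreducible u := by
  classical
  obtain ⟨z₁, h1, h2⟩ := D.normal_form hrs z hz
  have hne : D.w₀ ≠ D.m := by
    intro h
    have := D.v_w₀
    rw [h] at this
    exact hrs.ne this
  refine ⟨count D.m z₁, count D.w₀ z₁, _, ?_, h2, fun u hu =>
    h1.atoms hz u (Multiset.mem_of_mem_filter hu)⟩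
  convert h1
  rw [← Multiset.filter_eq', ← Multiset.filter_eq']
  conv_rhs => rw [← Multiset.filter_add_not (· = D.m) z₁]
  rw [add_assoc]
  congr 1
  conv_rhs => rw [← Multiset.filter_add_not (· = D.w₀) (z₁.filter (fun u => ¬ u = D.m))]
  rw [Multiset.filter_filter, Multiset.filter_filter]
  congr 1
  · refine Multiset.filter_congr fun u _ => ⟨fun h => ⟨h, h ▸ hne⟩, fun h => h.1⟩
  · refine Multiset.filter_congr fun u _ => by tauto

theorem v_normal (α β : ℕ) (T : Multiset E) :
    D.v () (replicate α D.m + replicate β D.w₀ + T).prod = α * D.r + β * D.s + D.v () T.prod := by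
  simp only [prod_add, prod_replicate, D.v_mul, D.v_pow, D.v_w₀]
  rfl

/-- In normal form, the value and the length determine the numbers of copies of `m` and of `w₀` up to a
bounded error. -/
theorem closeLengths (D : NonsplitData E) (hrs : D.r < D.s) : CloseLengths E := by
  classical
  intro C
  set B := (D.s + 1) * (4 * D.s) with hB
  set M := B * D.s + D.r * (C + B) + (C + B) with hM
  refine ⟨2 * M + 2 * B + 4 * D.s + C, fun z z' hz hz' hp h1 h2 => ?_⟩
  obtain ⟨α, β, T, k1, k2, k3⟩ := D.normal_form' hrs z hz
  obtain ⟨α', β', T', k1', k2', k3'⟩ := D.normal_form' hrs z' hz'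
  have c1 := k1.card_eq
  have c1' := k1'.card_eq
  simp only [card_add, card_replicate] at c1 c1'
  have p : (replicate α D.m + replicate β D.w₀ + T).prod =
      (replicate α' D.m + replicate β' D.w₀ + T').prod := by
    rw [← k1.prod_eq, ← k1'.prod_eq, hp]
  have hv := congrArg (D.v ()) p
  rw [D.v_normal, D.v_normal] at hv
  have t1 := (D.v_prod_le T k3).trans (Nat.mul_le_mul_right _ k2)
  have t1' := (D.v_prod_le T' k3').trans (Nat.mul_le_mul_right _ k2')
  rw [← hB] at t1 t1' k2 k2'
  have hr1 := D.one_le_r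
  -- the numbers of copies of `w₀` differ by a bounded amount, as values and lengths are close
  have key : ∀ α β α' β' t t' : ℕ, α * D.r + β * D.s + t = α' * D.r + β' * D.s + t' →
      t' ≤ B * D.s → α' + β' ≤ α + β + (C + B) → β ≤ β' + (B * D.s + D.r * (C + B)) := by
    intro α β α' β' t t' e ht hle
    obtain ⟨x, hx⟩ : ∃ x, D.s = D.r + (x + 1) := ⟨D.s - D.r - 1, by omega⟩
    by_contra! hcon
    obtain ⟨y, hy⟩ : ∃ y, β = β' + y := ⟨β - β', by omega⟩
    have h3 : D.r * (α' + β') ≤ D.r * (α + β + (C + B)) := Nat.mul_le_mul_left _ hle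
    have h4 : (α + β) * D.r + β * (x + 1) + t = (α' + β') * D.r + β' * (x + 1) + t' := by
      rw [hx] at e; linarith
    have h5 : y ≤ y * (x + 1) := Nat.le_mul_of_pos_right _ (by omega)
    have h6 : β * (x + 1) = β' * (x + 1) + y * (x + 1) := by rw [hy]; ring
    have h7 : y ≤ B * D.s + D.r * (C + B) := by linarith
    omega
  have hβ := key α β α' β' _ _ hv t1' (by omega)
  have hβ' := key α' β' α β _ _ hv.symm t1 (by omega)
  have e1 : replicate α D.m + replicate β D.w₀ + T =
      (replicate (min α α') D.m + replicate (min β β') D.w₀) +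
        (replicate (α - min α α') D.m + replicate (β - min β β') D.w₀ + T) := by
    conv_lhs => rw [show α = min α α' + (α - min α α') by omega,
      show β = min β β' + (β - min β β') by omega, replicate_add, replicate_add]
    abel
  have e2 : replicate α' D.m + replicate β' D.w₀ + T' =
      (replicate (min α α') D.m + replicate (min β β') D.w₀) +
        (replicate (α' - min α α') D.m + replicate (β' - min β β') D.w₀ + T') := by
    conv_lhs => rw [show α' = min α α' + (α' - min α α') by omega,
      show β' = min β β' + (β' - min β β') by omega, replicate_add, replicate_add]
    abel
  have hat : ∀ a b : ℕ, ∀ T : Multiset E, (∀ u ∈ T, Irreducible u) →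
      ∀ u ∈ replicate a D.m + replicate b D.w₀ + T, Irreducible u := by
    intro a b T hT u hu
    simp only [mem_add, mem_replicate] at hu
    rcases hu with (hu | hu) | hu
    exacts [hu.2 ▸ D.irr, hu.2 ▸ D.irr_w₀, hT u hu]
  refine ⟨_, _, k1.mono (by omega), k1'.mono (by omega), ?_⟩
  rw [e1, e2] at p ⊢
  refine D.near_of_prod_eq p (hat _ _ _ k3) (hat _ _ _ k3') ?_ ?_
  · simp only [card_add, card_replicate]; omega
  · simp only [card_add, card_replicate]; omega

/-- The lengths are shifted by trading `2 * q * s` copies of `m` for `2 * q * r` atoms of value `s`, where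
two atoms of value `s` are adjusted such that the products agree. -/
theorem shiftable (D : NonsplitData E) (hrs : D.r < D.s) (q : ℕ) (hq : 1 ≤ q) :
    Shiftable E (q * (2 * (D.s - D.r))) := by
  set B := (D.s + 1) * (4 * D.s) with hB
  obtain ⟨x, hx⟩ : ∃ x, D.s = D.r + (x + 1) := ⟨D.s - D.r - 1, by omega⟩
  have hx' : D.s - D.r = x + 1 := by omega
  have hr1 := D.one_le_r
  obtain ⟨p, hp⟩ : ∃ p, q * D.r = p + 1 :=
    ⟨q * D.r - 1, by have := Nat.mul_le_mul hq hr1; omega⟩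
  have hqs : q * D.s = p + 1 + q * (x + 1) := by rw [hx, mul_add, hp]
  have hΔ : q * (2 * (x + 1)) = 2 * (q * (x + 1)) := by ring
  rw [hx', hΔ]
  set Δ := q * (x + 1)
  set C := B * D.s + B + (2 * (p + 1 + Δ) + 2) * (x + 1) + 4 * D.s with hC
  have hBs : 0 ≤ B * D.s := Nat.zero_le _
  refine ⟨C, 2 * (p + 1 + Δ) + 4 + 4 * D.s, fun z z' hz hz' hpr hle => ⟨?_, ?_⟩⟩
  · obtain ⟨α, β, T, k1, k2, k3⟩ := D.normal_form' hrs z hz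
    have c1 := k1.card_eq
    simp only [card_add, card_replicate] at c1
    have hv := D.card_mul_le () z' hz'
    rw [← hpr, k1.prod_eq, D.v_normal] at hv
    change card z' * D.r ≤ _ at hv
    have t1 := (D.v_prod_le T k3).trans (Nat.mul_le_mul_right _ k2)
    rw [← hB] at t1 k2
    -- with few copies of `w₀`, the factorization `z` would be almost as long as possible
    have hβ : 2 * (p + 1) + 2 ≤ β := by
      by_contra! hcon
      have h1 : (α + β + C) * D.r ≤ card z' * D.r := Nat.mul_le_mul_right _ (by omega)
      have h2 : C ≤ C * D.r := Nat.le_mul_of_pos_right _ hr1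
      have h3 : α * D.r + β * D.s = (α + β) * D.r + β * (x + 1) := by rw [hx]; ring
      have h4 : β * (x + 1) ≤ (2 * (p + 1 + Δ) + 2) * (x + 1) := Nat.mul_le_mul_right _ (by omega)
      have h5 : (α + β + C) * D.r = (α + β) * D.r + C * D.r := by ring
      omega
    obtain ⟨X, Y, hX, hY, h⟩ := D.flex (D.w₀ ^ (2 * (p + 1) + 2)) (D.m ^ (2 * (p + 1 + Δ))) (by
      have h1 : D.v () D.m = D.r := rfl
      rw [D.v_pow, D.v_pow, D.v_w₀, h1]
      have : (p + 1 + Δ) * D.r = (p + 1) * D.s := by rw [← hqs, ← hp]; ring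
      linarith)
    refine ⟨_, (replicate α D.m + replicate (β - (2 * (p + 1) + 2)) D.w₀ + T) +
      (replicate (2 * (p + 1 + Δ)) D.m + replicate 0 D.w₀ + {X, Y}), k1.mono (by omega), ?_, ?_⟩
    · have e : replicate α D.m + replicate β D.w₀ + T =
          (replicate α D.m + replicate (β - (2 * (p + 1) + 2)) D.w₀ + T) +
            replicate (2 * (p + 1) + 2) D.w₀ := by
        conv_lhs => rw [show β = (β - (2 * (p + 1) + 2)) + (2 * (p + 1) + 2) by omega,
          replicate_add]
        abel
      rw [e]
      refine (Near.of_small ?_ ?_ (D.atoms_replicate_add hX hY _ _) ?_ ?_).add_left _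
      · simp only [h, prod_add, prod_replicate, insert_eq_cons, prod_cons, prod_singleton, pow_zero,
          mul_one]
      · intro u hu; exact Multiset.eq_of_mem_replicate hu ▸ D.irr_w₀
      · simp only [card_replicate]; omega
      · simp only [card_add, card_replicate, insert_eq_cons, card_cons, card_singleton]; omega
    · simp only [card_add, card_replicate, insert_eq_cons, card_cons, card_singleton]; omega
  · obtain ⟨α, β, T, k1, k2, k3⟩ := D.normal_form' hrs z' hz'
    have c1 := k1.card_eq
    simp only [card_add, card_replicate] at c1
    have hv := D.v_prod_le z hz
    rw [hpr, k1.prod_eq, D.v_normal] at hv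
    -- with few copies of `m`, the factorization `z'` would be almost as short as possible
    have hα : 2 * (p + 1 + Δ) ≤ α := by
      by_contra! hcon
      have h1 : (card z + C) * D.s ≤ (α + β + B) * D.s := Nat.mul_le_mul_right _ (by omega)
      have h2 : C ≤ C * D.s := Nat.le_mul_of_pos_right _ (by omega)
      have h3 : (α + β + B) * D.s = α * D.r + β * D.s + α * (x + 1) + B * D.s := by rw [hx]; ring
      have h4 : α * (x + 1) ≤ (2 * (p + 1 + Δ) + 2) * (x + 1) := Nat.mul_le_mul_right _ (by omega)
      have h5 : (card z + C) * D.s = card z * D.s + C * D.s := by ring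
      omega
    obtain ⟨X, Y, hX, hY, h⟩ := D.flex (D.m ^ (2 * (p + 1 + Δ))) (D.w₀ ^ (2 * p)) (by
      have h1 : D.v () D.m = D.r := rfl
      rw [D.v_pow, D.v_pow, D.v_w₀, h1]
      have : (p + 1 + Δ) * D.r = (p + 1) * D.s := by rw [← hqs, ← hp]; ring
      linarith)
    refine ⟨_, (replicate (α - 2 * (p + 1 + Δ)) D.m + replicate β D.w₀ + T) +
      (replicate 0 D.m + replicate (2 * p) D.w₀ + {X, Y}), k1.mono (by omega), ?_, ?_⟩
    · have e : replicate α D.m + replicate β D.w₀ + T =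
          (replicate (α - 2 * (p + 1 + Δ)) D.m + replicate β D.w₀ + T) +
            replicate (2 * (p + 1 + Δ)) D.m := by
        conv_lhs => rw [show α = (α - 2 * (p + 1 + Δ)) + 2 * (p + 1 + Δ) by omega,
          replicate_add]
        abel
      rw [e]
      refine (Near.of_small ?_ ?_ (D.atoms_replicate_add hX hY _ _) ?_ ?_).add_left _
      · simp only [h, prod_add, prod_replicate, insert_eq_cons, prod_cons, prod_singleton, pow_zero,
          one_mul]
      · intro u hu; exact Multiset.eq_of_mem_replicate hu ▸ D.irr
      · simp only [card_replicate]; omega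
      · simp only [card_add, card_replicate, insert_eq_cons, card_cons, card_singleton]; omega
    · simp only [card_add, card_replicate, insert_eq_cons, card_cons, card_singleton]; omega

end NonsplitData

/-! ### Merging all atoms into powers of one atom -/

/-- Any two factorizations of an element have the same length, and they are linked by steps that
exchange at most two atoms. -/
def TwoConnected (E : Type*) [CommMonoid E] : Prop :=
  ∀ z z' : Multiset E, (∀ u ∈ z, Irreducible u) → (∀ u ∈ z', Irreducible u) →
    z.prod = z'.prod → EqConn 2 z z'

/-- If all atoms have the same value under an additive function which is at least that large on all
non-units, then every factorization can be merged into copies of `m` and one more atom. -/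
theorem twoConnected_of_additive {E : Type*} [CommMonoid E] (m : E) (hm : Irreducible m)
    (hcancel : ∀ x y, m * x = m * y → x = y)
    (merge : ∀ u u' : E, ¬ IsUnit u → ¬ IsUnit u' → ∃ w, ¬ IsUnit w ∧ u * u' = m * w)
    (l : E → ℕ) (r : ℕ) (hr : 1 ≤ r) (h1 : l 1 = 0) (hmul : ∀ x y, l (x * y) = l x + l y)
    (hle : ∀ u, ¬ IsUnit u → r ≤ l u) (hat : ∀ u, Irreducible u → l u = r) : TwoConnected E := by
  have hirr : ∀ u, ¬ IsUnit u → l u < 2 * r → Irreducible u := by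
    refine fun u hu h => ⟨hu, fun a b hab => ?_⟩
    by_contra! hcon
    have h1 := hle a hcon.1
    have h2 := hle b hcon.2
    rw [hab, hmul] at h
    omega
  have canon : ∀ z : Multiset E, (∀ u ∈ z, Irreducible u) → ∀ n, card z = n + 1 →
      ∃ y, Irreducible y ∧ EqConn 2 z (replicate n m + {y}) := by
    intro z
    induction z using Multiset.induction_on with
    | empty => intro _ n hn; simp at hn
    | cons a z ih =>
      intro hz n hn
      have ha := hz a (Multiset.mem_cons_self _ _)
      cases n with
      | zero =>
        have : z = 0 := by simpa using hn
        subst this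
        exact ⟨a, ha, by simpa using EqConn.refl 2 {a}⟩
      | succ n =>
        obtain ⟨y, hy, hc⟩ := ih (fun u hu => hz u (Multiset.mem_cons_of_mem hu)) n (by simpa using hn)
        obtain ⟨w, hw, e⟩ := merge a y ha.not_isUnit hy.not_isUnit
        have hw' : Irreducible w := by
          refine hirr w hw ?_
          have := congrArg l e
          rw [hmul, hmul, hat a ha, hat y hy, hat m hm] at this
          omega
        refine ⟨w, hw', (hc.add_left {a}).trans (EqStep.conn ?_)⟩
        have hs : Near 2 ({a, y} : Multiset E) {m, w} :=
          Near.of_small (by simpa using e) (by simp [ha, hy]) (by simp [hm, hw']) (by simp) (by simp)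
        have := hs.add_left (replicate n m)
        have e1 : ({a} : Multiset E) + (replicate n m + {y}) = replicate n m + {a, y} := by
          rw [show ({a, y} : Multiset E) = {a} + {y} from rfl]; abel
        have e2 : replicate (n + 1) m + ({w} : Multiset E) = replicate n m + {m, w} := by
          rw [show ({m, w} : Multiset E) = {m} + {w} from rfl, replicate_succ,
            ← singleton_add]
          abel
        rw [e1, e2]
        exact ⟨this, by simp⟩
  have hl : ∀ z : Multiset E, (∀ u ∈ z, Irreducible u) → l z.prod = card z * r := by
    intro z
    induction z using Multiset.induction_on with
    | empty => simp [h1]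
    | cons a z ih =>
      intro hz
      rw [prod_cons, hmul, hat a (hz a (Multiset.mem_cons_self _ _)),
        ih fun u hu => hz u (Multiset.mem_cons_of_mem hu), card_cons]
      ring
  intro z z' hz hz' hp
  have hc : card z = card z' := by
    have := hl z hz
    rw [hp, hl z' hz'] at this
    exact (Nat.eq_of_mul_eq_mul_right hr this).symm
  rcases Nat.eq_zero_or_pos (card z) with h0 | h0
  · obtain rfl := Multiset.card_eq_zero.1 h0
    obtain rfl := Multiset.card_eq_zero.1 (hc.symm.trans h0)
    exact EqConn.refl _ _
  · obtain ⟨n, hn⟩ : ∃ n, card z = n + 1 := ⟨card z - 1, by omega⟩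
    obtain ⟨y, hy, hcy⟩ := canon z hz n hn
    obtain ⟨y', hy', hcy'⟩ := canon z' hz' n (hc ▸ hn)
    have e := hcy.prod_eq.symm.trans (hp.trans hcy'.prod_eq)
    simp only [prod_add, prod_replicate, prod_singleton] at e
    have : ∀ k : ℕ, m ^ k * y = m ^ k * y' → y = y' := by
      intro k
      induction k with
      | zero => simp
      | succ k ih =>
        intro h
        exact ih (hcancel _ _ (by rw [← mul_assoc, ← mul_assoc, ← pow_succ', h]))
    rw [this n e] at hcy
    exact hcy.trans hcy'.symm

theorem NonsplitData.twoConnected {E : Type*} [CommMonoid E] (D : NonsplitData E)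
    (h : D.r = D.s) : TwoConnected E :=
  twoConnected_of_additive D.m D.irr (fun _ _ h => D.cancel _ _ _ h) D.merge (D.v ()) D.r D.one_le_r
    (D.v_one ()) (D.v_mul ()) (D.le ()) fun u hu =>
      le_antisymm ((D.le_s u hu).trans h.ge) (D.le () u hu.not_isUnit)

end MonoidArith

/-! ### Lengths and catenary degrees of reduced monoids -/

namespace MonoidArith

open Multiset Relation

section Reduced

variable {H : Type*} [CommMonoid H]

theorem eq_empty_of_prod_eq_one [Subsingleton Hˣ] {z : Multiset H} (hz : ∀ u ∈ z, Irreducible u)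
    (h : z.prod = 1) : z = 0 := by
  by_contra hne
  obtain ⟨u, hu⟩ := Multiset.exists_mem_of_ne_zero hne
  exact (hz u hu).not_isUnit (isUnit_of_dvd_one (h ▸ Multiset.dvd_prod hu))

theorem irreducible_associates_mk_iff [Subsingleton Hˣ] {u : H} :
    Irreducible (Associates.mk u) ↔ Irreducible u :=
  MulEquiv.irreducible_iff (MulEquiv.ofBijective (Associates.mkMonoidHom (M := H))
    ⟨Associates.mk_injective, Associates.mk_surjective⟩)

/-- In a reduced monoid, factorizations are multisets of atoms of the monoid itself. -/
theorem mem_factorizations_iff [Subsingleton Hˣ] {a : H} {z : Multiset (Associates H)} :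
    z ∈ factorizations a ↔
      ∃ w : Multiset H, (∀ u ∈ w, Irreducible u) ∧ w.prod = a ∧ z = w.map Associates.mk := by
  constructor
  · rintro ⟨h1, h2⟩
    obtain ⟨w, rfl⟩ := Multiset.map_surjective_of_surjective Associates.mk_surjective z
    refine ⟨w, fun u hu => ?_, ?_, rfl⟩
    · exact irreducible_associates_mk_iff.1 (h1 _ (Multiset.mem_map_of_mem _ hu))
    · rw [Associates.prod_mk] at h2
      exact Associates.mk_injective h2
  · rintro ⟨w, h1, rfl, rfl⟩
    refine ⟨fun u hu => ?_, Associates.prod_mk⟩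
    obtain ⟨x, hx, rfl⟩ := Multiset.mem_map.1 hu
    exact irreducible_associates_mk_iff.2 (h1 x hx)

theorem mem_lengths_iff [Subsingleton Hˣ] {a : H} {k : ℕ} :
    k ∈ lengths a ↔ ∃ w : Multiset H, (∀ u ∈ w, Irreducible u) ∧ w.prod = a ∧ card w = k := by
  constructor
  · rintro ⟨z, hz, rfl⟩
    obtain ⟨w, h1, h2, rfl⟩ := mem_factorizations_iff.1 hz
    exact ⟨w, h1, h2, by simp⟩
  · rintro ⟨w, h1, h2, rfl⟩
    exact ⟨_, mem_factorizations_iff.2 ⟨w, h1, h2, rfl⟩, by simp⟩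

theorem lengths_one [Subsingleton Hˣ] : lengths (1 : H) = {0} := by
  ext k
  rw [mem_lengths_iff]
  constructor
  · rintro ⟨w, h1, h2, rfl⟩
    simp [eq_empty_of_prod_eq_one h1 h2]
  · rintro rfl
    exact ⟨0, by simp, by simp, by simp⟩

theorem factDist_le_of_near {N : ℕ} {z z' : Multiset H} (h : Near N z z') :
    factDist (z.map Associates.mk) (z'.map Associates.mk) ≤ N := by
  classical
  obtain ⟨x, y, y', rfl, rfl, h1, h2, -⟩ := h
  unfold factDist
  rw [Multiset.map_add, Multiset.map_add]
  refine max_le ?_ ?_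
  · refine (Multiset.card_le_card (t := y.map Associates.mk) ?_).trans (by simpa)
    rw [tsub_le_iff_right, add_comm (y.map _), add_assoc, add_comm (y'.map _), ← add_assoc]
    exact Multiset.le_add_right _ _
  · refine (Multiset.card_le_card (t := y'.map Associates.mk) ?_).trans (by simpa)
    rw [tsub_le_iff_right, add_comm (y'.map _), add_assoc, add_comm (y.map _), ← add_assoc]
    exact Multiset.le_add_right _ _

theorem exists_seq_of_reflTransGen {α : Type*} {r : α → α → Prop} {a b : α}
    (h : ReflTransGen r a b) :
    ∃ (k : ℕ) (c : ℕ → α), c 0 = a ∧ c k = b ∧ ∀ i < k, r (c i) (c (i + 1)) := by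
  induction h using ReflTransGen.head_induction_on with
  | refl => exact ⟨0, fun _ => b, rfl, rfl, by simp⟩
  | head h _ ih =>
    rename_i a c _
    obtain ⟨k, f, h0, hk, hs⟩ := ih
    refine ⟨k + 1, fun n => Nat.casesOn n a f, rfl, hk, fun i hi => ?_⟩
    cases i with
    | zero => simpa [h0] using h
    | succ i => exact hs i (by omega)

/-- The factorization chain attached to a sequence of steps that do not decrease the length. -/
theorem UpConn.exists_chain [Subsingleton Hˣ] {N : ℕ} {z z' : Multiset H} (h : UpConn N z z')
    (hz : ∀ u ∈ z, Irreducible u) :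
    ∃ k c, IsChainOfFact z.prod (N : ℕ∞) (z.map Associates.mk) (z'.map Associates.mk) k c ∧
      ∀ i < k, card (c i) ≤ card (c (i + 1)) := by
  obtain ⟨k, c, h0, hk, hs⟩ := exists_seq_of_reflTransGen h
  have hc : ∀ i ≤ k, (∀ u ∈ c i, Irreducible u) ∧ (c i).prod = z.prod := by
    intro i
    induction i with
    | zero => intro _; rw [h0]; exact ⟨hz, rfl⟩
    | succ i ih =>
      intro hi
      have h1 := ih (by omega)
      have h2 := (hs i (by omega)).1
      exact ⟨h2.atoms h1.1, h2.prod_eq ▸ h1.2⟩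
  refine ⟨k, fun i => (c i).map Associates.mk, ⟨by simp [h0], by simp [hk], fun i hi => ?_,
    fun i hi => ?_⟩, fun i hi => by simpa using (hs i hi).2⟩
  · exact mem_factorizations_iff.2 ⟨c i, (hc i hi).1, (hc i hi).2, rfl⟩
  · exact_mod_cast factDist_le_of_near (hs i hi).1

theorem factDist_comm (z z' : Multiset (Associates H)) : factDist z z' = factDist z' z := by
  unfold factDist
  exact max_comm _ _

theorem catenaryDegree_le_two_of_twoConnected [Subsingleton Hˣ] (h : TwoConnected H) :
    catenaryDegree H ≤ 2 := by
  refine iSup_le fun a => sInf_le fun z hz z' hz' => ?_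
  obtain ⟨w, h1, h2, rfl⟩ := mem_factorizations_iff.1 hz
  obtain ⟨w', h1', h2', rfl⟩ := mem_factorizations_iff.1 hz'
  obtain ⟨k, c, hc, -⟩ := (h w w' h1 h1' (h2.trans h2'.symm)).up.exists_chain h1
  rw [h2] at hc
  exact ⟨k, c, hc⟩

theorem monotoneCatenaryDegree_lt_top [Subsingleton Hˣ] {N : ℕ}
    (h : ∀ z z' : Multiset H, (∀ u ∈ z, Irreducible u) → (∀ u ∈ z', Irreducible u) →
      z.prod = z'.prod → card z ≤ card z' → UpConn N z z') : monotoneCatenaryDegree H < ⊤ := by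
  refine lt_of_le_of_lt (b := (N : ℕ∞)) ?_ (ENat.natCast_lt_top N)
  refine iSup_le fun a => sInf_le fun z hz z' hz' => ?_
  obtain ⟨w, h1, h2, rfl⟩ := mem_factorizations_iff.1 hz
  obtain ⟨w', h1', h2', rfl⟩ := mem_factorizations_iff.1 hz'
  rcases le_total (card w) (card w') with hle | hle
  · obtain ⟨k, c, hc, hm⟩ := (h w w' h1 h1' (h2.trans h2'.symm) hle).exists_chain h1
    rw [h2] at hc
    exact ⟨k, c, hc, Or.inl hm⟩
  · obtain ⟨k, c, hc, hm⟩ := (h w' w h1' h1 (h2'.trans h2.symm) hle).exists_chain h1'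
    rw [h2'] at hc
    obtain ⟨c0, ck, cf, cd⟩ := hc
    refine ⟨k, fun i => c (k - i), ⟨by simpa using ck, by simpa using c0,
      fun i _ => cf _ (by omega), fun i hi => ?_⟩, Or.inr fun i hi => ?_⟩
    · have := cd (k - (i + 1)) (by omega)
      rw [show k - (i + 1) + 1 = k - i by omega] at this
      rwa [factDist_comm]
    · have := hm (k - (i + 1)) (by omega)
      rwa [show k - (i + 1) + 1 = k - i by omega] at this

theorem isHalfFactorial_of_twoConnected [Subsingleton Hˣ] (hat : IsAtomicMonoid H)
    (h : TwoConnected H) : IsHalfFactorial H := by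
  refine ⟨hat, fun a => ?_⟩
  obtain ⟨w, h1, h2⟩ : ∃ w : Multiset H, (∀ u ∈ w, Irreducible u) ∧ w.prod = a := by
    by_cases ha : IsUnit a
    · exact ⟨0, by simp, by simp [isUnit_iff_eq_one.1 ha]⟩
    · exact hat a ha
  refine ⟨card w, Set.eq_singleton_iff_unique_mem.2 ⟨mem_lengths_iff.2 ⟨w, h1, h2, rfl⟩, ?_⟩⟩
  intro k hk
  obtain ⟨w', h1', h2', rfl⟩ := mem_lengths_iff.1 hk
  exact (h w' w h1' h1 (h2'.trans h2.symm)).card_eq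

/-- Cancelling the common part of two factorizations at distance at most two leaves at most two
atoms on either side, and then equally many. -/
theorem card_eq_of_card_sub_le_two {A : Type*} [CommMonoid A] [DecidableEq A] [Subsingleton Aˣ]
    {a : A} (hc : ∀ x y y', x * y = a → x * y' = a → y = y') {z z' : Multiset A}
    (hz : ∀ u ∈ z, Irreducible u) (hz' : ∀ u ∈ z', Irreducible u) (h : z.prod = a)
    (h' : z'.prod = a) (h1 : card (z - z') ≤ 2) (h2 : card (z' - z) ≤ 2) : card z = card z' := by
  have e1 : z ∩ z' + (z - z') = z := by rw [add_comm, Multiset.sub_add_inter]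
  have e2 : z ∩ z' + (z' - z) = z' := by rw [add_comm, Multiset.inter_comm, Multiset.sub_add_inter]
  have hp : (z - z').prod = (z' - z).prod :=
    hc (z ∩ z').prod _ _ (by rw [← prod_add, e1, h]) (by rw [← prod_add, e2, h'])
  have hy : ∀ u ∈ z - z', Irreducible u := fun u hu =>
    hz u (Multiset.mem_of_le (Multiset.sub_le_self _ _) hu)
  have hy' : ∀ u ∈ z' - z, Irreducible u := fun u hu =>
    hz' u (Multiset.mem_of_le (Multiset.sub_le_self _ _) hu)
  have key : ∀ y y' : Multiset A, (∀ u ∈ y, Irreducible u) → (∀ u ∈ y', Irreducible u) →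
      y.prod = y'.prod → card y' ≤ 2 → card y' ≤ card y := by
    intro y y' hy hy' hp h2
    by_contra! hlt
    have : card y = 0 ∨ (card y = 1 ∧ card y' = 2) := by omega
    rcases this with h0 | ⟨h1, h2⟩
    · rw [Multiset.card_eq_zero.1 h0, prod_zero] at hp
      rw [eq_empty_of_prod_eq_one hy' hp.symm] at hlt
      simp at hlt
    · obtain ⟨u, rfl⟩ := Multiset.card_eq_one.1 h1
      obtain ⟨p, q, rfl⟩ := Multiset.card_eq_two.1 h2
      have hu := hy u (by simp)
      rcases hu.isUnit_or_isUnit (show u = p * q by simpa using hp) with hh | hh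
      · exact (hy' p (by simp)).not_isUnit hh
      · exact (hy' q (by simp)).not_isUnit hh
  have : card (z - z') = card (z' - z) :=
    le_antisymm (key _ _ hy' hy hp.symm h1) (key _ _ hy hy' hp h2)
  have c1 := congrArg card e1
  have c2 := congrArg card e2
  rw [card_add] at c1 c2
  omega

/-- If the catenary degree is at most two, then all factorizations of an element whose divisors can
be cancelled have the same length. -/
theorem card_eq_of_catenaryDegree_le_two [Subsingleton Hˣ] (h : catenaryDegree H ≤ 2) {a : H}
    (hc : ∀ x y y', x * y = a → x * y' = a → y = y') {z z' : Multiset H}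
    (hz : ∀ u ∈ z, Irreducible u) (hz' : ∀ u ∈ z', Irreducible u) (hp : z.prod = a)
    (hp' : z'.prod = a) : card z = card z' := by
  classical
  have h2 : catenaryDegreeOf a ≤ 2 := (le_iSup _ a).trans h
  unfold catenaryDegreeOf at h2
  set S := {N : ℕ∞ | ∀ z ∈ factorizations a, ∀ z' ∈ factorizations a,
    ∃ k c, IsChainOfFact a N z z' k c}
  have hS : S.Nonempty := by
    by_contra hne
    rw [Set.not_nonempty_iff_eq_empty.1 hne, sInf_empty] at h2
    exact absurd h2 (by simp)
  obtain ⟨k, c, c0, ck, cf, cd⟩ := csInf_mem hS _ (mem_factorizations_iff.2 ⟨z, hz, hp, rfl⟩) _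
    (mem_factorizations_iff.2 ⟨z', hz', hp', rfl⟩)
  have hc' : ∀ x y y', x * y = Associates.mk a → x * y' = Associates.mk a → y = y' := by
    intro x y y' h1 h2
    obtain ⟨x, rfl⟩ := Associates.mk_surjective x
    obtain ⟨y, rfl⟩ := Associates.mk_surjective y
    obtain ⟨y', rfl⟩ := Associates.mk_surjective y'
    rw [Associates.mk_mul_mk] at h1 h2
    rw [hc x y y' (Associates.mk_injective h1) (Associates.mk_injective h2)]
  have hstep : ∀ i ≤ k, card (c i) = card z := by
    intro i
    induction i with
    | zero => intro _; simp [c0]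
    | succ i ih =>
      intro hi
      rw [← ih (by omega)]
      have hd : factDist (c i) (c (i + 1)) ≤ 2 := by
        exact_mod_cast (cd i (by omega)).trans h2
      unfold factDist at hd
      have f1 := cf i (by omega)
      have f2 := cf (i + 1) hi
      refine (card_eq_of_card_sub_le_two hc' f1.1 f2.1 f1.2 f2.2 ?_ ?_).symm
      · convert (le_max_left _ _).trans hd
      · convert (le_max_right _ _).trans hd
  have := hstep k le_rfl
  rw [ck] at this
  simpa using this.symm

end Reduced

/-! ### Krull monoids and transfer homomorphisms -/

section Krull

theorem inQuot_of {B : Type*} [CommMonoid B] (b : B) : Algebra.GrothendieckGroup.of b ∈ inQuot B :=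
  ⟨b, rfl⟩

theorem exists_of_div_of {B : Type*} [CommMonoid B] (x : Algebra.GrothendieckGroup B) :
    ∃ a b : B, x = Algebra.GrothendieckGroup.of a / Algebra.GrothendieckGroup.of b := by
  induction x using Localization.ind with
  | H y =>
    obtain ⟨a, b⟩ := y
    refine ⟨a, b, ?_⟩
    rw [eq_div_iff_mul_eq']
    have : (Localization.monoidOf (⊤ : Submonoid B)).mk' a b * Algebra.GrothendieckGroup.of (b : B) =
        Algebra.GrothendieckGroup.of a := Submonoid.LocalizationMap.mk'_spec _ _ _
    rw [← this, ← Localization.mk_eq_monoidOf_mk', mul_comm]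

/-- A cancellative monoid whose divisibility is governed by an additive function with values in the
natural numbers is a Krull monoid. -/
theorem isKrullMonoid_of_rank {B : Type*} [CommMonoid B] [IsCancelMul B] (l : B → ℕ)
    (hmul : ∀ x y, l (x * y) = l x + l y) (hdvd : ∀ x y, l x ≤ l y → x ∣ y) : IsKrullMonoid B where
  cancel := inferInstance
  completelyIntegrallyClosed := by
    rintro x ⟨c, ⟨c, rfl⟩, hx⟩
    obtain ⟨a, b, rfl⟩ := exists_of_div_of x
    have h1 : l 1 = 0 := by have := hmul 1 1; simp at this; exact this
    have hpow : ∀ (y : B) n, l (y ^ n) = n * l y := by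
      intro y n
      induction n with
      | zero => simp [h1]
      | succ n ih => rw [pow_succ, hmul, ih]; ring
    obtain ⟨t, ht⟩ := hx (l c + 1) (by omega)
    have e : t * b ^ (l c + 1) = c * a ^ (l c + 1) := by
      apply Algebra.GrothendieckGroup.of_injective
      simp only [map_mul, map_pow]
      rw [ht, div_pow, mul_assoc, div_mul_cancel]
    have e2 := congrArg l e
    rw [hmul, hmul, hpow, hpow] at e2
    -- `c * (a / b) ^ n` in `B` with `n = l c + 1` shows `n * l b ≤ l c + n * l a`
    have hle : l b ≤ l a := by
      by_contra! hlt
      have : (l c + 1) * (l a + 1) ≤ (l c + 1) * l b := Nat.mul_le_mul_left _ hlt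
      have h3 : (l c + 1) * (l a + 1) = (l c + 1) * l a + (l c + 1) := by ring
      omega
    obtain ⟨d, rfl⟩ := hdvd b a hle
    refine ⟨d, ?_⟩
    rw [map_mul, mul_div_cancel_left]
  mori := by
    intro A hA hmono
    by_cases hne : ∃ k, ∃ b : B, l b = k ∧ ∃ n, Algebra.GrothendieckGroup.of b ∈ A n
    -- an element of minimal rank in the union of the chain divides all others
    · classical
      obtain ⟨b, hb, n, hn⟩ := Nat.find_spec hne
      refine ⟨n, fun m hm => le_antisymm (fun x hx => ?_) (hmono hm)⟩
      obtain ⟨y, rfl⟩ := (hA m).1 hx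
      have hle : l b ≤ l y := by
        rw [hb]
        exact Nat.find_min' hne ⟨y, rfl, m, hx⟩
      obtain ⟨d, rfl⟩ := hdvd b y hle
      rw [← (hA n).2]
      intro z hz
      obtain ⟨w, hw⟩ := hz _ hn
      refine ⟨w * d, ?_⟩
      rw [map_mul, hw, map_mul]
      rw [mul_comm z, mul_right_comm]
    · refine ⟨0, fun m _ => ?_⟩
      have : ∀ n, A n = ∅ := by
        intro n
        rw [Set.eq_empty_iff_forall_notMem]
        intro x hx
        obtain ⟨y, rfl⟩ := (hA n).1 hx
        exact hne ⟨_, y, rfl, n, hx⟩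
      rw [this, this]

/-- The length function of a half-factorial monoid is a transfer homomorphism to the additive monoid
of natural numbers (or to the trivial monoid, if there are no atoms). -/
theorem isTransferKrull_of_isHalfFactorial.{u} {H : Type u} [CommMonoid H] [Subsingleton Hˣ]
    (h : IsHalfFactorial H) : IsTransferKrull H := by
  by_cases hex : ∃ p : H, Irreducible p
  · obtain ⟨p, hp⟩ := hex
    choose l hl using h.2
    have hmem : ∀ {w : Multiset H}, (∀ u ∈ w, Irreducible u) → card w = l w.prod := by
      intro w hw
      have : card w ∈ lengths w.prod := mem_lengths_iff.2 ⟨w, hw, rfl, rfl⟩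
      rw [hl] at this
      exact this
    have hex : ∀ a : H, ∃ w : Multiset H, (∀ u ∈ w, Irreducible u) ∧ w.prod = a := by
      intro a
      have : l a ∈ lengths a := by rw [hl]; rfl
      obtain ⟨w, h1, h2, -⟩ := mem_lengths_iff.1 this
      exact ⟨w, h1, h2⟩
    have hmul : ∀ a b, l (a * b) = l a + l b := by
      intro a b
      obtain ⟨w, h1, rfl⟩ := hex a
      obtain ⟨w', h1', rfl⟩ := hex b
      rw [← hmem h1, ← hmem h1', ← prod_add, ← hmem, card_add]
      intro u hu
      rcases Multiset.mem_add.1 hu with hu | hu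
      exacts [h1 u hu, h1' u hu]
    have hone : l 1 = 0 := by have := hmul 1 1; simp at this; exact this
    let θ : H →* ULift.{u} (Multiplicative ℕ) :=
      { toFun := fun a => ⟨Multiplicative.ofAdd (l a)⟩
        map_one' := by rw [hone]; rfl
        map_mul' := fun a b => by rw [hmul]; rfl }
    let ρ : ULift.{u} (Multiplicative ℕ) → ℕ := fun b => Multiplicative.toAdd b.down
    have hρ : ∀ b c, ρ (b * c) = ρ b + ρ c := fun b c => rfl
    have hρθ : ∀ a, ρ (θ a) = l a := fun a => rfl
    have hρinj : ∀ b c, ρ b = ρ c → b = c := by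
      rintro ⟨b⟩ ⟨c⟩ h
      exact congrArg ULift.up (Multiplicative.toAdd.injective h)
    have : IsCancelMul (ULift.{u} (Multiplicative ℕ)) :=
      { mul_left_cancel := fun a b c h => hρinj _ _ (by
          have := congrArg ρ h
          simp only [hρ] at this
          omega)
        mul_right_cancel := fun a b c h => hρinj _ _ (by
          have := congrArg ρ h
          simp only [hρ] at this
          omega) }
    have hunit : ∀ b, IsUnit b ↔ ρ b = 0 := by
      intro b
      constructor
      · intro hb
        obtain ⟨c, hc⟩ := isUnit_iff_exists_inv.1 hb
        have := congrArg ρ hc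
        rw [hρ] at this
        have h1 : ρ 1 = 0 := rfl
        omega
      · intro hb
        rw [hρinj b 1 hb]
        exact isUnit_one
    refine ⟨ULift.{u} (Multiplicative ℕ), inferInstance, θ, ?_, ?_, ?_, ?_⟩
    · refine isKrullMonoid_of_rank ρ hρ fun x y hxy => ?_
      refine ⟨⟨Multiplicative.ofAdd (ρ y - ρ x)⟩, hρinj _ _ ?_⟩
      rw [hρ]
      change _ = ρ x + (ρ y - ρ x)
      omega
    · intro b
      refine ⟨p ^ ρ b, 1, isUnit_one, hρinj _ _ ?_⟩
      rw [mul_one, hρθ, ← prod_replicate, ← hmem, card_replicate]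
      intro u hu
      rw [Multiset.eq_of_mem_replicate hu]
      exact hp
    · intro a
      rw [hunit, hρθ]
      obtain ⟨w, h1, rfl⟩ := hex a
      rw [← hmem h1]
      constructor
      · intro h0
        rw [Multiset.card_eq_zero.1 h0]
        simp
      · intro h0
        rw [eq_empty_of_prod_eq_one h1 (isUnit_iff_eq_one.1 h0), card_zero]
    · intro u b c hu
      obtain ⟨w, h1, rfl⟩ := hex u
      have e := congrArg ρ hu
      rw [hρθ, ← hmem h1, hρ] at e
      obtain ⟨S, hS, hSc⟩ := exists_le_card w (n := ρ b) (by omega)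
      obtain ⟨R, rfl⟩ := Multiset.le_iff_exists_add.1 hS
      refine ⟨S.prod, R.prod, prod_add _ _, ⟨1, isUnit_one, hρinj _ _ ?_⟩,
        ⟨1, isUnit_one, hρinj _ _ ?_⟩⟩
      · rw [mul_one, hρθ, ← hmem, hSc]
        exact fun u hu => h1 u (Multiset.mem_add.2 (Or.inl hu))
      · rw [mul_one, hρθ, ← hmem]
        · rw [card_add] at e; omega
        · exact fun u hu => h1 u (Multiset.mem_add.2 (Or.inr hu))
  · have htriv : ∀ a : H, IsUnit a := by
      intro a
      by_contra ha
      obtain ⟨s, hs, rfl⟩ := h.1 a ha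
      rcases Multiset.empty_or_exists_mem s with rfl | ⟨u, hu⟩
      · simp at ha
      · exact hex ⟨u, hs u hu⟩
    have hone : ∀ a : H, a = 1 := fun a => isUnit_iff_eq_one.1 (htriv a)
    have : IsCancelMul H :=
      { mul_left_cancel := fun a b c _ => (hone b).trans (hone c).symm
        mul_right_cancel := fun a b c _ => (hone b).trans (hone c).symm }
    refine ⟨H, inferInstance, MonoidHom.id H,
      isKrullMonoid_of_rank (fun _ => 0) (fun _ _ => rfl) fun x y _ => (htriv x).dvd, ?_, ?_, ?_⟩
    · exact fun b => ⟨b, 1, isUnit_one, (mul_one b).symm⟩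
    · exact fun _ => Iff.rfl
    · exact fun u b c h => ⟨b, c, h, ⟨1, isUnit_one, (mul_one b).symm⟩,
        ⟨1, isUnit_one, (mul_one c).symm⟩⟩

theorem IsTransferHom.irreducible {H B : Type*} [CommMonoid H] [CommMonoid B] {θ : H →* B}
    (hθ : IsTransferHom θ) {u : H} (hu : Irreducible u) : Irreducible (θ u) := by
  refine ⟨fun h => hu.not_isUnit ((hθ.isUnit_iff u).1 h), fun b c hbc => ?_⟩
  obtain ⟨v, w, rfl, ⟨e, he, hv⟩, ⟨e', he', hw⟩⟩ := hθ.lift u b c hbc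
  rcases hu.isUnit_or_isUnit rfl with h | h
  · left
    have := (hθ.isUnit_iff v).2 h
    rw [hv] at this
    exact isUnit_of_mul_isUnit_left this
  · right
    have := (hθ.isUnit_iff w).2 h
    rw [hw] at this
    exact isUnit_of_mul_isUnit_left this

/-! ### Bad relations -/

/-- An obstruction to half-factoriality that transfer homomorphisms to Krull monoids respect: a power
of an atom `m` is a product of a different number of atoms `u` such that `u / m` is almost integral
in the quotient group, that is, all its powers have the common denominator `c`. -/
def HasBadRelation (E : Type*) [CommMonoid E] : Prop :=
  ∃ (m c : E) (n : ℕ) (z : Multiset E), Irreducible m ∧ (∀ u ∈ z, Irreducible u) ∧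
    z.prod = m ^ n ∧ card z ≠ n ∧ ∀ u ∈ z, ∀ N : ℕ, m ^ N ∣ c * u ^ N

/-- A bad relation in `E` excludes transfer homomorphisms to Krull monoids, also from a larger monoid `H`
which need not be cancellative: in a Krull monoid, the images of `m` and of the atoms `u` are atoms, of
which the first one divides the others, so that they are all associated. -/
theorem not_isTransferKrull_of_hasBadRelation {E H : Type*} [CommMonoid E] [CommMonoid H]
    (h : HasBadRelation E) (j : E →* H) (hj : ∀ u, Irreducible u → Irreducible (j u)) :
    ¬ IsTransferKrull H := by
  rintro ⟨B, _, θ, hB, hθ⟩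
  obtain ⟨m, c, n, z, hm, hz, hp, hne, hint⟩ := h
  have := hB.cancel
  have hψ : ∀ u, Irreducible u → Irreducible (θ (j u)) := fun u hu => hθ.irreducible (hj u hu)
  -- complete integral closedness makes `θ (j m)` divide, hence be associated to, every `θ (j u)`
  have hass : ∀ u ∈ z, Associated (θ (j m)) (θ (j u)) := by
    intro u hu
    have hx := hB.completelyIntegrallyClosed
      (Algebra.GrothendieckGroup.of (θ (j u)) / Algebra.GrothendieckGroup.of (θ (j m)))
      ⟨_, inQuot_of (θ (j c)), fun N _ => by
        obtain ⟨t, ht⟩ := hint u hu N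
        refine ⟨θ (j t), ?_⟩
        have := congrArg (fun x => Algebra.GrothendieckGroup.of (θ (j x))) ht
        simp only [map_mul, map_pow] at this
        rw [div_pow, ← mul_div_assoc, this, mul_div_cancel_left]⟩
    obtain ⟨y, hy⟩ := hx
    have e : θ (j u) = θ (j m) * y := by
      apply Algebra.GrothendieckGroup.of_injective
      rw [map_mul, hy, mul_div_cancel]
    rcases (hψ u (hz u hu)).isUnit_or_isUnit e with h | h
    · exact absurd h (hψ m hm).not_isUnit
    · exact ⟨h.unit, e.symm⟩
  have hprod : ∀ w ≤ z, Associated ((θ (j m)) ^ card w) (θ (j w.prod)) := by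
    intro w
    induction w using Multiset.induction_on with
    | empty => intro _; simp
    | cons a w ih =>
      intro hw
      rw [card_cons, prod_cons, map_mul, map_mul, pow_succ']
      exact (hass a (Multiset.mem_of_le hw (Multiset.mem_cons_self _ _))).mul_mul
        (ih ((Multiset.le_cons_self _ _).trans hw))
  have := hprod z le_rfl
  rw [hp, map_pow, map_pow] at this
  have hnu := (hψ m hm).not_isUnit
  have key : ∀ a b : ℕ, a < b → Associated (θ (j m) ^ a) (θ (j m) ^ b) → False := by
    rintro a b hab ⟨e, he⟩
    obtain ⟨k, rfl⟩ : ∃ k, b = a + (k + 1) := ⟨b - a - 1, by omega⟩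
    rw [pow_add] at he
    have h2 := mul_left_cancel he
    exact hnu (isUnit_of_dvd_unit (dvd_pow_self _ (Nat.succ_ne_zero k)) (h2 ▸ e.isUnit))
  rcases lt_or_gt_of_ne hne with hlt | hlt
  · exact key _ _ hlt this
  · exact key _ _ hlt this.symm

theorem not_isHalfFactorial_of_hasBadRelation {E H : Type*} [CommMonoid E] [CommMonoid H]
    [Subsingleton Hˣ] (h : HasBadRelation E) (j : E →* H)
    (hj : ∀ u, Irreducible u → Irreducible (j u)) : ¬ IsHalfFactorial H := by
  obtain ⟨m, c, n, z, hm, hz, hp, hne, -⟩ := h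
  rintro ⟨-, h⟩
  obtain ⟨k, hk⟩ := h (j (m ^ n))
  have h1 : n ∈ lengths (j (m ^ n)) := mem_lengths_iff.2 ⟨replicate n (j m), fun u hu =>
    Multiset.eq_of_mem_replicate hu ▸ hj m hm, by simp, by simp⟩
  have h2 : card z ∈ lengths (j (m ^ n)) := mem_lengths_iff.2 ⟨z.map j, fun u hu => by
    obtain ⟨x, hx, rfl⟩ := Multiset.mem_map.1 hu
    exact hj x (hz x hx), by rw [Multiset.prod_hom, hp], by simp⟩
  rw [hk] at h1 h2
  exact hne (h2.trans h1.symm)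

theorem not_catenaryDegree_le_two_of_hasBadRelation {E H : Type*} [CommMonoid E] [CommMonoid H]
    [Subsingleton Hˣ] (h : HasBadRelation E) (j : E →* H)
    (hj : ∀ u, Irreducible u → Irreducible (j u))
    (hc : ∀ a x y y', x * y = j a → x * y' = j a → y = y') : ¬ catenaryDegree H ≤ 2 := by
  obtain ⟨m, c, n, z, hm, hz, hp, hne, -⟩ := h
  intro h
  have := card_eq_of_catenaryDegree_le_two h (hc (m ^ n)) (z := z.map j)
    (z' := replicate n (j m)) (fun u hu => by
      obtain ⟨x, hx, rfl⟩ := Multiset.mem_map.1 hu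
      exact hj x (hz x hx)) (fun u hu => Multiset.eq_of_mem_replicate hu ▸ hj m hm)
    (by rw [Multiset.prod_hom, hp]) (by simp)
  simp at this
  exact hne this

/-- The element `m ^ (f + 3)` is a product of only two atoms. -/
theorem SplitData.hasBadRelation {E ι : Type*} [CommMonoid E] (D : SplitData E ι) :
    HasBadRelation E := by
  obtain ⟨X, Y, hX, hY, e⟩ := D.flex (D.m ^ (D.f + 3)) 1 (by
    intro i
    rw [D.v_one, D.v_pow]
    have := Nat.mul_le_mul_left (D.f + 3) (D.pos i)
    omega)
  refine ⟨D.m, D.m ^ D.f, D.f + 3, {X, Y}, D.irr, by simp [hX, hY], by simpa using e.symm,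
    by simp, fun u hu N => D.dvd _ _ fun i => ?_⟩
  have hu' : Irreducible u := by
    simp only [insert_eq_cons, mem_cons, mem_singleton] at hu
    rcases hu with rfl | rfl
    exacts [hX, hY]
  rw [D.v_mul, D.v_pow, D.v_pow, D.v_pow]
  have h1 := Nat.mul_le_mul_left D.f (D.pos i)
  have h2 := Nat.mul_le_mul_left N (D.le i u hu'.not_isUnit)
  omega

/-- The element `m ^ (2 * s)`, of value `2 * r * s`, is also a product of `2 * r` atoms of value `s`. -/
theorem NonsplitData.exists_relation {E : Type*} [CommMonoid E] (D : NonsplitData E) :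
    ∃ z : Multiset E, (∀ u ∈ z, Irreducible u) ∧ z.prod = D.m ^ (2 * D.s) ∧ card z = 2 * D.r := by
  obtain ⟨p, hp⟩ : ∃ p, D.r = p + 1 := ⟨D.r - 1, by have := D.one_le_r; omega⟩
  obtain ⟨X, Y, hX, hY, e⟩ := D.flex (D.m ^ (2 * D.s)) (D.w₀ ^ (2 * p)) (by
    have h1 : D.v () D.m = p + 1 := hp
    rw [D.v_pow, D.v_pow, D.v_w₀, h1]
    ring)
  refine ⟨replicate 0 D.m + replicate (2 * p) D.w₀ + {X, Y}, D.atoms_replicate_add hX hY _ _, ?_, ?_⟩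
  · simp only [e, prod_add, prod_replicate, insert_eq_cons, prod_cons, prod_singleton, pow_zero,
      one_mul]
  · simp only [card_add, card_replicate, insert_eq_cons, card_cons, card_singleton]; omega

theorem NonsplitData.hasBadRelation {E : Type*} [CommMonoid E] (D : NonsplitData E)
    (hrs : D.r < D.s) : HasBadRelation E := by
  obtain ⟨z, hz, hp, hc⟩ := D.exists_relation
  refine ⟨D.m, D.m ^ D.f, 2 * D.s, z, D.irr, hz, hp, by omega, fun u hu N => D.dvd _ _ fun i => ?_⟩
  rw [D.v_mul, D.v_pow, D.v_pow, D.v_pow]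
  have h1 := Nat.mul_le_mul_left D.f (D.pos i)
  have h2 := Nat.mul_le_mul_left N (D.le i u (hz u hu).not_isUnit)
  omega

end Krull

end MonoidArith

/-! ### Coproducts of monoids -/

namespace MonoidArith

open Multiset Relation

/-- `H` is the coproduct (the restricted product) of the monoids `E i`: an element of `H` is given by
its components `π i a`, almost all of which are `1`, and `σ i` embeds the `i`-th factor. -/
structure Decomp (H : Type*) [CommMonoid H] {ι : Type*} (E : ι → Type*)
    [∀ i, CommMonoid (E i)] where
  π : ∀ i, H →* E i
  σ : ∀ i, E i →* H
  π_σ : ∀ i x, π i (σ i x) = x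
  π_σ_ne : ∀ i j x, i ≠ j → π j (σ i x) = 1
  ext : ∀ a b, (∀ i, π i a = π i b) → a = b
  finite : ∀ a, {i | π i a ≠ 1}.Finite

namespace Decomp

variable {H : Type*} [CommMonoid H] {ι : Type*} {E : ι → Type*} [∀ i, CommMonoid (E i)]
  (D : Decomp H E)

theorem eq_prod [DecidableEq ι] (a : H) (F : Finset ι) (hF : ∀ i, D.π i a ≠ 1 → i ∈ F) :
    a = ∏ i ∈ F, D.σ i (D.π i a) := by
  refine D.ext _ _ fun j => ?_
  rw [map_prod]
  by_cases hj : j ∈ F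
  · rw [Finset.prod_eq_single_of_mem j hj fun i _ hij => D.π_σ_ne i j _ hij, D.π_σ]
  · rw [Finset.prod_eq_one fun i hi => D.π_σ_ne i j _ (fun h => hj (h ▸ hi))]
    by_contra h
    exact hj (hF j h)

variable [∀ i, Subsingleton (E i)ˣ]

theorem irreducible_σ [Subsingleton Hˣ] (i : ι) {x : E i} (hx : Irreducible x) :
    Irreducible (D.σ i x) := by
  refine ⟨fun h => ?_, fun a b hab => ?_⟩
  · have := D.π_σ i x
    rw [isUnit_iff_eq_one.1 h, map_one] at this
    exact hx.not_isUnit (this ▸ isUnit_one)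
  · have h1 : x = D.π i a * D.π i b := by rw [← map_mul, ← hab, D.π_σ]
    have key : ∀ a b : H, D.σ i x = a * b → IsUnit (D.π i a) → IsUnit a := by
      intro a b hab ha
      rw [isUnit_iff_eq_one]
      refine D.ext _ _ fun j => ?_
      rw [map_one]
      by_cases hj : i = j
      · subst hj
        exact isUnit_iff_eq_one.1 ha
      · have := congrArg (D.π j) hab
        rw [D.π_σ_ne i j x hj, map_mul] at this
        exact isUnit_iff_eq_one.1 (IsUnit.of_mul_eq_one _ this.symm)
    rcases hx.isUnit_or_isUnit h1 with h | h
    · exact Or.inl (key a b hab h)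
    · exact Or.inr (key b a (by rw [hab, mul_comm]) h)

/-- The atoms of a coproduct are the atoms of its factors. -/
theorem exists_of_irreducible [Subsingleton Hˣ] {u : H} (hu : Irreducible u) :
    ∃ i x, Irreducible x ∧ u = D.σ i x := by
  classical
  obtain ⟨i, hi⟩ : ∃ i, D.π i u ≠ 1 := by
    by_contra! h
    exact hu.not_isUnit (isUnit_iff_eq_one.2 (D.ext _ _ fun i => by rw [h, map_one]))
  have hF := D.eq_prod u (D.finite u).toFinset (fun i hi => by simpa using hi)
  rw [← Finset.mul_prod_erase _ _ (show i ∈ (D.finite u).toFinset by simpa using hi)] at hF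
  have hσ : ¬ IsUnit (D.σ i (D.π i u)) := by
    intro h
    have := D.π_σ i (D.π i u)
    rw [isUnit_iff_eq_one.1 h, map_one] at this
    exact hi this.symm
  have hu' : u = D.σ i (D.π i u) := by
    rcases hu.isUnit_or_isUnit hF with h | h
    · exact absurd h hσ
    · rw [isUnit_iff_eq_one.1 h, mul_one] at hF
      exact hF
  refine ⟨i, D.π i u, ⟨fun h => hi (isUnit_iff_eq_one.1 h), fun x y hxy => ?_⟩, hu'⟩
  have h2 : u = D.σ i x * D.σ i y := by rw [← map_mul, ← hxy]; exact hu'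
  have key : ∀ x, IsUnit (D.σ i x) → IsUnit x := fun x hx => by
    have := hx.map (D.π i)
    rwa [D.π_σ] at this
  rcases hu.isUnit_or_isUnit h2 with h | h
  · exact Or.inl (key x h)
  · exact Or.inr (key y h)

open Classical in
/-- The part of a product of atoms that belongs to the factor `E i`. -/
noncomputable def comp (i : ι) (z : Multiset H) : Multiset (E i) := (z.map (D.π i)).filter (· ≠ 1)

theorem comp_atoms [Subsingleton Hˣ] (i : ι) {z : Multiset H} (hz : ∀ u ∈ z, Irreducible u) :
    ∀ u ∈ D.comp i z, Irreducible u := by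
  classical
  intro u hu
  obtain ⟨h1, h2⟩ := Multiset.mem_filter.1 hu
  obtain ⟨w, hw, rfl⟩ := Multiset.mem_map.1 h1
  obtain ⟨j, x, hx, rfl⟩ := D.exists_of_irreducible (hz w hw)
  by_cases hij : j = i
  · subst hij
    rwa [D.π_σ]
  · exact absurd (D.π_σ_ne j i x hij) h2

omit [∀ i, Subsingleton (E i)ˣ] in
theorem comp_prod (i : ι) (z : Multiset H) : (D.comp i z).prod = D.π i z.prod := by
  classical
  induction z using Multiset.induction_on with
  | empty => simp [comp]
  | cons a z ih =>
    unfold comp at ih ⊢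
    rw [map_cons, prod_cons, map_mul, ← ih]
    by_cases h : D.π i a = 1
    · rw [Multiset.filter_cons_of_neg (p := (· ≠ 1)) _ (by simpa using h), h, one_mul]
    · rw [Multiset.filter_cons_of_pos (p := (· ≠ 1)) _ h, prod_cons]

/-- A product of atoms is put together from its parts in the finitely many factors involved. -/
theorem eq_sum_comp [Subsingleton Hˣ] {z : Multiset H} (hz : ∀ u ∈ z, Irreducible u) (F : Finset ι)
    (hF : ∀ i, D.π i z.prod ≠ 1 → i ∈ F) : z = ∑ i ∈ F, (D.comp i z).map (D.σ i) := by
  classical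
  induction z using Multiset.induction_on with
  | empty => simp [comp]
  | cons a z ih =>
    obtain ⟨j, x, hx, rfl⟩ := D.exists_of_irreducible (hz a (Multiset.mem_cons_self _ _))
    have hx1 : x ≠ 1 := fun h => hx.not_isUnit (h ▸ isUnit_one)
    have hzF : ∀ i, D.π i z.prod ≠ 1 → i ∈ F := by
      intro i hi
      refine hF i fun h => hi ?_
      rw [prod_cons, map_mul, mul_comm] at h
      exact isUnit_iff_eq_one.1 (IsUnit.of_mul_eq_one _ h)
    have hjF : j ∈ F := by
      refine hF j fun h => hx1 ?_
      rw [prod_cons, map_mul, D.π_σ] at h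
      exact isUnit_iff_eq_one.1 (IsUnit.of_mul_eq_one _ h)
    have hcomp : ∀ i, (D.comp i (D.σ j x ::ₘ z)).map (D.σ i) =
        (if i = j then {D.σ j x} else 0) + (D.comp i z).map (D.σ i) := by
      intro i
      unfold comp
      rw [map_cons]
      by_cases hij : i = j
      · subst hij
        rw [D.π_σ, Multiset.filter_cons_of_pos (p := (· ≠ 1)) _ hx1, if_pos rfl, map_cons,
          singleton_add]
      · rw [D.π_σ_ne j i x (Ne.symm hij), Multiset.filter_cons_of_neg (p := (· ≠ 1)) _ (by simp),
          if_neg hij, zero_add]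
    rw [Finset.sum_congr rfl fun i _ => hcomp i, Finset.sum_add_distrib, Finset.sum_ite_eq' F j,
      if_pos hjF, ← ih (fun u hu => hz u (Multiset.mem_cons_of_mem hu)) hzF, singleton_add]

theorem card_eq_sum [Subsingleton Hˣ] {z : Multiset H} (hz : ∀ u ∈ z, Irreducible u) (F : Finset ι)
    (hF : ∀ i, D.π i z.prod ≠ 1 → i ∈ F) : card z = ∑ i ∈ F, card (D.comp i z) := by
  conv_lhs => rw [D.eq_sum_comp hz F hF]
  rw [Multiset.card_sum]
  simp

end Decomp

theorem EqConn.sum {H ι : Type*} [CommMonoid H] {N : ℕ} (F : Finset ι) (f g : ι → Multiset H)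
    (h : ∀ i ∈ F, EqConn N (f i) (g i)) : EqConn N (∑ i ∈ F, f i) (∑ i ∈ F, g i) := by
  classical
  induction F using Finset.induction_on with
  | empty => exact EqConn.refl _ _
  | insert a F ha ih =>
    rw [Finset.sum_insert ha, Finset.sum_insert ha]
    exact (h a (Finset.mem_insert_self _ _)).add
      (ih fun i hi => h i (Finset.mem_insert_of_mem hi))

theorem Near.sum {H ι : Type*} [CommMonoid H] {N : ℕ} (F : Finset ι) (f g : ι → Multiset H)
    (h : ∀ i ∈ F, Near N (f i) (g i)) : Near (F.card * N) (∑ i ∈ F, f i) (∑ i ∈ F, g i) := by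
  classical
  induction F using Finset.induction_on with
  | empty => exact Near.refl _ _
  | insert a F ha ih =>
    rw [Finset.sum_insert ha, Finset.sum_insert ha, Finset.card_insert_of_notMem ha]
    refine ((h a (Finset.mem_insert_self _ _)).add
      (ih fun i hi => h i (Finset.mem_insert_of_mem hi))).mono (le_of_eq ?_)
    ring

namespace Decomp

variable {H : Type*} [CommMonoid H] {ι : Type*} {E : ι → Type*} [∀ i, CommMonoid (E i)]
  (D : Decomp H E) [∀ i, Subsingleton (E i)ˣ] [Subsingleton Hˣ]

theorem twoConnected (D : Decomp H E) (h : ∀ i, TwoConnected (E i)) : TwoConnected H := by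
  classical
  intro z z' hz hz' hp
  set F := (D.finite z.prod).toFinset
  have hF : ∀ i, D.π i z.prod ≠ 1 → i ∈ F := fun i hi => by simpa [F] using hi
  rw [D.eq_sum_comp hz F hF, D.eq_sum_comp hz' F (hp ▸ hF)]
  refine EqConn.sum _ _ _ fun i _ => EqConn.map _ (fun u => D.irreducible_σ i) ?_
  refine h i _ _ (D.comp_atoms i hz) (D.comp_atoms i hz') ?_
  rw [D.comp_prod, D.comp_prod, hp]

section Monotone

/-- The product of atoms with given components in the factors belonging to `F`. -/
noncomputable def glue (F : Finset ι) (f : ∀ i, Multiset (E i)) : Multiset H :=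
  ∑ i ∈ F, (f i).map (D.σ i)

/-- `f i` and `g i` are factorizations of the same element, for all `i` in `F`. -/
def SameProd (F : Finset ι) (f g : ∀ i, Multiset (E i)) : Prop :=
  ∀ i ∈ F, (∀ u ∈ f i, Irreducible u) ∧ (∀ u ∈ g i, Irreducible u) ∧ (f i).prod = (g i).prod

omit [∀ i, Subsingleton (E i)ˣ] [Subsingleton Hˣ] in
theorem SameProd.update [DecidableEq ι] {F : Finset ι} {f g : ∀ i, Multiset (E i)}
    (h : SameProd F f g) {i : ι} {N : ℕ} {w w' : Multiset (E i)} (hw : EqConn N (f i) w)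
    (hw' : Near N w w') : SameProd F (Function.update f i w') g := by
  intro j hj
  obtain ⟨h1, h2, h3⟩ := h j hj
  by_cases hji : j = i
  · subst hji
    rw [Function.update_self]
    exact ⟨hw'.atoms (hw.atoms h1), h2, by rw [← h3, hw.prod_eq, hw'.prod_eq]⟩
  · rw [Function.update_of_ne hji]
    exact ⟨h1, h2, h3⟩

omit [∀ i, Subsingleton (E i)ˣ] [Subsingleton Hˣ] in
theorem glue_eq_add [DecidableEq ι] {F : Finset ι} (f : ∀ i, Multiset (E i)) {i : ι} (hi : i ∈ F) :
    D.glue F f = D.glue (F.erase i) f + (f i).map (D.σ i) := by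
  unfold glue
  rw [Finset.sum_erase_add _ _ hi]

omit [∀ i, Subsingleton (E i)ˣ] [Subsingleton Hˣ] in
theorem glue_update_erase [DecidableEq ι] {F : Finset ι} (f : ∀ i, Multiset (E i)) (i : ι)
    (w : Multiset (E i)) : D.glue (F.erase i) (Function.update f i w) = D.glue (F.erase i) f := by
  unfold glue
  refine Finset.sum_congr rfl fun j hj => ?_
  rw [Function.update_of_ne (Finset.ne_of_mem_erase hj)]

/-- Shifting the lengths of one component. -/
theorem glue_update [DecidableEq ι] {F : Finset ι} (f : ∀ i, Multiset (E i)) {i : ι} (hi : i ∈ F)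
    {N : ℕ} {w w' : Multiset (E i)} (hw : EqConn N (f i) w) (hw' : Near N w w') :
    ∃ x, EqConn N (D.glue F f) x ∧ Near N x (D.glue F (Function.update f i w')) := by
  rw [D.glue_eq_add f hi, D.glue_eq_add _ hi, D.glue_update_erase, Function.update_self]
  exact ⟨_, (hw.map _ fun u => D.irreducible_σ i).add_left _,
    (hw'.map _ fun u => D.irreducible_σ i).add_left _⟩

/-- Shifting the lengths of two components simultaneously. -/
theorem glue_update₂ [DecidableEq ι] {F : Finset ι} (f : ∀ i, Multiset (E i)) {i j : ι}
    (hij : i ≠ j) (hi : i ∈ F) (hj : j ∈ F) {N : ℕ} {w w' : Multiset (E i)}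
    {v v' : Multiset (E j)} (hw : EqConn N (f i) w)
    (hw' : Near N w w') (hv : EqConn N (f j) v) (hv' : Near N v v') :
    ∃ x, EqConn N (D.glue F f) x ∧
      Near (N + N) x (D.glue F (Function.update (Function.update f i w') j v')) := by
  have hi' : i ∈ F.erase j := Finset.mem_erase.2 ⟨hij, hi⟩
  rw [D.glue_eq_add f hj, D.glue_eq_add _ hj, D.glue_update_erase, Function.update_self,
    D.glue_eq_add f hi', D.glue_eq_add _ hi', D.glue_update_erase, Function.update_self]
  refine ⟨_, ((hw.map _ fun u => D.irreducible_σ i).add_left _).add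
    (hv.map _ fun u => D.irreducible_σ j), ?_⟩
  exact ((hw'.map _ fun u => D.irreducible_σ i).add_left _).add
    (hv'.map _ fun u => D.irreducible_σ j)

omit [∀ i, Subsingleton (E i)ˣ] [Subsingleton Hˣ] in
theorem card_glue (F : Finset ι) (f : ∀ i, Multiset (E i)) :
    card (D.glue F f) = ∑ i ∈ F, card (f i) := by
  unfold glue
  rw [Multiset.card_sum]
  simp

end Monotone

end Decomp

end MonoidArith

/-! ### Monotone chains in coproducts -/

namespace MonoidArith

open Multiset Relation

theorem ShiftBound.mono {E : Type*} [CommMonoid E] {D C N C' N' : ℕ} (h : ShiftBound E D C N)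
    (hC : C ≤ C') (hN : N ≤ N') : ShiftBound E D C' N' := by
  intro z z' hz hz' hp hle
  obtain ⟨⟨a, b, h1, h2, h3⟩, ⟨c, d, k1, k2, k3⟩⟩ := h z z' hz hz' hp (by omega)
  exact ⟨⟨a, b, h1.mono hN, h2.mono hN, h3⟩, ⟨c, d, k1.mono hN, k2.mono hN, k3⟩⟩

namespace Decomp

variable {H : Type*} [CommMonoid H] {ι : Type*} {E : ι → Type*} [∀ i, CommMonoid (E i)]
  [∀ i, Subsingleton (E i)ˣ] [Subsingleton Hˣ]

/-- The total difference of the lengths of the components of two factorizations. -/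
def lengthGap (F : Finset ι) (f g : ∀ i, Multiset (E i)) : ℕ :=
  ∑ i ∈ F, ((card (f i) - card (g i)) + (card (g i) - card (f i)))

omit [∀ i, CommMonoid (E i)] [∀ i, Subsingleton (E i)ˣ] in
theorem lengthGap_update_lt [DecidableEq ι] {F : Finset ι} (f g : ∀ i, Multiset (E i)) {i : ι}
    (hi : i ∈ F) (w : Multiset (E i))
    (h : (card w - card (g i)) + (card (g i) - card w) <
      (card (f i) - card (g i)) + (card (g i) - card (f i))) :
    lengthGap F (Function.update f i w) g < lengthGap F f g := by
  refine Finset.sum_lt_sum (fun j _ => ?_) ⟨i, hi, by simpa using h⟩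
  by_cases hji : j = i
  · subst hji
    simpa using h.le
  · rw [Function.update_of_ne hji]

omit [∀ i, CommMonoid (E i)] [∀ i, Subsingleton (E i)ˣ] in
theorem sum_card_update [DecidableEq ι] {F : Finset ι} (f : ∀ i, Multiset (E i)) {i : ι}
    (hi : i ∈ F) (w : Multiset (E i)) :
    ∑ j ∈ F, card (Function.update f i w j) + card (f i) = ∑ j ∈ F, card (f j) + card w := by
  have h1 : ∑ j ∈ F.erase i, card (Function.update f i w j) = ∑ j ∈ F.erase i, card (f j) :=
    Finset.sum_congr rfl fun j hj => by rw [Function.update_of_ne (Finset.ne_of_mem_erase hj)]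
  have h2 := Finset.sum_erase_add F (fun j => card (Function.update f i w j)) hi
  have h3 := Finset.sum_erase_add F (fun j => card (f j)) hi
  simp only [Function.update_self] at h2 h3
  omega

/-- Finitely many factors, in all of which factorizations of close lengths are close and lengths can
be shifted by the same amount `Δ`: lengthening one component while shortening another one keeps the
total length, so that factorizations can be linked monotonically. -/
theorem exists_upConn_glue (D : Decomp H E) (F : Finset ι) (Δ C N₀ : ℕ) (hΔ : 1 ≤ Δ)
    (hclose : ∀ i ∈ F, CloseLengths (E i)) (hshift : ∀ i ∈ F, ShiftBound (E i) Δ C N₀)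
    (hC : Δ ≤ C) :
    ∃ N, ∀ f g : ∀ i, Multiset (E i), SameProd F f g →
      ∑ i ∈ F, card (f i) ≤ ∑ i ∈ F, card (g i) → UpConn N (D.glue F f) (D.glue F g) := by
  classical
  set C' := F.card * C + C + Δ with hC'
  choose! N₁ hN₁ using fun (i : ι) (hi : i ∈ F) => hclose i hi C'
  set N₂ := F.sup N₁
  refine ⟨2 * N₀ + (F.card + 1) * N₂, fun f g hfg hle => ?_⟩
  have hN₀ : N₀ + N₀ ≤ 2 * N₀ + (F.card + 1) * N₂ := by
    have := Nat.zero_le ((F.card + 1) * N₂); omega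
  have hN₂ : F.card * N₂ ≤ 2 * N₀ + (F.card + 1) * N₂ := by
    have h1 : (F.card + 1) * N₂ = F.card * N₂ + N₂ := by ring
    omega
  have hN₂' : N₂ ≤ 2 * N₀ + (F.card + 1) * N₂ := by
    have h1 : (F.card + 1) * N₂ = F.card * N₂ + N₂ := by ring
    omega
  -- if all components have close lengths, a single step changing the length suffices
  have hcase : ∀ f : ∀ i, Multiset (E i), SameProd F f g →
      ∑ i ∈ F, card (f i) ≤ ∑ i ∈ F, card (g i) →
      (∀ i ∈ F, card (f i) ≤ card (g i) + C' ∧ card (g i) ≤ card (f i) + C') →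
      UpConn (2 * N₀ + (F.card + 1) * N₂) (D.glue F f) (D.glue F g) := by
    intro f hfg hle hcl
    have hex : ∀ i, ∃ p : Multiset (E i) × Multiset (E i), i ∈ F →
        EqConn N₂ (f i) p.1 ∧ EqConn N₂ (g i) p.2 ∧ Near N₂ p.1 p.2 := by
      intro i
      by_cases hi : i ∈ F
      · obtain ⟨h1, h2, h3⟩ := hfg i hi
        obtain ⟨z, z', k1, k2, k3⟩ := hN₁ i hi (f i) (g i) h1 h2 h3 (hcl i hi).1 (hcl i hi).2
        have hle := Finset.le_sup (f := N₁) hi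
        exact ⟨(z, z'), fun _ => ⟨k1.mono hle, k2.mono hle, k3.mono hle⟩⟩
      · exact ⟨(0, 0), fun h => absurd h hi⟩
    choose p hp using hex
    have e1 : EqConn N₂ (D.glue F f) (∑ i ∈ F, (p i).1.map (D.σ i)) :=
      EqConn.sum F _ _ fun i hi => (hp i hi).1.map _ fun u => D.irreducible_σ i
    have e2 : EqConn N₂ (D.glue F g) (∑ i ∈ F, (p i).2.map (D.σ i)) :=
      EqConn.sum F _ _ fun i hi => (hp i hi).2.1.map _ fun u => D.irreducible_σ i
    have e3 : Near (F.card * N₂) (∑ i ∈ F, (p i).1.map (D.σ i)) (∑ i ∈ F, (p i).2.map (D.σ i)) :=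
      Near.sum F _ _ fun i hi => (hp i hi).2.2.map _ fun u => D.irreducible_σ i
    refine ReflTransGen.trans (e1.mono hN₂').up (ReflTransGen.trans
      (ReflTransGen.single ⟨e3.mono hN₂, ?_⟩) (e2.mono hN₂').symm.up)
    rw [← e1.card_eq, ← e2.card_eq, D.card_glue, D.card_glue]
    exact hle
  induction hn : lengthGap F f g using Nat.strong_induction_on generalizing f with
  | _ n ih =>
    by_cases hP : ∃ j ∈ F, card (g j) + C ≤ card (f j)
    · obtain ⟨j, hj, hPj⟩ := hP
      by_cases hQ : ∃ i ∈ F, card (f i) + C ≤ card (g i)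
      -- shorten the component at `j` and lengthen the one at `i`, both by `Δ`
      · obtain ⟨i, hi, hQi⟩ := hQ
        have hij : i ≠ j := by rintro rfl; omega
        obtain ⟨h1, h2, h3⟩ := hfg i hi
        obtain ⟨k1, k2, k3⟩ := hfg j hj
        obtain ⟨w, w', hw, hw', cw⟩ := (hshift i hi _ _ h1 h2 h3 hQi).1
        obtain ⟨v, v', hv, hv', cv⟩ := (hshift j hj _ _ k2 k1 k3.symm hPj).2
        obtain ⟨x, hx, hx'⟩ := D.glue_update₂ f hij hi hj hw hw' hv hv'
        have hfi : Function.update f i w' j = f j := Function.update_of_ne hij.symm _ _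
        have hsum : ∑ k ∈ F, card (Function.update (Function.update f i w') j v' k) =
            ∑ k ∈ F, card (f k) := by
          have s1 := sum_card_update f hi w'
          have s2 := sum_card_update (Function.update f i w') hj v'
          rw [hfi] at s2
          omega
        have hstep : UpConn (2 * N₀ + (F.card + 1) * N₂) (D.glue F f)
            (D.glue F (Function.update (Function.update f i w') j v')) := by
          refine ReflTransGen.trans (hx.mono (by omega)).up
            (ReflTransGen.single ⟨hx'.mono hN₀, ?_⟩)
          rw [← hx.card_eq, D.card_glue, D.card_glue, hsum]
        refine ReflTransGen.trans hstep (ih _ ?_ _ ?_ ?_ rfl)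
        · rw [← hn]
          refine (lengthGap_update_lt _ g hj v' ?_).trans (lengthGap_update_lt f g hi w' ?_)
          · rw [hfi]; omega
          · omega
        · have hs := hfg.update hw hw'
          exact hs.update (i := j) (N := N₀) (w := v) (by rw [hfi]; exact hv) hv'
        · rw [hsum]; exact hle
      -- no component of `f` is much shorter than that of `g`, so by `hle` none is much longer
      · push Not at hQ
        refine hcase f hfg hle fun k hk => ⟨?_, ?_⟩
        · by_contra! hcon
          have hs : ∑ i ∈ F, (card (g i) + if i = k then C' + 1 else 0) ≤
              ∑ i ∈ F, (card (f i) + C) := by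
            refine Finset.sum_le_sum fun i hi => ?_
            by_cases hik : i = k
            · subst hik
              rw [if_pos rfl]; omega
            · rw [if_neg hik]
              have := hQ i hi
              omega
          rw [Finset.sum_add_distrib, Finset.sum_add_distrib, Finset.sum_ite_eq' F k, if_pos hk,
            Finset.sum_const, smul_eq_mul] at hs
          omega
        · have := hQ k hk
          omega
    · push Not at hP
      by_cases hQ : ∃ i ∈ F, card (f i) + C' ≤ card (g i)
      -- `C'` is so large that lengthening this component by `Δ` keeps `f` shorter than `g` in total
      · obtain ⟨i, hi, hQi⟩ := hQ
        obtain ⟨h1, h2, h3⟩ := hfg i hi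
        obtain ⟨w, w', hw, hw', cw⟩ := (hshift i hi _ _ h1 h2 h3 (by omega)).1
        obtain ⟨x, hx, hx'⟩ := D.glue_update f hi hw hw'
        have s1 := sum_card_update f hi w'
        refine ReflTransGen.trans (hx.mono (by omega)).up (ReflTransGen.trans
          (ReflTransGen.single ⟨hx'.mono (by omega), ?_⟩) (ih _ ?_ _ (hfg.update hw hw') ?_ rfl))
        · rw [← hx.card_eq, D.card_glue, D.card_glue]
          omega
        · rw [← hn]
          exact lengthGap_update_lt f g hi w' (by omega)
        · have hs : ∑ k ∈ F, (card (f k) + if k = i then C' else 0) ≤ ∑ k ∈ F, (card (g k) + C) := by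
            refine Finset.sum_le_sum fun k hk => ?_
            by_cases hki : k = i
            · subst hki
              rw [if_pos rfl]; omega
            · rw [if_neg hki]
              have := hP k hk
              omega
          rw [Finset.sum_add_distrib, Finset.sum_add_distrib, Finset.sum_ite_eq' F i, if_pos hi,
            Finset.sum_const, smul_eq_mul] at hs
          omega
      · push Not at hQ
        refine hcase f hfg hle fun k hk => ⟨?_, ?_⟩
        · have := hP k hk; omega
        · have := hQ k hk; omega

/-- If all factors outside of the finite set `F` are two-connected, and the lengths in the factors in `F`
can be shifted by all positive multiples of some `Δ i`, then any two factorizations in the coproduct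
are linked monotonically by steps of bounded distance: in `F` one shifts by the product of all `Δ i`. -/
theorem exists_upConn (D : Decomp H E) (F : Finset ι) (hgood : ∀ i, i ∉ F → TwoConnected (E i))
    (hclose : ∀ i ∈ F, CloseLengths (E i))
    (hshift : ∀ i ∈ F, ∃ Δ, 1 ≤ Δ ∧ ∀ q, 1 ≤ q → Shiftable (E i) (q * Δ)) :
    ∃ N, ∀ z z' : Multiset H, (∀ u ∈ z, Irreducible u) → (∀ u ∈ z', Irreducible u) →
      z.prod = z'.prod → card z ≤ card z' → UpConn N z z' := by
  classical
  choose! Δ hΔ hq using hshift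
  set Δ₀ := ∏ i ∈ F, Δ i
  have hΔ₀ : 1 ≤ Δ₀ :=
    Nat.one_le_iff_ne_zero.2 (Finset.prod_ne_zero_iff.2 fun i hi =>
      Nat.one_le_iff_ne_zero.1 (hΔ i hi))
  have hsh : ∀ i ∈ F, ∃ C N, ShiftBound (E i) Δ₀ C N := by
    intro i hi
    obtain ⟨q, hq'⟩ := Finset.dvd_prod_of_mem Δ hi
    have hq1 : 1 ≤ q := by
      rcases Nat.eq_zero_or_pos q with rfl | h
      · rw [mul_zero] at hq'
        exact absurd hq' (by change Δ₀ ≠ 0; omega)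
      · exact h
    have := hq i hi q hq1
    rw [mul_comm, ← hq'] at this
    exact this
  choose! C N hCN using hsh
  obtain ⟨N', hN'⟩ := D.exists_upConn_glue F Δ₀ (F.sup C + Δ₀) (F.sup N) hΔ₀ hclose
    (fun i hi => (hCN i hi).mono ((Finset.le_sup (f := C) hi).trans (Nat.le_add_right _ _))
      (Finset.le_sup (f := N) hi)) (Nat.le_add_left _ _)
  refine ⟨N' + 2, fun z z' hz hz' hp hle => ?_⟩
  set G := (D.finite z.prod).toFinset ∪ F
  have hG : ∀ i, D.π i z.prod ≠ 1 → i ∈ G := fun i hi =>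
    Finset.mem_union_left _ (by simpa using hi)
  have hFG : F ⊆ G := Finset.subset_union_right
  have ez := D.eq_sum_comp hz G hG
  have ez' := D.eq_sum_comp hz' G (hp ▸ hG)
  rw [← Finset.sum_sdiff hFG] at ez ez'
  have hcp : ∀ i, (D.comp i z).prod = (D.comp i z').prod := fun i => by
    rw [D.comp_prod, D.comp_prod, hp]
  have h1 : EqConn 2 (∑ i ∈ G \ F, (D.comp i z).map (D.σ i))
      (∑ i ∈ G \ F, (D.comp i z').map (D.σ i)) := by
    refine EqConn.sum _ _ _ fun i hi => EqConn.map _ (fun u => D.irreducible_σ i) ?_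
    exact hgood i (Finset.mem_sdiff.1 hi).2 _ _ (D.comp_atoms i hz) (D.comp_atoms i hz') (hcp i)
  have h2 : UpConn N' (∑ i ∈ F, (D.comp i z).map (D.σ i)) (∑ i ∈ F, (D.comp i z').map (D.σ i)) := by
    refine hN' (fun i => D.comp i z) (fun i => D.comp i z')
      (fun i _ => ⟨D.comp_atoms i hz, D.comp_atoms i hz', hcp i⟩) ?_
    have c1 := congrArg card ez
    have c2 := congrArg card ez'
    rw [card_add] at c1 c2
    have c3 := h1.card_eq
    have c4 := D.card_glue F (fun i => D.comp i z)
    have c5 := D.card_glue F (fun i => D.comp i z')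
    simp only [glue] at c4 c5
    show ∑ i ∈ F, card (D.comp i z) ≤ ∑ i ∈ F, card (D.comp i z')
    omega
  rw [ez, ez']
  refine ReflTransGen.trans ?_ ((h2.mono (N' := N' + 2) (by omega)).add_left _)
  exact ((h1.mono (N' := N' + 2) (by omega)).add (EqConn.refl _ _)).up

end Decomp

/-! ### Elasticity of coproducts -/

section Elasticity

variable {H : Type*} [CommMonoid H] [Subsingleton Hˣ]

omit [Subsingleton Hˣ] in
theorem le_elasticity {a : H} {k n : ℕ} (hk : k ∈ lengths a) (hn : n ∈ lengths a) (h1 : 1 ≤ k) :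
    (n : ℝ≥0∞) / k ≤ setElasticity (lengths a) := by
  unfold setElasticity
  have hne : lengths a ≠ {0} := by
    intro h
    rw [h] at hk
    have : k = 0 := hk
    omega
  rw [if_neg hne]
  refine ENNReal.div_le_div (le_iSup₂ (f := fun (k : ℕ) (_ : k ∈ lengths a) => (k : ℝ≥0∞)) n hn) ?_
  exact_mod_cast Nat.sInf_le hk

omit [Subsingleton Hˣ] in
theorem setElasticity_le {a : H} {r s : ℕ} (hr : 1 ≤ r) (hrs : r ≤ s)
    (h : ∀ k ∈ lengths a, ∀ n ∈ lengths a, n * r ≤ s * k) :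
    setElasticity (lengths a) ≤ (s : ℝ≥0∞) / r := by
  have hr0 : (r : ℝ≥0∞) ≠ 0 := by simpa using (by omega : r ≠ 0)
  have hrt : (r : ℝ≥0∞) ≠ ⊤ := ENNReal.natCast_ne_top r
  unfold setElasticity
  split_ifs with h0
  · rw [ENNReal.le_div_iff_mul_le (Or.inl hr0) (Or.inl hrt), one_mul]
    exact_mod_cast hrs
  · by_cases hne : (lengths a).Nonempty
    · refine ENNReal.div_le_of_le_mul (iSup₂_le fun n hn => ?_)
      have := h _ (Nat.sInf_mem hne) n hn
      rw [ENNReal.div_eq_inv_mul, mul_assoc, ← ENNReal.div_eq_inv_mul,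
        ENNReal.le_div_iff_mul_le (Or.inl hr0) (Or.inl hrt)]
      exact_mod_cast this
    · rw [Set.not_nonempty_iff_eq_empty.1 hne]
      simp

namespace Decomp

variable {ι : Type*} {E : ι → Type*} [∀ i, CommMonoid (E i)] [∀ i, Subsingleton (E i)ˣ]

theorem mem_lengths_σ (D : Decomp H E) (i : ι) {x : E i} {w : Multiset (E i)}
    (hw : ∀ u ∈ w, Irreducible u) (hp : w.prod = x) : card w ∈ lengths (D.σ i x) := by
  refine mem_lengths_iff.2 ⟨w.map (D.σ i), fun u hu => ?_, ?_, by simp⟩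
  · obtain ⟨y, hy, rfl⟩ := Multiset.mem_map.1 hu
    exact D.irreducible_σ i (hw y hy)
  · rw [Multiset.prod_hom, hp]

/-- The element `m ^ (f + n)` is also a product of two atoms. -/
theorem elasticity_eq_top (D : Decomp H E) (i : ι) {κ : Type*} (S : SplitData (E i) κ) :
    elasticity H = ⊤ := by
  refine ENNReal.eq_top_of_forall_nnreal_le fun c => ?_
  obtain ⟨n, hn⟩ := exists_nat_ge (2 * c)
  obtain ⟨X, Y, hX, hY, e⟩ := S.flex (S.m ^ (S.f + n)) 1 (by
    intro i
    rw [S.v_one, S.v_pow]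
    have := Nat.mul_le_mul_left (S.f + n) (S.pos i)
    omega)
  have h1 := D.mem_lengths_σ i (x := S.m ^ (S.f + n)) (w := {X, Y}) (by simp [hX, hY])
    (by simpa using e.symm)
  have h2 := D.mem_lengths_σ i (x := S.m ^ (S.f + n)) (w := replicate (S.f + n) S.m)
    (fun u hu => Multiset.eq_of_mem_replicate hu ▸ S.irr) (by simp)
  refine le_trans ?_ (le_iSup (fun a : H => setElasticity (lengths a)) (D.σ i (S.m ^ (S.f + n))))
  refine le_trans ?_ (le_elasticity h1 h2 (by simp))
  simp only [insert_eq_cons, card_cons, card_singleton, card_replicate]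
  rw [ENNReal.le_div_iff_mul_le (Or.inl (by simp)) (Or.inl (by simp))]
  have h3 : c * 2 ≤ ((S.f + n : ℕ) : NNReal) := by
    rw [mul_comm]
    refine hn.trans ?_
    exact_mod_cast Nat.le_add_left _ _
  exact_mod_cast h3

/-- The values bound the elasticity of the factor `E i` by `s / r`, and this bound is attained by
`m ^ (2 * s)`. Only finitely many factors have `s / r > 1`, so the supremum over all factors is a
maximum. -/
theorem elasticity_nonsplit (D : Decomp H E) (F : Finset ι) (S : ∀ i, NonsplitData (E i))
    (hF : ∀ i, i ∉ F → (S i).r = (S i).s) : elasticity H < ⊤ ∧ ElasticityAccepted H := by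
  classical
  rcases isEmpty_or_nonempty ι with hι | ⟨⟨j⟩⟩
  · have h1 : ∀ a : H, a = 1 := fun a => D.ext _ _ fun i => hι.elim i
    have h2 : ∀ a : H, setElasticity (lengths a) = 1 := by
      intro a
      rw [h1 a, lengths_one]
      simp [setElasticity]
    have h3 : elasticity H = 1 := by
      unfold elasticity
      have : Nonempty H := ⟨1⟩
      simp [h2]
    exact ⟨by rw [h3]; exact ENNReal.one_lt_top, 1, by rw [h2, h3]⟩
  · obtain ⟨i₀, -, hi₀⟩ := Finset.exists_max_image (insert j F)
      (fun i => ((S i).s : ℚ) / (S i).r) ⟨j, Finset.mem_insert_self _ _⟩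
    have hrpos : ∀ i, (0 : ℚ) < (S i).r := fun i => by exact_mod_cast (S i).one_le_r
    have hmax : ∀ i, (S i).s * (S i₀).r ≤ (S i₀).s * (S i).r := by
      intro i
      by_cases hi : i ∈ insert j F
      · have := hi₀ i hi
        rw [div_le_div_iff₀ (hrpos i) (hrpos i₀)] at this
        exact_mod_cast this
      · rw [← hF i fun h => hi (Finset.mem_insert_of_mem h), mul_comm]
        exact Nat.mul_le_mul_right _ (S i₀).r_le_s
    have hle : ∀ a : H, setElasticity (lengths a) ≤ ((S i₀).s : ℝ≥0∞) / (S i₀).r := by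
      intro a
      refine setElasticity_le (S i₀).one_le_r (S i₀).r_le_s fun k hk n hn => ?_
      obtain ⟨z, hz, rfl, rfl⟩ := mem_lengths_iff.1 hk
      obtain ⟨z', hz', hp, rfl⟩ := mem_lengths_iff.1 hn
      set G := (D.finite z.prod).toFinset
      have hG : ∀ i, D.π i z.prod ≠ 1 → i ∈ G := fun i hi => by simpa [G] using hi
      rw [D.card_eq_sum hz G hG, D.card_eq_sum hz' G (hp ▸ hG), Finset.sum_mul, Finset.mul_sum]
      refine Finset.sum_le_sum fun i _ => ?_
      have h1 := (S i).card_mul_le () (D.comp i z') (D.comp_atoms i hz')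
      have h2 := (S i).v_prod_le (D.comp i z) (D.comp_atoms i hz)
      rw [D.comp_prod, hp, ← D.comp_prod] at h1
      have h3 : card (D.comp i z') * (S i).r ≤ card (D.comp i z) * (S i).s := h1.trans h2
      have h4 := hmax i
      have h5 := (S i).one_le_r
      refine Nat.le_of_mul_le_mul_right (c := (S i).r) ?_ h5
      calc card (D.comp i z') * (S i₀).r * (S i).r
          = card (D.comp i z') * (S i).r * (S i₀).r := by ring
        _ ≤ card (D.comp i z) * (S i).s * (S i₀).r := Nat.mul_le_mul_right _ h3
        _ = card (D.comp i z) * ((S i).s * (S i₀).r) := by ring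
        _ ≤ card (D.comp i z) * ((S i₀).s * (S i).r) := Nat.mul_le_mul_left _ h4
        _ = (S i₀).s * card (D.comp i z) * (S i).r := by ring
    have hel : elasticity H ≤ ((S i₀).s : ℝ≥0∞) / (S i₀).r := iSup_le hle
    refine ⟨lt_of_le_of_lt hel ?_, D.σ i₀ ((S i₀).m ^ (2 * (S i₀).s)), ?_⟩
    · refine ENNReal.div_lt_top (ENNReal.natCast_ne_top _) ?_
      have := (S i₀).one_le_r
      simpa using (by omega : (S i₀).r ≠ 0)
    · refine le_antisymm (le_iSup (fun a : H => setElasticity (lengths a)) _) (hel.trans ?_)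
      obtain ⟨z, hz, hp, hc⟩ := (S i₀).exists_relation
      have h1 := D.mem_lengths_σ i₀ hz hp
      have h2 := D.mem_lengths_σ i₀ (x := (S i₀).m ^ (2 * (S i₀).s))
        (w := replicate (2 * (S i₀).s) (S i₀).m)
        (fun u hu => Multiset.eq_of_mem_replicate hu ▸ (S i₀).irr) (by simp)
      rw [hc] at h1
      rw [card_replicate] at h2
      have h3 := (S i₀).one_le_r
      refine le_trans (le_of_eq ?_) (le_elasticity h1 h2 (by omega))
      push_cast
      rw [ENNReal.mul_div_mul_left _ _ (by simp) (by simp)]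

end Decomp

end Elasticity

end MonoidArith

/-! ### Stable local orders -/

namespace OrderIdeals

open MonoidArith IsLocalRing

/-- A local domain `R`, not a field, inside a principal ideal domain `S` which is integral over `R`,
with non-zero conductor, such that every non-zero ideal `J` of `R` contains an element `a` with
`J ^ 2 = a J`; the latter says that `R` is stable. -/
structure IsStableLocalOrder (R S : Type*) [CommRing R] [IsLocalRing R] [CommRing S]
    [Algebra R S] : Prop where
  injective : Function.Injective (algebraMap R S)
  integral : Algebra.IsIntegral R S
  conductor : ∃ d : R, d ≠ 0 ∧ ∀ s : S, ∃ r : R, algebraMap R S r = algebraMap R S d * s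
  ne_bot : maximalIdeal R ≠ ⊥
  stable : ∀ J : Ideal R, J ≠ ⊥ → ∃ a ∈ J, a ≠ 0 ∧ ∀ x ∈ J, ∀ y ∈ J, ∃ w ∈ J, x * y = a * w

section Val

variable {S : Type*} [CommRing S] [IsDomain S] [IsPrincipalIdealRing S]

/-- A generator of a maximal ideal of a principal ideal domain. -/
noncomputable def gen (Q : MaximalSpectrum S) : S := Submodule.IsPrincipal.generator Q.asIdeal

theorem mem_iff_gen_dvd {Q : MaximalSpectrum S} {x : S} : x ∈ Q.asIdeal ↔ gen Q ∣ x :=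
  Submodule.IsPrincipal.mem_iff_generator_dvd _

/-- The valuation attached to a maximal ideal of a principal ideal domain. -/
noncomputable def val (Q : MaximalSpectrum S) (x : S) : ℕ := multiplicity (gen Q) x

theorem gen_prime (hS : ¬ IsField S) (Q : MaximalSpectrum S) : Prime (gen Q) := by
  have : Q.asIdeal.IsPrime := Q.isMaximal.isPrime
  refine (Submodule.IsPrincipal.prime_generator_of_isPrime Q.asIdeal ?_)
  intro h
  exact Ring.ne_bot_of_isMaximal_of_not_isField Q.isMaximal hS h

theorem finite_val (hS : ¬ IsField S) (Q : MaximalSpectrum S) {x : S} (hx : x ≠ 0) :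
    FiniteMultiplicity (gen Q) x := FiniteMultiplicity.of_prime_left (gen_prime hS Q) hx

theorem val_mul (hS : ¬ IsField S) (Q : MaximalSpectrum S) {x y : S} (hx : x ≠ 0) (hy : y ≠ 0) :
    val Q (x * y) = val Q x + val Q y :=
  multiplicity_mul (gen_prime hS Q) (finite_val hS Q (mul_ne_zero hx hy))

theorem one_le_val_iff (Q : MaximalSpectrum S) {x : S} :
    1 ≤ val Q x ↔ gen Q ∣ x := by
  rw [Nat.one_le_iff_ne_zero, ← not_iff_not, not_not]
  exact multiplicity_eq_zero

theorem val_isUnit (hS : ¬ IsField S) (Q : MaximalSpectrum S) {x : S} (hx : IsUnit x) :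
    val Q x = 0 := by
  by_contra h
  have := (one_le_val_iff Q).1 (Nat.one_le_iff_ne_zero.2 h)
  exact (gen_prime hS Q).not_isUnit (isUnit_of_dvd_unit this hx)

theorem isUnit_of_val {x : S} (h : ∀ Q : MaximalSpectrum S, val Q x = 0) : IsUnit x := by
  by_contra hu
  obtain ⟨M, hM, hxM⟩ := exists_max_ideal_of_mem_nonunits hu
  have := (one_le_val_iff ⟨M, hM⟩).2 (mem_iff_gen_dvd.1 hxM)
  have := h ⟨M, hM⟩
  omega

theorem val_gen_self (Q : MaximalSpectrum S) : val Q (gen Q) = 1 :=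
  multiplicity_self

theorem not_gen_dvd_gen {Q Q' : MaximalSpectrum S} (h : Q ≠ Q') : ¬ gen Q ∣ gen Q' := by
  intro hd
  refine h (MaximalSpectrum.ext (Q'.isMaximal.eq_of_le Q.isMaximal.ne_top fun x hx => ?_).symm)
  exact mem_iff_gen_dvd.2 (hd.trans (mem_iff_gen_dvd.1 hx))

theorem dvd_of_val_le (hS : ¬ IsField S) {x y : S} (hx : x ≠ 0) (hy : y ≠ 0)
    (h : ∀ Q : MaximalSpectrum S, val Q x ≤ val Q y) : x ∣ y := by
  induction x using UniqueFactorizationMonoid.induction_on_prime generalizing y with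
  | h₁ => exact absurd rfl hx
  | h₂ x hu => exact hu.dvd
  | h₃ a q ha hq ih =>
    have hqM : (Ideal.span {q}).IsMaximal :=
      PrincipalIdealRing.isMaximal_of_irreducible hq.irreducible
    have hass : Associated (gen ⟨_, hqM⟩) q := by
      rw [← Ideal.span_singleton_eq_span_singleton]
      exact Submodule.IsPrincipal.span_singleton_generator _
    have h1 : gen ⟨_, hqM⟩ ∣ y := by
      refine (one_le_val_iff _).1 (le_trans ?_ (h ⟨_, hqM⟩))
      exact (one_le_val_iff _).2 (hass.dvd.trans (dvd_mul_right _ _))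
    obtain ⟨y, rfl⟩ := hass.symm.dvd.trans h1
    have hy' : y ≠ 0 := right_ne_zero_of_mul hy
    refine mul_dvd_mul_left q (ih ha hy' fun Q => ?_)
    have := h Q
    rw [val_mul hS Q hq.ne_zero ha, val_mul hS Q hq.ne_zero hy'] at this
    omega

end Val

namespace IsStableLocalOrder

variable {R S : Type*} [CommRing R] [IsDomain R] [IsLocalRing R] [CommRing S] [IsDomain S]
  [IsPrincipalIdealRing S] [Algebra R S] (h : IsStableLocalOrder R S)

include h

theorem map_ne_zero {x : R} (hx : x ≠ 0) : algebraMap R S x ≠ 0 :=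
  (map_ne_zero_iff _ h.injective).2 hx

theorem mem_of_mem_maximalIdeal (Q : MaximalSpectrum S) {x : R} (hx : x ∈ maximalIdeal R) :
    algebraMap R S x ∈ Q.asIdeal := by
  have := h.integral
  have hQ := Q.isMaximal
  have := Ideal.isMaximal_comap_of_isIntegral_of_isMaximal (R := R) Q.asIdeal
  rw [← eq_maximalIdeal this] at hx
  exact hx

theorem not_isField : ¬ IsField S := by
  intro hS
  obtain ⟨Q, hQ⟩ := Ideal.exists_maximal S
  obtain ⟨x, hx, hx0⟩ := Submodule.exists_mem_ne_zero_of_ne_bot h.ne_bot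
  have h1 := h.mem_of_mem_maximalIdeal ⟨Q, hQ⟩ hx
  obtain ⟨y, hy⟩ := hS.mul_inv_cancel (h.map_ne_zero hx0)
  exact hQ.ne_top ((Ideal.eq_top_iff_one _).2 (hy ▸ Q.mul_mem_right y h1))

/-- An element as provided by stability divides, in `S`, all elements of the ideal: if
`x ^ (n + 1) = a ^ n * w` for all `n`, then `x` has at least the value of `a`. -/
theorem map_dvd_map {J : Ideal R} {a : R} (ha0 : a ≠ 0)
    (ha : ∀ x ∈ J, ∀ y ∈ J, ∃ w ∈ J, x * y = a * w) {x : R} (hx : x ∈ J) :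
    algebraMap R S a ∣ algebraMap R S x := by
  have hS := h.not_isField
  by_cases hx0 : x = 0
  · simp [hx0]
  have hpow : ∀ n : ℕ, ∃ w ∈ J, x ^ (n + 1) = a ^ n * w := by
    intro n
    induction n with
    | zero => exact ⟨x, hx, by simp⟩
    | succ n ih =>
      obtain ⟨w, hw, e⟩ := ih
      obtain ⟨w', hw', e'⟩ := ha w hw x hx
      exact ⟨w', hw', by rw [pow_succ, e, mul_assoc, e', pow_succ]; ring⟩
  have hvp : ∀ (Q : MaximalSpectrum S) {y : S} (_ : y ≠ 0) (n : ℕ), val Q (y ^ n) = n * val Q y := by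
    intro Q y hy n
    induction n with
    | zero => simpa using val_isUnit hS Q isUnit_one
    | succ n ih => rw [pow_succ, val_mul hS Q (pow_ne_zero _ hy) hy, ih]; ring
  refine dvd_of_val_le hS (h.map_ne_zero ha0) (h.map_ne_zero hx0) fun Q => ?_
  by_contra! hlt
  obtain ⟨w, hw, e⟩ := hpow (val Q (algebraMap R S x) + 1)
  have hw0 : w ≠ 0 := by
    rintro rfl
    rw [mul_zero] at e
    exact hx0 (pow_eq_zero_iff (Nat.succ_ne_zero _) |>.1 e)
  have e2 := congrArg (fun t => val Q (algebraMap R S t)) e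
  simp only [map_mul, map_pow] at e2
  rw [val_mul hS Q (pow_ne_zero _ (h.map_ne_zero ha0)) (h.map_ne_zero hw0),
    hvp Q (h.map_ne_zero ha0), hvp Q (h.map_ne_zero hx0)] at e2
  have h3 : (val Q (algebraMap R S x) + 1) * (val Q (algebraMap R S x) + 1) ≤
    (val Q (algebraMap R S x) + 1) * val Q (algebraMap R S a) := Nat.mul_le_mul_left _ hlt
  have h4 : (val Q (algebraMap R S x) + 1 + 1) * val Q (algebraMap R S x) + 1 =
    (val Q (algebraMap R S x) + 1) * (val Q (algebraMap R S x) + 1) := by ring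
  omega

/-- The conductor of `S` in the maximal ideal of `R` is generated by some `c`. -/
theorem exists_conductor : ∃ c : S, c ≠ 0 ∧
    (∀ x, c ∣ x ↔ ∀ s : S, ∃ r ∈ maximalIdeal R, algebraMap R S r = x * s) := by
  let C : Ideal S :=
    { carrier := {x | ∀ s : S, ∃ r ∈ maximalIdeal R, algebraMap R S r = x * s}
      zero_mem' := fun s => ⟨0, zero_mem _, by simp⟩
      add_mem' := fun {x y} hx hy s => by
        obtain ⟨r, hr, e⟩ := hx s
        obtain ⟨r', hr', e'⟩ := hy s
        exact ⟨r + r', add_mem hr hr', by rw [map_add, e, e']; ring⟩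
      smul_mem' := fun t x hx s => by
        obtain ⟨r, hr, e⟩ := hx (t * s)
        exact ⟨r, hr, by rw [e, smul_eq_mul]; ring⟩ }
  have hC : ∀ x, x ∈ C ↔ ∀ s : S, ∃ r ∈ maximalIdeal R, algebraMap R S r = x * s := fun _ => Iff.rfl
  refine ⟨Submodule.IsPrincipal.generator C, ?_, fun x => ?_⟩
  · obtain ⟨d, hd, hdS⟩ := h.conductor
    obtain ⟨x, hx, hx0⟩ := Submodule.exists_mem_ne_zero_of_ne_bot h.ne_bot
    have hmem : algebraMap R S (x * d) ∈ C := by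
      intro s
      obtain ⟨r, hr⟩ := hdS s
      exact ⟨x * r, Ideal.mul_mem_right _ _ hx, by rw [map_mul, hr, map_mul]; ring⟩
    intro h0
    rw [Submodule.IsPrincipal.mem_iff_generator_dvd, h0, zero_dvd_iff] at hmem
    exact h.map_ne_zero (mul_ne_zero hx0 hd) hmem
  · rw [← hC, Submodule.IsPrincipal.mem_iff_generator_dvd]

end IsStableLocalOrder

end OrderIdeals

/-! ### Stable local orders below several maximal ideals -/

namespace OrderIdeals

open MonoidArith IsLocalRing

section

variable {S : Type*} [CommRing S] [IsDomain S] [IsPrincipalIdealRing S]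

theorem isUnit_of_forall_not_gen_dvd {x : S} (h : ∀ Q : MaximalSpectrum S, ¬ gen Q ∣ x) :
    IsUnit x := by
  by_contra hu
  obtain ⟨M, hM, hxM⟩ := exists_max_ideal_of_mem_nonunits hu
  exact h ⟨M, hM⟩ (mem_iff_gen_dvd.1 hxM)

theorem gen_dvd_mul_sub_one (Q : MaximalSpectrum S) {x : S} (hx : ¬ gen Q ∣ x) :
    ∃ y, gen Q ∣ x * y - 1 := by
  have hQ := Q.isMaximal
  obtain ⟨y, z, hz, e⟩ := hQ.exists_inv (mt mem_iff_gen_dvd.1 hx)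
  refine ⟨y, ?_⟩
  rw [← mem_iff_gen_dvd]
  have : x * y - 1 = -z := by rw [← e]; ring
  rw [this]
  exact neg_mem hz

/-- A unit of a semilocal principal ideal domain with prescribed residues at two maximal ideals. -/
theorem exists_isUnit_gen_dvd_sub [Finite (MaximalSpectrum S)] {Q Q' : MaximalSpectrum S}
    (hQ : Q ≠ Q') {x y : S} (hx : ¬ gen Q ∣ x) (hy : ¬ gen Q' ∣ y) :
    ∃ e : S, IsUnit e ∧ gen Q ∣ e - x ∧ gen Q' ∣ e - y := by
  classical
  have hco : Pairwise (Function.onFun IsCoprime fun Q : MaximalSpectrum S => Q.asIdeal) := by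
    intro A B hAB
    have hA := A.isMaximal
    have hB := B.isMaximal
    exact Ideal.isCoprime_of_isMaximal fun h => hAB (MaximalSpectrum.ext h)
  obtain ⟨e, he⟩ := Ideal.exists_forall_sub_mem_ideal hco
    (fun A => if A = Q then x else if A = Q' then y else 1)
  have h1 := he Q
  have h2 := he Q'
  rw [if_pos rfl] at h1
  rw [if_neg hQ.symm, if_pos rfl] at h2
  refine ⟨e, isUnit_of_forall_not_gen_dvd fun A hA => ?_, mem_iff_gen_dvd.1 h1,
    mem_iff_gen_dvd.1 h2⟩
  have h3 := mem_iff_gen_dvd.1 (he A)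
  have h4 := (dvd_sub_right hA).1 h3
  split_ifs at h4 with hc hc'
  · subst hc; exact hx h4
  · subst hc'; exact hy h4
  · exact A.isMaximal.ne_top ((Ideal.eq_top_iff_one _).2 (mem_iff_gen_dvd.2 h4))

end

section Transport

variable {A E : Type*} [CommMonoid A] [CommMonoid E] {ι : Type*}

theorem isUnit_map_iff_of_associated {g : A →* E} (hg : Function.Surjective g)
    (hga : ∀ a b, g a = g b ↔ Associated a b) (a : A) : IsUnit (g a) ↔ IsUnit a := by
  refine ⟨fun h => ?_, fun h => h.map g⟩
  obtain ⟨e, he⟩ := h.exists_right_inv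
  obtain ⟨b, rfl⟩ := hg e
  rw [← map_mul, ← map_one g, hga] at he
  exact isUnit_of_mul_isUnit_left (he.isUnit_iff.2 isUnit_one)

theorem irreducible_map_iff_of_associated {g : A →* E} (hg : Function.Surjective g)
    (hga : ∀ a b, g a = g b ↔ Associated a b) (a : A) : Irreducible (g a) ↔ Irreducible a := by
  have hu := isUnit_map_iff_of_associated hg hga
  refine ⟨fun h => ⟨mt (hu a).2 h.not_isUnit, fun b c e => ?_⟩,
    fun h => ⟨mt (hu a).1 h.not_isUnit, fun b c e => ?_⟩⟩
  · rw [← hu, ← hu]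
    exact h.isUnit_or_isUnit (by rw [e, map_mul])
  · obtain ⟨b, rfl⟩ := hg b
    obtain ⟨c, rfl⟩ := hg c
    rw [← map_mul, hga] at e
    have h2 := e.irreducible_iff.1 h
    rw [hu, hu]
    exact h2.isUnit_or_isUnit rfl

/-- Valuation data only depend on the monoid up to units. -/
theorem exists_valData_of_associated (D : ValData A ι) (g : A →* E) (hg : Function.Surjective g)
    (hga : ∀ a b, g a = g b ↔ Associated a b) :
    ∃ D' : ValData E ι, D'.f = D.f ∧ D'.m = g D.m ∧ ∀ i a, D'.v i (g a) = D.v i a := by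
  have hvu : ∀ i (a : A), IsUnit a → D.v i a = 0 := by
    intro i a ha
    obtain ⟨b, hb⟩ := ha.exists_right_inv
    have := congrArg (D.v i) hb
    rw [D.v_mul, D.v_one] at this
    omega
  have hva : ∀ i (a b : A), g a = g b → D.v i a = D.v i b := by
    intro i a b h
    obtain ⟨u, rfl⟩ := (hga a b).1 h
    rw [D.v_mul, hvu i _ u.isUnit, add_zero]
  have hs : ∀ x, g (Function.surjInv hg x) = x := Function.surjInv_eq hg
  have hu := isUnit_map_iff_of_associated hg hga
  have hv : ∀ i a, D.v i (Function.surjInv hg (g a)) = D.v i a := fun i a => hva i _ _ (hs _)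
  refine ⟨
    { m := g D.m
      irr := (irreducible_map_iff_of_associated hg hga _).2 D.irr
      cancel := fun x y z h => ?_
      v := fun i x => D.v i (Function.surjInv hg x)
      v_one := fun i => ?_
      v_mul := fun i x y => ?_
      pos := fun i => ?_
      le := fun i u h => ?_
      merge := fun u u' h h' => ?_
      f := D.f
      dvd := fun u w h => ?_ }, rfl, rfl, hv⟩
  · obtain ⟨x, rfl⟩ := hg x
    obtain ⟨y, rfl⟩ := hg y
    obtain ⟨z, rfl⟩ := hg z
    rw [← map_mul, ← map_mul, hga] at h
    obtain ⟨u, hu⟩ := h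
    rw [mul_assoc] at hu
    exact (hga _ _).2 ⟨u, D.cancel _ _ _ hu⟩
  · rw [← map_one g, hv, D.v_one]
  · obtain ⟨x, rfl⟩ := hg x
    obtain ⟨y, rfl⟩ := hg y
    rw [← map_mul, hv, hv, hv, D.v_mul]
  · rw [hv]; exact D.pos i
  · obtain ⟨u, rfl⟩ := hg u
    rw [hv, hv]
    exact D.le i u (mt (hu u).2 h)
  · obtain ⟨u, rfl⟩ := hg u
    obtain ⟨u', rfl⟩ := hg u'
    obtain ⟨w, hw, e⟩ := D.merge u u' (mt (hu u).2 h) (mt (hu u').2 h')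
    exact ⟨g w, mt (hu w).1 hw, by rw [← map_mul, e, map_mul]⟩
  · obtain ⟨u, rfl⟩ := hg u
    obtain ⟨w, rfl⟩ := hg w
    exact map_dvd g (D.dvd u w fun i => by simpa only [hv] using h i)

theorem exists_splitData_of_associated (D : SplitData A ι) (g : A →* E)
    (hg : Function.Surjective g) (hga : ∀ a b, g a = g b ↔ Associated a b) :
    Nonempty (SplitData E ι) := by
  obtain ⟨D', hf, -, hv⟩ := exists_valData_of_associated D.toValData g hg hga
  refine ⟨{ D' with flex := fun u w h => ?_ }⟩
  obtain ⟨u, rfl⟩ := hg u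
  obtain ⟨w, rfl⟩ := hg w
  obtain ⟨X, Y, hX, hY, e⟩ := D.flex u w fun i => by simpa only [hv, hf] using h i
  exact ⟨g X, g Y, (irreducible_map_iff_of_associated hg hga _).2 hX,
    (irreducible_map_iff_of_associated hg hga _).2 hY, by rw [e, map_mul, map_mul]⟩

theorem exists_nonsplitData_of_associated (D : NonsplitData A) (g : A →* E)
    (hg : Function.Surjective g) (hga : ∀ a b, g a = g b ↔ Associated a b) :
    ∃ D' : NonsplitData E, D'.r = D.r ∧ D'.s = D.s := by
  obtain ⟨D', hf, hm, hv⟩ := exists_valData_of_associated D.toValData g hg hga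
  have hirr := irreducible_map_iff_of_associated hg hga
  refine ⟨{ D' with
    s := D.s
    w₀ := g D.w₀
    irr_w₀ := (hirr _).2 D.irr_w₀
    v_w₀ := by rw [hv, D.v_w₀]
    le_s := fun u hu => ?_
    flex := fun u w h => ?_ }, ?_, rfl⟩
  · obtain ⟨u, rfl⟩ := hg u
    rw [hv]
    exact D.le_s u ((hirr u).1 hu)
  · obtain ⟨u, rfl⟩ := hg u
    obtain ⟨w, rfl⟩ := hg w
    obtain ⟨X, Y, hX, hY, e⟩ := D.flex u w (by simpa only [hv] using h)
    exact ⟨g X, g Y, (hirr _).2 hX, (hirr _).2 hY, by rw [e, map_mul, map_mul]⟩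
  · change D'.v () D'.m = D.v () D.m
    rw [hm, hv]

end Transport

namespace IsStableLocalOrder

variable {R S : Type*} [CommRing R] [IsDomain R] [IsLocalRing R] [CommRing S] [IsDomain S]
  [IsPrincipalIdealRing S] [Algebra R S] (h : IsStableLocalOrder R S)

theorem isUnit_coe_iff {a : R⁰} : IsUnit (a : R) ↔ IsUnit a := by
  refine ⟨fun ha => ?_, fun ha => ha.map (Submonoid.subtype _)⟩
  obtain ⟨b, hb⟩ := ha.exists_right_inv
  have hb0 : b ≠ 0 := by
    rintro rfl
    simp at hb
  exact IsUnit.of_mul_eq_one ⟨b, mem_nonZeroDivisors_of_ne_zero hb0⟩ (Subtype.ext hb)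

theorem mem_maximalIdeal_iff_not_isUnit {a : R⁰} : (a : R) ∈ maximalIdeal R ↔ ¬ IsUnit a := by
  rw [mem_maximalIdeal, mem_nonunits_iff, isUnit_coe_iff]

theorem ne_zero_coe (a : R⁰) : (a : R) ≠ 0 := nonZeroDivisors.ne_zero a.2

/-- If `M ^ 2 = m M` for the maximal ideal `M`, then the elements of `M` outside of `m M` are atoms. -/
theorem irreducible_of_forall_ne {m : R}
    (hmm : ∀ x ∈ maximalIdeal R, ∀ y ∈ maximalIdeal R, ∃ w ∈ maximalIdeal R, x * y = m * w)
    {a : R⁰} (ha : (a : R) ∈ maximalIdeal R) (hne : ∀ w ∈ maximalIdeal R, (a : R) ≠ m * w) :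
    Irreducible a := by
  refine ⟨mem_maximalIdeal_iff_not_isUnit.1 ha, fun x y e => ?_⟩
  by_contra! hxy
  obtain ⟨w, hw, e'⟩ := hmm x (mem_maximalIdeal_iff_not_isUnit.2 hxy.1) y
    (mem_maximalIdeal_iff_not_isUnit.2 hxy.2)
  exact hne w hw (by rw [← e', e]; rfl)

include h

/-- The valuation data of the monoid of non-zero elements of `R`, for a family of maximal ideals
of `S` which exhausts all of them. -/
theorem exists_valData {κ : Type*} (q : κ → MaximalSpectrum S) (hq : Function.Surjective q)
    {m : R} (hm : m ∈ maximalIdeal R) (hm0 : m ≠ 0)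
    (hmm : ∀ x ∈ maximalIdeal R, ∀ y ∈ maximalIdeal R, ∃ w ∈ maximalIdeal R, x * y = m * w)
    {c : S} (hc0 : c ≠ 0)
    (hc : ∀ x, c ∣ x ↔ ∀ s : S, ∃ r ∈ maximalIdeal R, algebraMap R S r = x * s)
    (f : ℕ) (hf : ∀ Q, val Q c ≤ f) :
    ∃ D : ValData R⁰ κ, (D.m : R) = m ∧ D.f = f ∧
      ∀ i a, D.v i a = val (q i) (algebraMap R S a) := by
  have hS := h.not_isField
  have hφ : ∀ a : R⁰, algebraMap R S a ≠ 0 := fun a => h.map_ne_zero (ne_zero_coe a)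
  refine ⟨
    { m := ⟨m, mem_nonZeroDivisors_of_ne_zero hm0⟩
      irr := irreducible_of_forall_ne hmm hm fun w hw e => ?_
      cancel := fun x y z e => mul_left_cancel e
      v := fun i a => val (q i) (algebraMap R S a)
      v_one := fun i => by simpa using val_isUnit hS (q i) isUnit_one
      v_mul := fun i x y => by
        rw [← val_mul hS _ (hφ x) (hφ y), ← map_mul]; rfl
      pos := fun i => ?_
      le := fun i u hu => ?_
      merge := fun u u' hu hu' => ?_
      f := f
      dvd := fun u w huw => ?_ }, rfl, rfl, fun _ _ => rfl⟩
  · have e1 : m * 1 = m * w := by simpa using e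
    rw [← mul_left_cancel₀ hm0 e1] at hw
    exact (Ideal.ne_top_iff_one _).1 (maximalIdeal.isMaximal R).ne_top hw
  · exact (one_le_val_iff _).2
      (mem_iff_gen_dvd.1 (h.mem_of_mem_maximalIdeal _ hm))
  · obtain ⟨t, ht⟩ := h.map_dvd_map hm0 hmm (mem_maximalIdeal_iff_not_isUnit.2 hu)
    have ht0 : t ≠ 0 := by
      rintro rfl
      rw [mul_zero] at ht
      exact hφ u ht
    change val _ (algebraMap R S m) ≤ val _ (algebraMap R S u)
    rw [ht, val_mul hS _ (h.map_ne_zero hm0) ht0]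
    omega
  · obtain ⟨w, hw, e⟩ := hmm u (mem_maximalIdeal_iff_not_isUnit.2 hu) u'
      (mem_maximalIdeal_iff_not_isUnit.2 hu')
    have hw0 : w ≠ 0 := by
      rintro rfl
      rw [mul_zero] at e
      exact mul_ne_zero (ne_zero_coe u) (ne_zero_coe u') e
    exact ⟨⟨w, mem_nonZeroDivisors_of_ne_zero hw0⟩, mem_maximalIdeal_iff_not_isUnit.1 hw,
      Subtype.ext e⟩
  · obtain ⟨t, ht⟩ : algebraMap R S w * c ∣ algebraMap R S u := by
      refine dvd_of_val_le hS (mul_ne_zero (hφ w) hc0) (hφ u) fun Q => ?_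
      obtain ⟨i, rfl⟩ := hq Q
      rw [val_mul hS _ (hφ w) hc0]
      exact (Nat.add_le_add_left (hf _) _).trans (huw i)
    obtain ⟨r, -, hr⟩ := (hc c).1 dvd_rfl t
    have e : (u : R) = w * r := h.injective (by rw [ht, map_mul, hr, mul_assoc])
    have hr0 : r ≠ 0 := by
      rintro rfl
      rw [mul_zero] at e
      exact ne_zero_coe u e
    exact ⟨⟨r, mem_nonZeroDivisors_of_ne_zero hr0⟩, Subtype.ext e⟩

/-- If `m β` lies in the conductor, but `β` is not in the maximal ideal of `R`, then `m β` is an atom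
of `R`. -/
theorem exists_irreducible {m : R} (hm0 : m ≠ 0)
    (hmm : ∀ x ∈ maximalIdeal R, ∀ y ∈ maximalIdeal R, ∃ w ∈ maximalIdeal R, x * y = m * w)
    {c : S} (hc : ∀ x, c ∣ x ↔ ∀ s : S, ∃ r ∈ maximalIdeal R, algebraMap R S r = x * s)
    {β : S} (hcβ : c ∣ algebraMap R S m * β)
    (hβ : ∀ r ∈ maximalIdeal R, algebraMap R S r ≠ β) :
    ∃ X : R⁰, Irreducible X ∧ algebraMap R S X = algebraMap R S m * β := by
  obtain ⟨r, hr, e⟩ := (hc _).1 hcβ 1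
  rw [mul_one] at e
  have hβ0 : β ≠ 0 := fun h0 => hβ 0 (zero_mem _) (by rw [map_zero, h0])
  have hr0 : r ≠ 0 := by
    rintro rfl
    rw [map_zero] at e
    exact mul_ne_zero (h.map_ne_zero hm0) hβ0 e.symm
  refine ⟨⟨r, mem_nonZeroDivisors_of_ne_zero hr0⟩, irreducible_of_forall_ne hmm hr
    fun w hw ew => hβ w hw ?_, e⟩
  change r = m * w at ew
  rw [ew, map_mul] at e
  exact mul_left_cancel₀ (h.map_ne_zero hm0) e

/-- The conductor divided by a generator of a maximal ideal `Q`: the multiples `b z` of `b = c / gen Q`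
lie in the maximal ideal of `R` if `z` is in `Q`, but not if `z` lies in a certain non-zero residue
class modulo `Q`. -/
theorem exists_conductor_div {c : S} (hc0 : c ≠ 0)
    (hc : ∀ x, c ∣ x ↔ ∀ s : S, ∃ r ∈ maximalIdeal R, algebraMap R S r = x * s)
    (Q : MaximalSpectrum S) : ∃ b t : S, c = gen Q * b ∧ ¬ gen Q ∣ t ∧
      (∀ z, gen Q ∣ z - t → ∀ r ∈ maximalIdeal R, algebraMap R S r ≠ b * z) ∧
      ∀ z, gen Q ∣ z → ∃ r ∈ maximalIdeal R, algebraMap R S r = b * z := by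
  have hS := h.not_isField
  obtain ⟨r, hr, e⟩ := (hc c).1 dvd_rfl 1
  rw [mul_one] at e
  obtain ⟨b, hb⟩ := mem_iff_gen_dvd.1 (e ▸ h.mem_of_mem_maximalIdeal Q hr)
  have hb0 : b ≠ 0 := by
    rintro rfl
    exact hc0 (by rw [hb, mul_zero])
  have hcb : ¬ c ∣ b := by
    intro hcb
    rw [hb] at hcb
    have h1 : gen Q * b ∣ 1 * b := by rwa [one_mul]
    exact (gen_prime hS Q).not_isUnit (isUnit_of_dvd_one ((mul_dvd_mul_iff_right hb0).1 h1))
  have hpz : ∀ z, gen Q ∣ z → ∃ r ∈ maximalIdeal R, algebraMap R S r = b * z := by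
    rintro _ ⟨z, rfl⟩
    obtain ⟨r, hr, e⟩ := (hc c).1 dvd_rfl z
    exact ⟨r, hr, by rw [e, hb]; ring⟩
  rw [hc] at hcb
  push Not at hcb
  obtain ⟨t, ht⟩ := hcb
  refine ⟨b, t, hb, fun hpt => ?_, fun z hz r hr e => ?_, hpz⟩
  · obtain ⟨r, hr, e⟩ := hpz t hpt
    exact ht r hr e
  · obtain ⟨r', hr', e'⟩ := hpz _ hz
    exact ht (r - r') (sub_mem hr hr') (by rw [map_sub, e, e']; ring)

/-- If `S` has at least two maximal ideals, every element of `R` of large value is a product of two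
atoms: the two residues that decide whether a factor is an atom can be adjusted by a unit of
`S`. -/
theorem exists_splitData [Finite (MaximalSpectrum S)] {Q Q' : MaximalSpectrum S} (hQ : Q ≠ Q') :
    Nonempty (SplitData R⁰ (MaximalSpectrum S)) := by
  have hS := h.not_isField
  obtain ⟨m, hm, hm0, hmm⟩ := h.stable _ h.ne_bot
  obtain ⟨c, hc0, hc⟩ := h.exists_conductor
  obtain ⟨b, t, hb, ht, hbt, -⟩ := h.exists_conductor_div hc0 hc Q
  obtain ⟨b', t', hb', ht', hbt', -⟩ := h.exists_conductor_div hc0 hc Q'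
  have hb0 : b ≠ 0 := fun h0 => hc0 (by rw [hb, h0, mul_zero])
  have hb'0 : b' ≠ 0 := fun h0 => hc0 (by rw [hb', h0, mul_zero])
  have hφm := h.map_ne_zero hm0
  set e := algebraMap R S m * b * (algebraMap R S m * b') with he
  have he0 : e ≠ 0 := mul_ne_zero (mul_ne_zero hφm hb0) (mul_ne_zero hφm hb'0)
  obtain ⟨f, hf⟩ := (Set.finite_range fun Q : MaximalSpectrum S => val Q (e * c)).bddAbove
  have hf : ∀ Q, val Q (e * c) ≤ f := fun Q => hf ⟨Q, rfl⟩
  have hf' : ∀ Q, val Q e + val Q c ≤ f := fun Q => by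
    rw [← val_mul hS Q he0 hc0]; exact hf Q
  obtain ⟨D, hDm, hDf, hDv⟩ := h.exists_valData id Function.surjective_id hm hm0 hmm hc0 hc f
    fun Q => (Nat.le_add_left _ _).trans (hf' Q)
  have hφ : ∀ a : R⁰, algebraMap R S a ≠ 0 := fun a => h.map_ne_zero (ne_zero_coe a)
  refine ⟨{ D with flex := fun u w huw => ?_ }⟩
  obtain ⟨β, hβ⟩ : algebraMap R S w * e ∣ algebraMap R S u := by
    refine dvd_of_val_le hS (mul_ne_zero (hφ w) he0) (hφ u) fun Q => ?_
    have h1 := huw Q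
    rw [hDv, hDv, hDf] at h1
    simp only [id] at h1
    rw [val_mul hS _ (hφ w) he0]
    have := hf' Q
    omega
  have hβ0 : β ≠ 0 := by
    rintro rfl
    rw [mul_zero] at hβ
    exact hφ u hβ
  -- the cofactor `β` is split as `β₁ * β₂`, with `β₁` prime to `Q` and `β₂` prime to `Q'`
  obtain ⟨β₂, hβ₂, hndvd⟩ := (finite_val hS Q' hβ0).exists_eq_pow_mul_and_not_dvd
  have hβ₁ : ¬ gen Q ∣ gen Q' ^ multiplicity (gen Q') β := fun hd =>
    not_gen_dvd_gen hQ ((gen_prime hS Q).dvd_of_dvd_pow hd)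
  set β₁ := gen Q' ^ multiplicity (gen Q') β
  -- a unit `η` with `β₁ η ≡ t` modulo `Q` and `β₂ ≡ t' η` modulo `Q'`
  obtain ⟨y, hy⟩ := gen_dvd_mul_sub_one Q hβ₁
  obtain ⟨y', hy'⟩ := gen_dvd_mul_sub_one Q' ht'
  have hny : ¬ gen Q ∣ t * y := by
    intro hd
    rcases (gen_prime hS Q).dvd_or_dvd hd with hd | hd
    · exact ht hd
    · have := (dvd_sub_right (hd.mul_left β₁)).1 hy
      exact (gen_prime hS Q).not_isUnit (isUnit_of_dvd_one this)
  have hny' : ¬ gen Q' ∣ β₂ * y' := by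
    intro hd
    rcases (gen_prime hS Q').dvd_or_dvd hd with hd | hd
    · exact hndvd hd
    · have := (dvd_sub_right (hd.mul_left t')).1 hy'
      exact (gen_prime hS Q').not_isUnit (isUnit_of_dvd_one this)
  obtain ⟨η, hη, hη1, hη2⟩ := exists_isUnit_gen_dvd_sub hQ hny hny'
  obtain ⟨ξ, hξ⟩ := hη.exists_right_inv
  have h1 : gen Q ∣ β₁ * η - t := by
    have : β₁ * η - t = β₁ * (η - t * y) + t * (β₁ * y - 1) := by ring
    rw [this]
    exact dvd_add (hη1.mul_left _) (hy.mul_left _)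
  have h2 : gen Q' ∣ β₂ * ξ - t' := by
    have : β₂ * ξ - t' = -(t' * ξ * (η - β₂ * y')) - β₂ * ξ * (t' * y' - 1) + t' * (η * ξ - 1) := by
      ring
    rw [this, hξ, sub_self, mul_zero, add_zero]
    exact dvd_sub (dvd_neg.2 (hη2.mul_left _)) (hy'.mul_left _)
  have hdiv : ∀ (A : MaximalSpectrum S) (b z : S), c = gen A * b →
      c ∣ algebraMap R S m * (b * z) := by
    intro A b z hb
    obtain ⟨k, hk⟩ := mem_iff_gen_dvd.1 (h.mem_of_mem_maximalIdeal A hm)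
    exact ⟨k * z, by rw [hk, hb]; ring⟩
  obtain ⟨X, hX, eX⟩ := h.exists_irreducible hm0 hmm hc (hdiv Q b _ hb) (hbt _ h1)
  obtain ⟨Y, hY, eY⟩ := h.exists_irreducible hm0 hmm hc (hdiv Q' b' _ hb') (hbt' _ h2)
  refine ⟨X, Y, hX, hY, Subtype.ext (h.injective ?_)⟩
  change algebraMap R S u = algebraMap R S (w * (X * Y))
  rw [hβ, map_mul, map_mul, eX, eY, hβ₂, he]
  linear_combination (- algebraMap R S w * (algebraMap R S m) ^ 2 * b * b' * β₁ * β₂) * hξ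

end IsStableLocalOrder

end OrderIdeals

/-! ### Stable local orders below a single maximal ideal -/

namespace OrderIdeals

open MonoidArith IsLocalRing

namespace IsStableLocalOrder

variable {R S : Type*} [CommRing R] [IsDomain R] [IsLocalRing R] [CommRing S] [IsDomain S]
  [IsPrincipalIdealRing S] [Algebra R S] (h : IsStableLocalOrder R S)

include h

/-- If `S` is local with prime element `p`, and `c` generates the conductor, there is `b` associated to
`c / p` such that every unit of `S` is a product of two units `z` with `b z` outside of the maximal
ideal `M` of `R`. Stability provides a generator `a` for the ideal of all elements of `M` divisible by
`c / p`. If `a` is divisible by `c`, then no unit `z` has `(c / p) z` in `M`. Otherwise `b = a` is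
taken: the `z` with `a z` in `M` form a proper subring of `S` that contains `R` and `p S` and is closed
under inverses, and every unit is a product of two units outside of such a subring. -/
theorem exists_unit_factors {Q : MaximalSpectrum S} (hQ : ∀ Q', Q' = Q)
    {c : S} (hc0 : c ≠ 0)
    (hc : ∀ x, c ∣ x ↔ ∀ s : S, ∃ r ∈ maximalIdeal R, algebraMap R S r = x * s) :
    ∃ b : S, b ≠ 0 ∧ val Q b + 1 = val Q c ∧
      ∀ ε : S, IsUnit ε → ∃ η ξ : S, η * ξ = ε ∧
        (∀ r ∈ maximalIdeal R, algebraMap R S r ≠ b * η) ∧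
        ∀ r ∈ maximalIdeal R, algebraMap R S r ≠ b * ξ := by
  have hS := h.not_isField
  have hp := gen_prime hS Q
  have hunit : ∀ {x : S}, ¬ gen Q ∣ x → IsUnit x := fun hx =>
    isUnit_of_forall_not_gen_dvd fun Q' => by rw [hQ Q']; exact hx
  obtain ⟨b, t, hb, ht, hbt, hbp⟩ := h.exists_conductor_div hc0 hc Q
  have hb0 : b ≠ 0 := fun h0 => hc0 (by rw [hb, h0, mul_zero])
  have hval : val Q b + 1 = val Q c := by
    rw [hb, val_mul hS Q hp.ne_zero hb0, val_gen_self, add_comm]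
  let J : Ideal R := maximalIdeal R ⊓ (Ideal.span {b}).comap (algebraMap R S)
  have hJ : ∀ x, x ∈ J ↔ x ∈ maximalIdeal R ∧ b ∣ algebraMap R S x := fun x => by
    simp [J, Ideal.mem_comap, Ideal.mem_span_singleton]
  obtain ⟨rc, hrc, erc⟩ := (hc c).1 dvd_rfl 1
  rw [mul_one] at erc
  have hrcJ : rc ∈ J := (hJ rc).2 ⟨hrc, by rw [erc, hb]; exact dvd_mul_left _ _⟩
  have hrc0 : rc ≠ 0 := by
    rintro rfl
    exact hc0 (by rw [← erc, map_zero])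
  obtain ⟨a, haJ, ha0, ha⟩ := h.stable J fun h0 => hrc0 (by rw [h0] at hrcJ; simpa using hrcJ)
  obtain ⟨η₀, hη₀⟩ := ((hJ a).1 haJ).2
  by_cases hd : gen Q ∣ η₀
  · have hV : ∀ z, ¬ gen Q ∣ z → ∀ r ∈ maximalIdeal R, algebraMap R S r ≠ b * z := by
      intro z hz r hr e
      have h1 : algebraMap R S a ∣ algebraMap R S r :=
        h.map_dvd_map ha0 ha ((hJ r).2 ⟨hr, e ▸ dvd_mul_right _ _⟩)
      rw [hη₀, e, mul_dvd_mul_iff_left hb0] at h1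
      exact hz (hd.trans h1)
    refine ⟨b, hb0, hval, fun ε hε => ⟨1, ε, one_mul ε, hV 1 fun hd => ?_, hV ε fun hd => ?_⟩⟩
    · exact hp.not_isUnit (isUnit_of_dvd_one hd)
    · exact hp.not_isUnit (isUnit_of_dvd_unit hd hε)
  · have hη₀u := hunit hd
    have hφa := h.map_ne_zero ha0
    let T : Subalgebra R S :=
      { carrier := {z | ∃ r ∈ maximalIdeal R, algebraMap R S r = algebraMap R S a * z}
        mul_mem' := by
          rintro x y ⟨r, hr, e⟩ ⟨r', hr', e'⟩
          have hmem : ∀ {r z}, r ∈ maximalIdeal R → algebraMap R S r = algebraMap R S a * z →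
              r ∈ J := fun {r z} hr e => (hJ r).2 ⟨hr, by
            rw [e, hη₀, mul_assoc]; exact dvd_mul_right _ _⟩
          obtain ⟨w, hw, ew⟩ := ha r (hmem hr e) r' (hmem hr' e')
          refine ⟨w, ((hJ w).1 hw).1, mul_left_cancel₀ hφa ?_⟩
          rw [← map_mul, ← ew, map_mul, e, e']
          ring
        add_mem' := by
          rintro x y ⟨r, hr, e⟩ ⟨r', hr', e'⟩
          exact ⟨r + r', add_mem hr hr', by rw [map_add, e, e']; ring⟩
        algebraMap_mem' := fun x => ⟨a * x, Ideal.mul_mem_right _ _ ((hJ a).1 haJ).1,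
          map_mul _ _ _⟩ }
    have hT : ∀ z, z ∈ T ↔ ∃ r ∈ maximalIdeal R, algebraMap R S r = algebraMap R S a * z :=
      fun z => Iff.rfl
    have hpT : ∀ z, gen Q ∣ z → z ∈ T := by
      intro z hz
      obtain ⟨r, hr, e⟩ := hbp (η₀ * z) (hz.mul_left _)
      exact ⟨r, hr, by rw [e, hη₀]; ring⟩
    have hinv : ∀ x y : S, x * y = 1 → x ∈ T → y ∈ T := by
      intro x y hxy hx
      have hint := h.integral
      have : Algebra.IsIntegral T S := Algebra.IsIntegral.tower_top (R := R)
      have hu : IsUnit (algebraMap T S ⟨x, hx⟩) := IsUnit.of_mul_eq_one y hxy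
      have hu' := (isUnit_map_iff (algebraMap T S) _).1 hu
      obtain ⟨y', hy'⟩ := hu'.exists_right_inv
      have h1 : x * y' = 1 := congrArg Subtype.val hy'
      have : y = y' := by
        calc y = y * (x * y') := by rw [h1, mul_one]
          _ = (x * y) * y' := by ring
          _ = y' := by rw [hxy, one_mul]
      rw [this]
      exact y'.2
    obtain ⟨η₁, hη₁⟩ := hη₀u.exists_right_inv
    have htT : t * η₁ ∉ T := by
      rintro ⟨r, hr, e⟩
      refine hbt t (by simp) r hr ?_
      rw [e, hη₀]
      linear_combination b * t * hη₁
    have hnT : ∀ z, z ∉ T → ∀ r ∈ maximalIdeal R, algebraMap R S r ≠ algebraMap R S a * z :=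
      fun z hz r hr e => hz ⟨r, hr, e⟩
    have huT : ∀ {z}, z ∉ T → ∃ y, z * y = 1 := fun hz =>
      (hunit (mt (hpT _) hz)).exists_right_inv
    refine ⟨algebraMap R S a, hφa, ?_, fun ε hε => ?_⟩
    · rw [← hval, hη₀, val_mul hS Q hb0 hη₀u.ne_zero, val_isUnit hS Q hη₀u, add_zero]
    obtain ⟨ε', hε'⟩ := hε.exists_right_inv
    by_cases hεT : ε ∈ T
    · obtain ⟨y, hy⟩ := huT htT
      refine ⟨t * η₁, ε * y, by linear_combination ε * hy, hnT _ htT, hnT _ fun hmem => htT ?_⟩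
      have h1 : ε' ∈ T := hinv _ _ hε' hεT
      refine hinv y _ (by rw [mul_comm]; exact hy) ?_
      have : y = ε * y * ε' := by linear_combination (-y) * hε'
      rw [this]
      exact T.mul_mem hmem h1
    · -- `1 + ε` and `ε / (1 + ε) = 1 - 1 / (1 + ε)` are both outside of `T`
      have h1 : 1 + ε ∉ T := fun hmem => hεT (by
        have := T.sub_mem hmem T.one_mem
        simpa using this)
      obtain ⟨y, hy⟩ := huT h1
      refine ⟨1 + ε, ε * y, by linear_combination ε * hy, hnT _ h1, hnT _ fun hmem => h1 ?_⟩
      refine hinv y _ (by rw [mul_comm]; exact hy) ?_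
      have : y = 1 - ε * y := by linear_combination hy
      rw [this]
      exact T.sub_mem T.one_mem hmem

/-- If `S` is local, the atoms of maximal value in `R` have the value `s` of `m b`, where `b` is as in
`exists_unit_factors`. Hence `r = s` if and only if `b` is a unit, that is, if the maximal ideal of `R`
contains that of `S`. -/
theorem exists_nonsplitData {Q : MaximalSpectrum S} (hQ : ∀ Q', Q' = Q) :
    ∃ D : NonsplitData R⁰, (Function.Surjective (algebraMap R S) → D.r = D.s) ∧
      (D.r = D.s → ∀ z, gen Q ∣ z → ∃ r ∈ maximalIdeal R, algebraMap R S r = z) := by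
  have hS := h.not_isField
  have hp := gen_prime hS Q
  have hunit : ∀ {x : S}, val Q x = 0 → IsUnit x := fun hx =>
    isUnit_of_val fun Q' => by rw [hQ Q']; exact hx
  obtain ⟨m, hm, hm0, hmm⟩ := h.stable _ h.ne_bot
  obtain ⟨c, hc0, hc⟩ := h.exists_conductor
  obtain ⟨b, hb0, hbc, hfac⟩ := h.exists_unit_factors hQ hc0 hc
  have hφm := h.map_ne_zero hm0
  obtain ⟨D, hDm, hDf, hDv⟩ := h.exists_valData (fun _ : Unit => Q)
    (fun Q' => ⟨(), (hQ Q').symm⟩) hm hm0 hmm hc0 hc (val Q c) fun Q' => by rw [hQ Q']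
  have hφ : ∀ a : R⁰, algebraMap R S a ≠ 0 := fun a => h.map_ne_zero (ne_zero_coe a)
  have hvm : 1 ≤ val Q (algebraMap R S m) := (one_le_val_iff _).2
      (mem_iff_gen_dvd.1 (h.mem_of_mem_maximalIdeal _ hm))
  have hdvd : ∀ {x y : S}, x ≠ 0 → y ≠ 0 → val Q x ≤ val Q y → x ∣ y := fun hx hy hxy =>
    dvd_of_val_le hS hx hy fun Q' => by rw [hQ Q']; exact hxy
  have hirr : ∀ η, (∀ r ∈ maximalIdeal R, algebraMap R S r ≠ b * η) →
      ∃ X : R⁰, Irreducible X ∧ algebraMap R S X = algebraMap R S m * (b * η) := by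
    intro η hη
    refine h.exists_irreducible hm0 hmm hc ?_ hη
    have hη0 : η ≠ 0 := by
      rintro rfl
      exact hη 0 (zero_mem _) (by simp)
    rw [← mul_assoc]
    refine Dvd.dvd.mul_right (hdvd hc0 (mul_ne_zero hφm hb0) ?_) _
    rw [val_mul hS _ hφm hb0]
    omega
  have hunit_of : ∀ {η ξ ε : S}, IsUnit ε → η * ξ = ε → IsUnit η := fun hε e =>
    isUnit_of_mul_isUnit_left (e ▸ hε)
  obtain ⟨η, ξ, e1, hη, -⟩ := hfac 1 isUnit_one
  obtain ⟨w₀, hw₀, ew₀⟩ := hirr η hη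
  have hηu := hunit_of isUnit_one e1
  have key : ∀ {u : R⁰}, val Q (algebraMap R S m) + val Q c ≤ val Q (algebraMap R S u) →
      ∃ r ∈ maximalIdeal R, (u : R) = m * r := by
    intro u hu
    obtain ⟨t, ht⟩ := hdvd (mul_ne_zero hφm hc0) (hφ u) (by rwa [val_mul hS _ hφm hc0])
    obtain ⟨r, hr, er⟩ := (hc c).1 dvd_rfl t
    exact ⟨r, hr, h.injective (by rw [ht, map_mul, er, mul_assoc])⟩
  let D' : NonsplitData R⁰ := { D with
    s := val Q (algebraMap R S m) + val Q b
    w₀ := w₀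
    irr_w₀ := hw₀
    v_w₀ := by
      rw [hDv, ew₀, val_mul hS _ hφm (mul_ne_zero hb0 hηu.ne_zero),
        val_mul hS _ hb0 hηu.ne_zero, val_isUnit hS _ hηu, add_zero]
    le_s := fun u hu => by
      by_contra! hlt
      rw [hDv] at hlt
      obtain ⟨r, hr, er⟩ := key (u := u) (by omega)
      have hr0 : r ≠ 0 := by
        rintro rfl
        rw [mul_zero] at er
        exact ne_zero_coe u er
      have e : u = (⟨m, mem_nonZeroDivisors_of_ne_zero hm0⟩ : R⁰) *
        ⟨r, mem_nonZeroDivisors_of_ne_zero hr0⟩ := Subtype.ext er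
      rcases hu.isUnit_or_isUnit e with h1 | h1
      · exact mem_maximalIdeal_iff_not_isUnit.1 hm h1
      · exact mem_maximalIdeal_iff_not_isUnit.1 hr h1
    flex := fun u w huw => by
      rw [hDv, hDv] at huw
      set e := algebraMap R S m * b * (algebraMap R S m * b) with he
      have hmb := mul_ne_zero hφm hb0
      have he0 : e ≠ 0 := mul_ne_zero hmb hmb
      have hve : val Q (algebraMap R S w * e) = val Q (algebraMap R S u) := by
        rw [huw, val_mul hS _ (hφ w) he0, he, val_mul hS _ hmb hmb, val_mul hS _ hφm hb0]
        ring
      obtain ⟨ε, hε⟩ := hdvd (mul_ne_zero (hφ w) he0) (hφ u) hve.le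
      have hε0 : ε ≠ 0 := by
        rintro rfl
        rw [mul_zero] at hε
        exact hφ u hε
      have hεu : IsUnit ε := by
        refine hunit ?_
        have h2 := congrArg (val Q) hε
        rw [val_mul hS _ (mul_ne_zero (hφ w) he0) hε0, hve] at h2
        omega
      obtain ⟨η, ξ, e2, hη, hξ⟩ := hfac ε hεu
      obtain ⟨X, hX, eX⟩ := hirr η hη
      obtain ⟨Y, hY, eY⟩ := hirr ξ hξ
      refine ⟨X, Y, hX, hY, Subtype.ext (h.injective ?_)⟩
      change algebraMap R S u = algebraMap R S (w * (X * Y))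
      rw [hε, map_mul, map_mul, eX, eY, he, ← e2]
      ring }
  have hr : D'.r = val Q (algebraMap R S m) := by
    change D.v () D.m = _
    rw [hDv, hDm]
  have hs : D'.s = val Q (algebraMap R S m) + val Q b := rfl
  refine ⟨D', fun hsurj => ?_, fun hrs z hz => ?_⟩
  · obtain ⟨r, er⟩ := hsurj (gen Q)
    have hrM : r ∈ maximalIdeal R := by
      rw [mem_maximalIdeal]
      intro hu
      exact hp.not_isUnit (er ▸ hu.map (algebraMap R S))
    have hcp : c ∣ gen Q := by
      rw [hc]
      intro s
      obtain ⟨r', rfl⟩ := hsurj s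
      exact ⟨r * r', Ideal.mul_mem_right _ _ hrM, by rw [map_mul, er]⟩
    obtain ⟨k, hk⟩ := hcp
    have hk0 : k ≠ 0 := by
      rintro rfl
      exact hp.ne_zero (by rw [hk, mul_zero])
    have h1 := congrArg (val Q) hk
    rw [val_mul hS _ hc0 hk0, val_gen_self] at h1
    omega
  · have hcz : c ∣ z := by
      refine Dvd.dvd.trans (hdvd hc0 hp.ne_zero ?_) hz
      rw [val_gen_self]
      omega
    obtain ⟨r, hr, e⟩ := (hc z).1 hcz 1
    exact ⟨r, hr, by rw [e, mul_one]⟩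

/-- If `S` is local and its maximal ideal lies in `R`, then `R` has half-factorial ideal arithmetic: the
additive function sends an ideal `I` to the value of `I S`. It is one on atoms, since every ideal of
value at least two is divisible by `m`. -/
theorem twoConnected_nonzeroIdeals {Q : MaximalSpectrum S} (hQ : ∀ Q', Q' = Q)
    (hp : ∀ z, gen Q ∣ z → ∃ r ∈ maximalIdeal R, algebraMap R S r = z) :
    TwoConnected (nonzeroIdeals R) := by
  have hS := h.not_isField
  have hpp := gen_prime hS Q
  obtain ⟨m, hm, hm0, hmm⟩ := h.stable _ h.ne_bot
  obtain ⟨r₀, hr₀, er₀⟩ := hp _ dvd_rfl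
  have hmp : algebraMap R S m ∣ gen Q := er₀ ▸ h.map_dvd_map hm0 hmm hr₀
  have hM : ∀ {I : nonzeroIdeals R}, ¬ IsUnit I → (I : Ideal R) ≤ maximalIdeal R := by
    intro I hI
    refine le_maximalIdeal fun htop => hI ?_
    have : I = 1 := Subtype.ext (htop.trans Ideal.one_eq_top.symm)
    rw [this]
    exact isUnit_one
  have hunit : ∀ {I : nonzeroIdeals R}, (I : Ideal R) ≤ maximalIdeal R → ¬ IsUnit I := by
    intro I hI hu
    have h1 : IsUnit (I : Ideal R) := hu.map (Submonoid.subtype _)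
    rw [Ideal.isUnit_iff] at h1
    rw [h1] at hI
    exact (maximalIdeal.isMaximal R).ne_top (top_le_iff.1 hI)
  -- an ideal contained in `m M` is divisible by `m`
  have hdiv : ∀ I : nonzeroIdeals R, (∀ x ∈ (I : Ideal R), ∃ w ∈ maximalIdeal R, x = m * w) →
      ∃ J : nonzeroIdeals R, ¬ IsUnit J ∧ (I : Ideal R) = Ideal.span {m} * J := by
    intro I hI
    let J : Ideal R := Submodule.comap (LinearMap.mulLeft R m) (I : Ideal R)
    have hJ : ∀ x, x ∈ J ↔ m * x ∈ (I : Ideal R) := fun x => Iff.rfl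
    have e : (I : Ideal R) = Ideal.span {m} * J := by
      ext x
      rw [Ideal.mem_span_singleton_mul]
      constructor
      · intro hx
        obtain ⟨w, -, rfl⟩ := hI x hx
        exact ⟨w, (hJ w).2 hx, rfl⟩
      · rintro ⟨w, hw, rfl⟩
        exact (hJ w).1 hw
    have hJ0 : J ≠ ⊥ := by
      intro h0
      rw [h0, Ideal.mul_bot] at e
      exact I.2 e
    refine ⟨⟨J, hJ0⟩, hunit fun x hx => ?_, e⟩
    obtain ⟨w, hw, ew⟩ := hI _ ((hJ x).1 hx)
    rwa [mul_left_cancel₀ hm0 ew]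
  let l : nonzeroIdeals R → ℕ := fun I =>
    val Q (Submodule.IsPrincipal.generator ((I : Ideal R).map (algebraMap R S)))
  have hspan : ∀ I : Ideal S, Ideal.span {Submodule.IsPrincipal.generator I} = I := fun I =>
    Submodule.IsPrincipal.span_singleton_generator I
  have hg0 : ∀ I : nonzeroIdeals R,
      Submodule.IsPrincipal.generator ((I : Ideal R).map (algebraMap R S)) ≠ 0 := by
    intro I h0
    have h1 := hspan ((I : Ideal R).map (algebraMap R S))
    rw [h0, Ideal.span_singleton_eq_bot.2 rfl, eq_comm,
      Ideal.map_eq_bot_iff_of_injective h.injective] at h1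
    exact I.2 h1
  have hval_assoc : ∀ {x y : S}, Associated x y → val Q x = val Q y := fun hxy =>
    multiplicity_eq_of_associated_right hxy
  have hl : ∀ (I : nonzeroIdeals R) (x : R), x ∈ (I : Ideal R) → x ≠ 0 →
      l I ≤ val Q (algebraMap R S x) := by
    intro I x hx hx0
    obtain ⟨k, hk⟩ := (Submodule.IsPrincipal.mem_iff_generator_dvd _).1
      (Ideal.mem_map_of_mem (algebraMap R S) hx)
    have hk0 : k ≠ 0 := by
      rintro rfl
      rw [mul_zero] at hk
      exact h.map_ne_zero hx0 hk
    rw [hk, val_mul hS _ (hg0 I) hk0]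
    exact Nat.le_add_right _ _
  refine twoConnected_of_additive (⟨Ideal.span {m}, by simpa [nonzeroIdeals] using hm0⟩) ⟨?_, ?_⟩
    ?_ ?_ l 1 le_rfl ?_ ?_ ?_ ?_
  · exact hunit ((Ideal.span_singleton_le_iff_mem _).2 hm)
  · intro I J e
    by_contra! hIJ
    have e' : Ideal.span {m} = (I : Ideal R) * J := congrArg Subtype.val e
    have h1 : m ∈ (I : Ideal R) * J := e' ▸ Ideal.mem_span_singleton_self m
    have h2 : (I : Ideal R) * J ≤ Ideal.span {m} * maximalIdeal R := by
      refine Ideal.mul_le.2 fun x hx y hy => ?_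
      obtain ⟨w, hw, e⟩ := hmm x (hM hIJ.1 hx) y (hM hIJ.2 hy)
      exact Ideal.mem_span_singleton_mul.2 ⟨w, hw, e.symm⟩
    obtain ⟨w, hw, ew⟩ := Ideal.mem_span_singleton_mul.1 (h2 h1)
    have : w = 1 := mul_left_cancel₀ hm0 (by rw [ew, mul_one])
    rw [this] at hw
    exact (Ideal.ne_top_iff_one _).1 (maximalIdeal.isMaximal R).ne_top hw
  · intro I J e
    exact Subtype.ext (Ideal.span_singleton_mul_right_injective hm0 (congrArg Subtype.val e))
  · intro I J hI hJ
    obtain ⟨K, hK, e⟩ := hdiv (I * J) fun x hx => by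
      have h2 : (I : Ideal R) * J ≤ Ideal.span {m} * maximalIdeal R := by
        refine Ideal.mul_le.2 fun x hx y hy => ?_
        obtain ⟨w, hw, e⟩ := hmm x (hM hI hx) y (hM hJ hy)
        exact Ideal.mem_span_singleton_mul.2 ⟨w, hw, e.symm⟩
      obtain ⟨w, hw, e⟩ := Ideal.mem_span_singleton_mul.1 (h2 hx)
      exact ⟨w, hw, e.symm⟩
    exact ⟨K, hK, Subtype.ext e⟩
  · have h1 : IsUnit (Submodule.IsPrincipal.generator
        (((1 : nonzeroIdeals R) : Ideal R).map (algebraMap R S))) := by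
      rw [← Ideal.span_singleton_eq_top, hspan]
      simp [Ideal.one_eq_top, Ideal.map_top]
    exact val_isUnit hS Q h1
  · intro I J
    change val Q _ = val Q _ + val Q _
    rw [← val_mul hS Q (hg0 I) (hg0 J)]
    refine hval_assoc ?_
    rw [← Ideal.span_singleton_eq_span_singleton, ← Ideal.span_singleton_mul_span_singleton,
      hspan, hspan, hspan, ← Ideal.map_mul]
    rfl
  · intro I hI
    refine (one_le_val_iff _).2 (mem_iff_gen_dvd.1 ?_)
    have h1 : (I : Ideal R).map (algebraMap R S) ≤ Q.asIdeal :=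
      Ideal.map_le_iff_le_comap.2 fun x hx => h.mem_of_mem_maximalIdeal Q (hM hI hx)
    exact h1 (Submodule.IsPrincipal.generator_mem _)
  · intro I hI
    have h1 : 1 ≤ l I := by
      refine (one_le_val_iff _).2 (mem_iff_gen_dvd.1 ?_)
      have h1 : (I : Ideal R).map (algebraMap R S) ≤ Q.asIdeal := Ideal.map_le_iff_le_comap.2
        fun x hx => h.mem_of_mem_maximalIdeal Q (hM hI.not_isUnit hx)
      exact h1 (Submodule.IsPrincipal.generator_mem _)
    by_contra hne
    obtain ⟨J, hJ, e⟩ := hdiv I fun x hx => by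
      by_cases hx0 : x = 0
      · exact ⟨0, zero_mem _, by rw [hx0, mul_zero]⟩
      have h2 := hl I x hx hx0
      obtain ⟨z, hz⟩ : gen Q * gen Q ∣ algebraMap R S x := by
        refine dvd_of_val_le hS (mul_ne_zero hpp.ne_zero hpp.ne_zero) (h.map_ne_zero hx0)
          fun Q' => ?_
        rw [hQ Q', val_mul hS _ hpp.ne_zero hpp.ne_zero, val_gen_self]
        omega
      obtain ⟨k, hk⟩ := hmp
      obtain ⟨w, hw, ew⟩ := hp (gen Q * (k * z)) (dvd_mul_right _ _)
      refine ⟨w, hw, h.injective ?_⟩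
      rw [hz, map_mul, ew]
      linear_combination gen Q * z * hk
    have e' : I = (⟨Ideal.span {m}, by simpa [nonzeroIdeals] using hm0⟩ : nonzeroIdeals R) * J :=
      Subtype.ext e
    rcases hI.isUnit_or_isUnit e' with h2 | h2
    · exact hunit ((Ideal.span_singleton_le_iff_mem _).2 hm) h2
    · exact hJ h2

end IsStableLocalOrder

end OrderIdeals

/-! ### Orders in Dedekind domains -/

namespace OrderIdeals

open MonoidArith IsLocalRing

theorem isNoetherian_of_isTorsionBySet {R M : Type*} [CommRing R] [AddCommGroup M] [Module R M]
    [Module.Finite R M] (P : Ideal R) [hP : P.IsMaximal] (hM : Module.IsTorsionBySet R M P) :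
    IsNoetherian R M := by
  let := Ideal.Quotient.field P
  let := hM.module
  have : IsSemisimpleModule R M := hM.isSemisimpleModule_iff.1 inferInstance
  exact ((IsSemisimpleModule.finite_tfae (R := R) (M := M)).out 0 1).1 ‹Module.Finite R M›

namespace IsOrderIn

variable {R : Type*} [CommRing R] [IsDomain R] {S : Type*} [CommRing S] [IsDedekindDomain S]
  [Algebra R S] (h : IsOrderIn R S)

include h

theorem isIntegral : Algebra.IsIntegral R S := by
  have := h.finite
  exact Algebra.IsIntegral.of_finite R S

theorem map_ne_zero {x : R} (hx : x ≠ 0) : algebraMap R S x ≠ 0 :=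
  (map_ne_zero_iff _ h.injective).2 hx

/-- The conductor of `R` in `S` is non-zero: `d` is a common denominator of generators of `S`. -/
theorem exists_conductor :
    ∃ d : R, d ≠ 0 ∧ ∀ s : S, ∃ r : R, algebraMap R S r = algebraMap R S d * s := by
  obtain ⟨G, hG⟩ := h.finite.fg_top
  choose a b hb e using h.isFraction
  refine ⟨∏ x ∈ G, b x, Finset.prod_ne_zero_iff.2 fun x _ => hb x, fun s => ?_⟩
  have hs : s ∈ Submodule.span R (G : Set S) := hG ▸ Submodule.mem_top
  induction hs using Submodule.span_induction with
  | mem x hx =>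
    obtain ⟨t, ht⟩ := Finset.dvd_prod_of_mem b (Finset.mem_coe.1 hx)
    refine ⟨a x * t, ?_⟩
    rw [ht, map_mul, map_mul, ← e]
    ring
  | zero => exact ⟨0, by simp⟩
  | add x y _ _ hx hy =>
    obtain ⟨r, hr⟩ := hx
    obtain ⟨r', hr'⟩ := hy
    exact ⟨r + r', by rw [map_add, hr, hr']; ring⟩
  | smul t x _ hx =>
    obtain ⟨r, hr⟩ := hx
    exact ⟨t * r, by rw [map_mul, hr, Algebra.smul_def]; ring⟩

theorem fg_restrictScalars (𝔞 : Ideal S) : (𝔞.restrictScalars R).FG := by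
  have := h.finite
  have h1 : Module.Finite S 𝔞 := Module.Finite.of_fg (IsNoetherian.noetherian 𝔞)
  have h2 : Module.Finite R 𝔞 := Module.Finite.trans S 𝔞
  exact Module.Finite.iff_fg.1 h2

/-- The module `S / 𝔞` is noetherian over `R` for a non-zero ideal `𝔞`: its composition factors over
`S` are finite-dimensional over residue fields of `R`. -/
theorem fg_of_le (𝔞 : Ideal S) (h0 : 𝔞 ≠ ⊥) (N : Submodule R S) (hN : 𝔞.restrictScalars R ≤ N) :
    N.FG := by
  induction 𝔞 using UniqueFactorizationMonoid.induction_on_prime generalizing N with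
  | h₁ => exact absurd rfl h0
  | h₂ 𝔞 hu =>
    have h1 : N = (⊤ : Ideal S).restrictScalars R := by
      rw [Ideal.isUnit_iff.1 hu] at hN
      exact top_le_iff.1 hN
    rw [h1]
    exact h.fg_restrictScalars ⊤
  | h₃ 𝔟 Q h𝔟 hQ ih =>
    have hQm : Q.IsMaximal := (Ideal.isPrime_of_prime hQ).isMaximal hQ.ne_zero
    have hint := h.isIntegral
    have hPm : (Q.comap (algebraMap R S)).IsMaximal :=
      Ideal.isMaximal_comap_of_isIntegral_of_isMaximal Q
    set B := 𝔟.restrictScalars R with hB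
    set C := (Q * 𝔟).restrictScalars R with hC
    have hCB : C ≤ B := fun x hx => (Ideal.mul_le_right : Q * 𝔟 ≤ 𝔟) hx
    refine Submodule.fg_of_fg_map_of_fg_inf_ker B.mkQ ?_ ?_
    · have h1 : N.map B.mkQ = (N ⊔ B).map B.mkQ := by
        rw [Submodule.map_sup, Submodule.mkQ_map_self, sup_bot_eq]
      rw [h1]
      exact (ih h𝔟 _ le_sup_right).map _
    · rw [Submodule.ker_mkQ]
      refine Submodule.fg_of_fg_map_of_fg_inf_ker C.mkQ ?_ ?_
      · have hfin : Module.Finite R (B.map C.mkQ) :=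
          Module.Finite.of_fg ((h.fg_restrictScalars 𝔟).map _)
        have hno : IsNoetherian R (B.map C.mkQ) := by
          refine isNoetherian_of_isTorsionBySet (Q.comap (algebraMap R S)) ?_
          rintro ⟨_, x, hx, rfl⟩ ⟨r, hr⟩
          refine Subtype.ext ?_
          change r • C.mkQ x = 0
          rw [← map_smul, Submodule.mkQ_apply, Submodule.Quotient.mk_eq_zero, Algebra.smul_def]
          exact Ideal.mul_mem_mul hr hx
        exact isNoetherian_submodule.1 hno _ (Submodule.map_mono inf_le_right)
      · rw [Submodule.ker_mkQ]
        have h2 : N ⊓ B ⊓ C = C := inf_eq_right.2 (le_inf hN hCB)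
        rw [h2]
        exact h.fg_restrictScalars _

/-- An ideal of `R` that contains `a ≠ 0` contains the ideal `a d S` of `S`, for `d` in the conductor, and
`S` is a noetherian `R`-module modulo this ideal. -/
theorem isNoetherianRing : IsNoetherianRing R := by
  obtain ⟨d, hd, hdS⟩ := h.exists_conductor
  refine isNoetherianRing_iff_ideal_fg R |>.2 fun I => ?_
  by_cases hI : I = ⊥
  · rw [hI]; exact Submodule.fg_bot
  obtain ⟨a, ha, ha0⟩ := Submodule.exists_mem_ne_zero_of_ne_bot hI
  have h1 : (Submodule.map (Algebra.linearMap R S) I).FG := by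
    refine h.fg_of_le (Ideal.span {algebraMap R S (a * d)}) ?_ _ ?_
    · rw [Ne, Ideal.span_singleton_eq_bot]
      exact h.map_ne_zero (mul_ne_zero ha0 hd)
    · intro x hx
      obtain ⟨s, rfl⟩ := Ideal.mem_span_singleton'.1 hx
      obtain ⟨r, hr⟩ := hdS s
      refine ⟨a * r, I.mul_mem_right _ ha, ?_⟩
      rw [Algebra.linearMap_apply, map_mul, hr, map_mul]
      ring
  exact Submodule.fg_of_fg_map_injective (Algebra.linearMap R S) h.injective h1

theorem dimensionLEOne : Ring.DimensionLEOne R := by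
  refine ⟨fun {P} h0 hP => ?_⟩
  have hint := h.isIntegral
  obtain ⟨Q, -, hQ, hQP⟩ := Ideal.exists_ideal_over_prime_of_isIntegral (S := S) P ⊥ (by
    rw [← RingHom.ker_eq_comap_bot, (RingHom.injective_iff_ker_eq_bot _).1 h.injective]
    exact bot_le)
  have hQ0 : Q ≠ ⊥ := by
    rintro rfl
    rw [← RingHom.ker_eq_comap_bot, (RingHom.injective_iff_ker_eq_bot _).1 h.injective] at hQP
    exact h0 hQP.symm
  have := hQ.isMaximal hQ0
  rw [← hQP]
  exact Ideal.isMaximal_comap_of_isIntegral_of_isMaximal Q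

end IsOrderIn

/-! ### Monoids of ideals -/

section IdealMonoids

variable {R : Type*} [CommRing R]

theorem finite_isMaximal_of_le [IsNoetherianRing R] [IsDomain R] [Ring.DimensionLEOne R]
    {I : Ideal R} (hI : I ≠ ⊥) : {P : Ideal R | P.IsMaximal ∧ I ≤ P}.Finite := by
  refine (Ideal.finite_minimalPrimes_of_isNoetherianRing R I).subset ?_
  rintro P ⟨hP, hIP⟩
  refine ⟨⟨hP.isPrime, hIP⟩, fun Q ⟨hQ, hIQ⟩ hQP => ?_⟩
  have hQ0 : Q ≠ ⊥ := fun h => hI (le_bot_iff.1 (h ▸ hIQ))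
  exact ((hQ.isMaximal hQ0).eq_of_le hP.ne_top hQP).ge

/-- Nakayama's lemma for the faithful module `I`. -/
theorem eq_top_of_eq_mul_self [IsDomain R] [IsNoetherianRing R] {I J : Ideal R} (hI : I ≠ ⊥)
    (h : I = I * J) : J = ⊤ := by
  obtain ⟨r, hr, hr0⟩ := Submodule.exists_sub_one_mem_and_smul_eq_zero_of_fg_of_le_smul J I
    (IsNoetherian.noetherian I) (by rw [smul_eq_mul, mul_comm, ← h])
  obtain ⟨x, hx, hx0⟩ := Submodule.exists_mem_ne_zero_of_ne_bot hI
  have h1 : r = 0 := by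
    have := hr0 x hx
    rw [smul_eq_mul] at this
    exact (mul_eq_zero.1 this).resolve_right hx0
  rw [h1, zero_sub, neg_mem_iff] at hr
  exact (Ideal.eq_top_iff_one _).2 hr

variable (H : Submonoid (Ideal R))

instance subsingleton_units_of_ideals : Subsingleton Hˣ := by
  refine ⟨fun u v => ?_⟩
  have h1 : ∀ u : Hˣ, u = 1 := fun u => Units.ext (Subtype.ext (by
    have h2 : IsUnit ((u : H) : Ideal R) := u.isUnit.map H.subtype
    rw [Ideal.isUnit_iff] at h2
    exact h2.trans Ideal.one_eq_top.symm))
  rw [h1 u, h1 v]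

variable {H} [IsDomain R] [IsNoetherianRing R]

theorem isUnitCancellative_of_ideals (hH : ∀ I ∈ H, I ≠ ⊥) : IsUnitCancellative H := by
  intro I J e
  have h1 : J = 1 :=
    Subtype.ext ((eq_top_of_eq_mul_self (hH _ I.2) (congrArg Subtype.val e)).trans
      Ideal.one_eq_top.symm)
  rw [h1]
  exact isUnit_one

theorem isAtomicMonoid_of_ideals (hH : ∀ I ∈ H, I ≠ ⊥) : IsAtomicMonoid H := by
  have key : ∀ (I : Ideal R) (hI : I ∈ H), ¬ IsUnit (⟨I, hI⟩ : H) →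
      ∃ s : Multiset H, (∀ u ∈ s, Irreducible u) ∧ s.prod = ⟨I, hI⟩ := by
    intro I
    induction I using IsNoetherian.induction with
    | hgt I ih =>
      intro hI hu
      by_cases hirr : Irreducible (⟨I, hI⟩ : H)
      · exact ⟨{⟨I, hI⟩}, by simpa using hirr, by simp⟩
      rw [irreducible_iff] at hirr
      push Not at hirr
      obtain ⟨A, B, e, hA, hB⟩ := hirr hu
      have hlt : ∀ A B : H, (⟨I, hI⟩ : H) = A * B → ¬ IsUnit B → I < A := by
        intro A B e hB
        have e' : I = (A : Ideal R) * B := congrArg Subtype.val e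
        refine lt_of_le_of_ne (e' ▸ Ideal.mul_le_left) fun hIA => hB ?_
        refine isUnitCancellative_of_ideals hH A B (Subtype.ext ?_)
        rw [← hIA, e']
        rfl
      obtain ⟨s, hs, es⟩ := ih A (hlt A B e hB) A.2 hA
      obtain ⟨t, ht, et⟩ := ih B (hlt B A (by rw [e, mul_comm]) hA) B.2 hB
      refine ⟨s + t, fun u hu => ?_, by rw [Multiset.prod_add, es, et, e]⟩
      rcases Multiset.mem_add.1 hu with hu | hu
      exacts [hs u hu, ht u hu]
  exact fun a ha => key a a.2 ha

omit [IsNoetherianRing R] in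
/-- Invertible ideals are the divisors of non-zero principal ideals. -/
theorem mem_invertibleIdeals_iff {I : Ideal R} :
    I ∈ invertibleIdeals R ↔ ∃ (J : Ideal R) (a : R), a ≠ 0 ∧ I * J = Ideal.span {a} := by
  change IsUnit (I : FractionalIdeal R⁰ (FractionRing R)) ↔ _
  constructor
  · intro hI
    obtain ⟨N, hN⟩ := hI.exists_right_inv
    obtain ⟨a, J, ha, e⟩ := FractionalIdeal.exists_eq_spanSingleton_mul N
    refine ⟨J, a, ha, ?_⟩
    have ha' : algebraMap R (FractionRing R) a ≠ 0 :=
      (map_ne_zero_iff _ (IsFractionRing.injective R (FractionRing R))).2 ha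
    rw [← FractionalIdeal.coeIdeal_inj (K := FractionRing R), FractionalIdeal.coeIdeal_mul,
      FractionalIdeal.coeIdeal_span_singleton]
    have h1 : (J : FractionalIdeal R⁰ (FractionRing R)) =
        FractionalIdeal.spanSingleton R⁰ (algebraMap R (FractionRing R) a) * N := by
      rw [e, ← mul_assoc, FractionalIdeal.spanSingleton_mul_spanSingleton, mul_inv_cancel₀ ha',
        FractionalIdeal.spanSingleton_one, one_mul]
    rw [h1, mul_left_comm, hN, mul_one]
  · rintro ⟨J, a, ha, e⟩
    have ha' : algebraMap R (FractionRing R) a ≠ 0 :=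
      (map_ne_zero_iff _ (IsFractionRing.injective R (FractionRing R))).2 ha
    refine IsUnit.of_mul_eq_one (J * FractionalIdeal.spanSingleton R⁰
      (algebraMap R (FractionRing R) a)⁻¹) ?_
    rw [← mul_assoc, ← FractionalIdeal.coeIdeal_mul, e, FractionalIdeal.coeIdeal_span_singleton,
      FractionalIdeal.spanSingleton_mul_spanSingleton, mul_inv_cancel₀ ha',
      FractionalIdeal.spanSingleton_one]

omit [IsNoetherianRing R] in
theorem ne_bot_of_mem_invertibleIdeals {I : Ideal R} (hI : I ∈ invertibleIdeals R) : I ≠ ⊥ := by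
  obtain ⟨J, a, ha, e⟩ := mem_invertibleIdeals_iff.1 hI
  rintro rfl
  rw [Ideal.bot_mul, eq_comm, Ideal.span_singleton_eq_bot] at e
  exact ha e

omit [IsNoetherianRing R] in
theorem mem_invertibleIdeals_of_dvd {I J : Ideal R} (hJ : J ∈ invertibleIdeals R) (h : I ∣ J) :
    I ∈ invertibleIdeals R := by
  obtain ⟨K, rfl⟩ := h
  exact isUnit_of_mul_isUnit_left (x := (I : FractionalIdeal R⁰ (FractionRing R)))
    (y := (K : FractionalIdeal R⁰ (FractionRing R)))
    (by rw [← FractionalIdeal.coeIdeal_mul]; exact hJ)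

omit [IsNoetherianRing R] in
theorem mul_left_cancel_of_mem_invertibleIdeals {I J K : Ideal R} (hI : I ∈ invertibleIdeals R)
    (h : I * J = I * K) : J = K := by
  have h1 : IsUnit (I : FractionalIdeal R⁰ (FractionRing R)) := hI
  rw [← FractionalIdeal.coeIdeal_inj (K := FractionRing R)]
  refine h1.mul_left_cancel ?_
  rw [← FractionalIdeal.coeIdeal_mul, ← FractionalIdeal.coeIdeal_mul, h]

omit [IsNoetherianRing R] in
theorem span_singleton_mem_invertibleIdeals {a : R} (ha : a ≠ 0) :
    Ideal.span {a} ∈ invertibleIdeals R :=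
  mem_invertibleIdeals_iff.2 ⟨⊤, a, ha, Ideal.mul_top _⟩

end IdealMonoids

end OrderIdeals

/-! ### Localization of stable domains -/

namespace OrderIdeals

open MonoidArith IsLocalRing

/-- Locally at a maximal ideal `P`, a non-zero ideal `I` of a stable noetherian domain is a principal
ideal of the overring `T = (I : I)`. Since `I` is invertible over `T`, and only finitely many maximal
ideals of `T` lie over `P`, there is `a ∈ I` such that the ideal `a I⁻¹` of `T` lies in none of
them; hence it contains an element `s` of `R` outside of `P`, and `s I ⊆ a T`. -/
theorem exists_stable_generator {R : Type*} [CommRing R] [IsDomain R] [IsNoetherianRing R]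
    (hR : IsStableDomain R) {I : Ideal R} (hI : I ≠ ⊥) (P : Ideal R) [hP : P.IsMaximal] :
    ∃ a ∈ I, a ≠ 0 ∧ ∃ s, s ∉ P ∧ ∀ x ∈ I, ∀ y ∈ I, ∃ w ∈ I, s * (x * y) = a * w := by
  classical
  set K := FractionRing R
  set M : Submodule R K := IsLocalization.coeSubmodule K I with hM
  have hst : M * ((M / M) / M) = M / M := hR I hI
  have hinj := IsFractionRing.injective R K
  have hMmem : ∀ x, x ∈ M ↔ ∃ y ∈ I, algebraMap R K y = x := fun x => Iff.rfl
  let T : Subalgebra R K :=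
    { carrier := {t | ∀ y ∈ M, t * y ∈ M}
      mul_mem' := fun {a b} ha hb y hy => by rw [mul_assoc]; exact ha _ (hb _ hy)
      add_mem' := fun {a b} ha hb y hy => by rw [add_mul]; exact add_mem (ha _ hy) (hb _ hy)
      algebraMap_mem' := fun r y hy => by
        rw [← Algebra.smul_def]; exact M.smul_mem r hy }
  have hT : ∀ t, t ∈ T ↔ ∀ y ∈ M, t * y ∈ M := fun t => Iff.rfl
  have hT' : ∀ t, t ∈ T ↔ t ∈ M / M := fun t => Iff.rfl
  set N := (M / M) / M with hN
  have hNmem : ∀ n, n ∈ N ↔ ∀ y ∈ M, n * y ∈ T := fun n => Iff.rfl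
  obtain ⟨x₀, hx₀, hx₀0⟩ := Submodule.exists_mem_ne_zero_of_ne_bot hI
  have hfin : Module.Finite R T := by
    have hMfg : M.FG := (IsNoetherian.noetherian I).map _
    have hMno : IsNoetherian R M := isNoetherian_of_fg_of_noetherian _ hMfg
    have hx₀M : algebraMap R K x₀ ∈ M := ⟨x₀, hx₀, rfl⟩
    let f : T →ₗ[R] M :=
      { toFun := fun t => ⟨t * algebraMap R K x₀, t.2 _ hx₀M⟩
        map_add' := fun a b => Subtype.ext (add_mul _ _ _)
        map_smul' := fun r a => Subtype.ext (smul_mul_assoc _ _ _) }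
    refine Module.Finite.of_injective f fun a b hab => Subtype.ext ?_
    exact mul_right_cancel₀ ((map_ne_zero_iff _ hinj).2 hx₀0) (congrArg Subtype.val hab)
  have hint : Algebra.IsIntegral R T := Algebra.IsIntegral.of_finite R T
  have hfinP : (P.primesOver T).Finite := Algebra.QuasiFinite.finite_primesOver P
  have := hfinP.to_subtype
  have hcomap : ∀ Q : P.primesOver T, Q.1.comap (algebraMap R T) = P := fun Q => Q.2.2.over.symm
  have hmax : ∀ Q : P.primesOver T, Q.1.IsMaximal := fun Q => by
    have := Q.2.1
    exact Ideal.isMaximal_of_isIntegral_of_isMaximal_comap _ (hcomap Q ▸ hP)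
  -- as `M * N = T`, for each of the primes `Q` over `P` some product `x * n` is outside of `Q`
  have hex : ∀ Q : P.primesOver T, ∃ x ∈ M, ∃ n ∈ N, ∀ t : T, (t : K) = x * n → t ∉ Q.1 := by
    intro Q
    by_contra! hcon
    have hle : M * N ≤ (Q.1.restrictScalars R).map T.val.toLinearMap := by
      refine Submodule.mul_le.2 fun x hx n hn => ?_
      obtain ⟨t, ht, htQ⟩ := hcon x hx n hn
      exact ⟨t, htQ, ht⟩
    rw [hst] at hle
    obtain ⟨t, ht, e⟩ := hle ((hT' 1).1 T.one_mem)
    have : t = 1 := Subtype.ext e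
    rw [this] at ht
    exact Q.2.1.ne_top ((Ideal.eq_top_iff_one _).2 ht)
  choose x hx n hn hxn using hex
  have hco : Pairwise (Function.onFun IsCoprime fun Q : P.primesOver T => Q.1) := by
    intro A B hAB
    have hA := hmax A
    have hB := hmax B
    exact Ideal.isCoprime_of_isMaximal fun h => hAB (Subtype.ext h)
  have he : ∀ Q : P.primesOver T, ∃ e : T, ∀ Q' : P.primesOver T,
      e - (if Q' = Q then 1 else 0) ∈ Q'.1 := fun Q =>
    Ideal.exists_forall_sub_mem_ideal hco _
  choose e he using he
  have := Fintype.ofFinite (P.primesOver T)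
  set a : K := ∑ Q : P.primesOver T, (e Q : K) * x Q with ha
  have haM : a ∈ M := sum_mem fun Q _ => (e Q).2 _ (hx Q)
  -- the ideal `a N` of `T`
  let A : Ideal T :=
    { carrier := {t | ∃ n ∈ N, (t : K) = a * n}
      zero_mem' := ⟨0, zero_mem _, by simp⟩
      add_mem' := by
        rintro t t' ⟨n, hn, e⟩ ⟨n', hn', e'⟩
        exact ⟨n + n', add_mem hn hn', by rw [mul_add, ← e, ← e']; rfl⟩
      smul_mem' := by
        rintro c t ⟨n, hn, e⟩
        refine ⟨c * n, (hNmem _).2 fun y hy => ?_, ?_⟩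
        · rw [mul_assoc]; exact T.mul_mem c.2 ((hNmem n).1 hn y hy)
        · rw [smul_eq_mul, mul_left_comm, ← e]; rfl }
  have hA : ∀ Q : P.primesOver T, ¬ A ≤ Q.1 := by
    intro Q hle
    have hmem : ∀ Q', x Q' * n Q ∈ T := fun Q' => by
      rw [mul_comm]; exact (hNmem _).1 (hn Q) _ (hx Q')
    let τ : P.primesOver T → T := fun Q' => ⟨x Q' * n Q, hmem Q'⟩
    have h1 : ∑ Q', e Q' * τ Q' ∈ A := by
      refine ⟨n Q, hn Q, ?_⟩
      rw [ha, Finset.sum_mul]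
      simp only [AddSubmonoidClass.coe_finsetSum, MulMemClass.coe_mul, mul_assoc, τ]
    have h2 := hle h1
    rw [← Finset.add_sum_erase _ _ (Finset.mem_univ Q)] at h2
    have h3 : ∑ Q' ∈ Finset.univ.erase Q, e Q' * τ Q' ∈ Q.1 := by
      refine sum_mem fun Q' hQ' => Ideal.mul_mem_right _ _ ?_
      have := he Q' Q
      rwa [if_neg (Finset.ne_of_mem_erase hQ').symm, sub_zero] at this
    have h4 := (Ideal.add_mem_iff_left _ h3).1 h2
    have h5 := he Q Q
    rw [if_pos rfl] at h5
    have h6 : τ Q ∈ Q.1 := by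
      have : τ Q = e Q * τ Q - (e Q - 1) * τ Q := by ring
      rw [this]
      exact sub_mem h4 (Ideal.mul_mem_right _ _ h5)
    exact hxn Q (τ Q) rfl h6
  have hnot : ¬ A.comap (algebraMap R T) ≤ P := by
    intro hle
    obtain ⟨Q, hAQ, hQ, hQP⟩ := Ideal.exists_ideal_over_prime_of_isIntegral P A hle
    exact hA ⟨Q, hQ, ⟨hQP.symm⟩⟩ hAQ
  obtain ⟨s, ⟨ν, hν, es⟩, hsP⟩ := Set.not_subset.1 hnot
  change algebraMap R K s = a * ν at es
  obtain ⟨a₀, ha₀, ea₀⟩ := haM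
  have es' : algebraMap R K s = algebraMap R K a₀ * ν := by rw [es, ← ea₀]; rfl
  refine ⟨a₀, ha₀, ?_, s, hsP, fun y hy z hz => ?_⟩
  · rintro rfl
    rw [map_zero, zero_mul, map_eq_zero_iff _ hinj] at es'
    exact hsP (es' ▸ zero_mem _)
  · have h1 : ν * algebraMap R K y * algebraMap R K z ∈ M :=
      (hNmem ν).1 hν _ ⟨y, hy, rfl⟩ _ ⟨z, hz, rfl⟩
    obtain ⟨w, hw, ew⟩ := h1
    refine ⟨w, hw, hinj ?_⟩
    change algebraMap R K w = _ at ew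
    rw [map_mul, map_mul, map_mul, ew, es']
    ring

section Localization

variable {R : Type*} [CommRing R] [IsDomain R] {S : Type*} [CommRing S] [IsDedekindDomain S]
  [Algebra R S] (P : Ideal R) [hP : P.IsMaximal]
  (Rp Sp : Type*) [CommRing Rp] [CommRing Sp] [Algebra R Rp] [Algebra S Sp] [Algebra R Sp]
  [Algebra Rp Sp] [IsScalarTower R S Sp] [IsScalarTower R Rp Sp]
  [IsLocalization.AtPrime Rp P] [IsLocalization (Algebra.algebraMapSubmonoid S P.primeCompl) Sp]

/-- The localization of a stable order at a non-zero maximal ideal is a stable local order. -/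
theorem IsOrderIn.isStableLocalOrder [IsLocalRing Rp] [IsNoetherianRing R] (h : IsOrderIn R S)
    (hR : IsStableDomain R) (hP0 : P ≠ ⊥) : IsStableLocalOrder Rp Sp := by
  have hinjS : Function.Injective (algebraMap S Sp) := by
    refine IsLocalization.injective Sp (M := Algebra.algebraMapSubmonoid S P.primeCompl) ?_
    exact map_le_nonZeroDivisors_of_injective _ h.injective P.primeCompl_le_nonZeroDivisors
  have hinjR : Function.Injective (algebraMap R Rp) :=
    IsLocalization.injective Rp P.primeCompl_le_nonZeroDivisors
  have hRSp : ∀ r : R, algebraMap Rp Sp (algebraMap R Rp r) = algebraMap S Sp (algebraMap R S r) :=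
    fun r => by
      rw [← IsScalarTower.algebraMap_apply R Rp Sp, ← IsScalarTower.algebraMap_apply R S Sp]
  have hunit : ∀ t : P.primeCompl, IsUnit (algebraMap R Rp t) := fun t =>
    IsLocalization.map_units Rp t
  have hSp : ∀ x : Sp, ∃ (s : S) (t : P.primeCompl),
      x * algebraMap Rp Sp (algebraMap R Rp t) = algebraMap S Sp s := by
    intro x
    obtain ⟨⟨s, ⟨_, t, ht, rfl⟩⟩, e⟩ :=
      IsLocalization.surj (Algebra.algebraMapSubmonoid S P.primeCompl) x
    exact ⟨s, ⟨t, ht⟩, by rw [hRSp]; exact e⟩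
  refine ⟨?_, ⟨fun x => ?_⟩, ?_, ?_, fun J hJ => ?_⟩
  · rw [injective_iff_map_eq_zero]
    intro x hx
    obtain ⟨⟨r, t⟩, e⟩ := IsLocalization.surj P.primeCompl x
    have h1 := congrArg (algebraMap Rp Sp) e
    rw [map_mul, hx, zero_mul, hRSp, eq_comm, map_eq_zero_iff _ hinjS,
      map_eq_zero_iff _ h.injective] at h1
    have h2 : r = 0 := h1
    have h3 : x * algebraMap R Rp t = algebraMap R Rp r := e
    rw [h2, map_zero] at h3
    exact ((hunit t).mul_left_eq_zero).1 h3
  · obtain ⟨s, t, e⟩ := hSp x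
    obtain ⟨y, hy⟩ := (hunit t).exists_right_inv
    have h1 : x = algebraMap S Sp s * algebraMap Rp Sp y := by
      rw [← e, mul_assoc, ← map_mul, hy, map_one, mul_one]
    rw [h1]
    have := h.isIntegral
    refine IsIntegral.mul ?_ isIntegral_algebraMap
    exact ((Algebra.IsIntegral.isIntegral (R := R) s).algebraMap (B := Sp)).tower_top
  · obtain ⟨d, hd, hdS⟩ := h.exists_conductor
    refine ⟨algebraMap R Rp d, (map_ne_zero_iff _ hinjR).2 hd, fun x => ?_⟩
    obtain ⟨s, t, e⟩ := hSp x
    obtain ⟨y, hy⟩ := (hunit t).exists_right_inv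
    obtain ⟨r, hr⟩ := hdS s
    refine ⟨algebraMap R Rp r * y, ?_⟩
    rw [map_mul, hRSp, hr, map_mul, ← e, hRSp d]
    have h2 := congrArg (algebraMap Rp Sp) hy
    rw [map_mul, map_one] at h2
    linear_combination (algebraMap S Sp (algebraMap R S d) * x) * h2
  · intro h0
    obtain ⟨x, hx, hx0⟩ := Submodule.exists_mem_ne_zero_of_ne_bot hP0
    have h1 := (IsLocalization.AtPrime.to_map_mem_maximal_iff Rp P x).2 hx
    rw [h0, Ideal.mem_bot, map_eq_zero_iff _ hinjR] at h1
    exact hx0 h1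
  · have hJ' : J.comap (algebraMap R Rp) ≠ ⊥ := by
      intro h0
      obtain ⟨x, hx, hx0⟩ := Submodule.exists_mem_ne_zero_of_ne_bot hJ
      obtain ⟨⟨r, t⟩, e⟩ := IsLocalization.surj P.primeCompl x
      have h1 : r ∈ J.comap (algebraMap R Rp) := by
        change algebraMap R Rp r ∈ J
        rw [← e]
        exact J.mul_mem_right _ hx
      rw [h0, Ideal.mem_bot] at h1
      simp only [h1, map_zero] at e
      exact hx0 (((hunit t).mul_left_eq_zero).1 e)
    obtain ⟨a, ha, ha0, s, hs, hsI⟩ := exists_stable_generator hR hJ' P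
    refine ⟨algebraMap R Rp a, ha, (map_ne_zero_iff _ hinjR).2 ha0, fun x hx y hy => ?_⟩
    obtain ⟨⟨x', t⟩, e⟩ := IsLocalization.surj P.primeCompl x
    obtain ⟨⟨y', t'⟩, e'⟩ := IsLocalization.surj P.primeCompl y
    simp only at e e'
    obtain ⟨w, hw, ew⟩ := hsI x' (by
      change algebraMap R Rp x' ∈ J
      rw [← e]
      exact J.mul_mem_right _ hx) y' (by
      change algebraMap R Rp y' ∈ J
      rw [← e']
      exact J.mul_mem_right _ hy)
    obtain ⟨v, hv⟩ := (((hunit t).mul (hunit t')).mul (hunit ⟨s, hs⟩)).exists_right_inv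
    refine ⟨algebraMap R Rp w * v, J.mul_mem_right _ hw, ?_⟩
    have h3 := congrArg (algebraMap R Rp) ew
    rw [map_mul, map_mul, map_mul, ← e, ← e'] at h3
    linear_combination v * h3 - (x * y) * hv

end Localization

end OrderIdeals

namespace OrderIdeals

open MonoidArith IsLocalRing

/-- The invertible ideals of a local domain are the non-zero principal ideals. -/
theorem exists_monoidHom_invertibleIdeals (A : Type*) [CommRing A] [IsDomain A] [IsLocalRing A] :
    ∃ g : A⁰ →* invertibleIdeals A, Function.Surjective g ∧
      ∀ a b, g a = g b ↔ Associated a b := by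
  let g : A⁰ →* invertibleIdeals A :=
    { toFun := fun a => ⟨Ideal.span {(a : A)},
        span_singleton_mem_invertibleIdeals (nonZeroDivisors.ne_zero a.2)⟩
      map_one' := Subtype.ext (Ideal.span_singleton_one.trans Ideal.one_eq_top.symm)
      map_mul' := fun a b => Subtype.ext (Ideal.span_singleton_mul_span_singleton _ _).symm }
  refine ⟨g, fun I => ?_, fun a b => ?_⟩
  · have hfin : {J : Ideal A | J.IsMaximal}.Finite :=
      (Set.finite_singleton (maximalIdeal A)).subset fun J hJ => eq_maximalIdeal hJ
    obtain ⟨x, hx⟩ := (Ideal.IsPrincipal.of_finite_maximals_of_isUnit hfin I.2).principal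
    have hx0 : x ≠ 0 := by
      rintro rfl
      refine ne_bot_of_mem_invertibleIdeals I.2 (hx.trans ?_)
      simp
    exact ⟨⟨x, mem_nonZeroDivisors_of_ne_zero hx0⟩, Subtype.ext hx.symm⟩
  · constructor
    · intro e
      have h1 : Ideal.span {(a : A)} = Ideal.span {(b : A)} := congrArg Subtype.val e
      rw [Ideal.span_singleton_eq_span_singleton] at h1
      obtain ⟨u, hu⟩ := h1
      have hu' : IsUnit (⟨(u : A), mem_nonZeroDivisors_of_ne_zero u.ne_zero⟩ : A⁰) :=
        IsStableLocalOrder.isUnit_coe_iff.1 u.isUnit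
      exact ⟨hu'.unit, Subtype.ext hu⟩
    · rintro ⟨u, rfl⟩
      refine Subtype.ext (Ideal.span_singleton_eq_span_singleton.2 ⟨u.map A⁰.subtype, rfl⟩)

theorem comap_injective_of_isLocalization {A B : Type*} [CommRing A] [CommRing B] [Algebra A B]
    (M : Submonoid A) [IsLocalization M B] {Q Q' : Ideal B}
    (h : Q.comap (algebraMap A B) = Q'.comap (algebraMap A B)) : Q = Q' := by
  have h1 : (Q.under A).map (algebraMap A B) = (Q'.under A).map (algebraMap A B) :=
    congrArg (Ideal.map (algebraMap A B)) h
  rwa [IsLocalization.map_under M, IsLocalization.map_under M] at h1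

section Localization

variable {R : Type*} [CommRing R] [IsDomain R] {S : Type*} [CommRing S] [IsDedekindDomain S]
  [Algebra R S] (P : Ideal R) [hP : P.IsMaximal]

section

variable
  (Rp Sp : Type*) [CommRing Rp] [CommRing Sp] [Algebra R Rp] [Algebra S Sp] [Algebra R Sp]
  [Algebra Rp Sp] [IsScalarTower R S Sp] [IsScalarTower R Rp Sp]
  [IsLocalization.AtPrime Rp P] [IsLocalization (Algebra.algebraMapSubmonoid S P.primeCompl) Sp]

/-- The maximal ideals of the localization of `S` at `P` lie over `P`. -/
theorem comap_comap_of_isMaximal [IsLocalRing Rp] [Algebra.IsIntegral Rp Sp] (Q : Ideal Sp)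
    [hQ : Q.IsMaximal] :
    (Q.comap (algebraMap S Sp)).comap (algebraMap R S) = P := by
  have h1 : (Q.comap (algebraMap Rp Sp)) = maximalIdeal Rp :=
    eq_maximalIdeal (Ideal.isMaximal_comap_of_isIntegral_of_isMaximal Q)
  rw [Ideal.comap_comap, ← IsScalarTower.algebraMap_eq R S Sp, IsScalarTower.algebraMap_eq R Rp Sp,
    ← Ideal.comap_comap, h1]
  exact IsLocalization.AtPrime.under_maximalIdeal Rp P

include P in
theorem finite_maximalSpectrum [IsLocalRing Rp] [Algebra.IsIntegral Rp Sp] [Module.Finite R S] :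
    Finite (MaximalSpectrum Sp) := by
  have hfin : (P.primesOver S).Finite := Algebra.QuasiFinite.finite_primesOver P
  have := hfin.to_subtype
  refine Finite.of_injective (fun Q : MaximalSpectrum Sp =>
    (⟨Q.asIdeal.comap (algebraMap S Sp), ?_, ⟨?_⟩⟩ : P.primesOver S)) fun Q Q' h => ?_
  · have := Q.isMaximal.isPrime
    exact Ideal.comap_isPrime _ _
  · have := Q.isMaximal
    exact (comap_comap_of_isMaximal P Rp Sp Q.asIdeal).symm
  · exact MaximalSpectrum.ext (comap_injective_of_isLocalization
      (Algebra.algebraMapSubmonoid S P.primeCompl) (congrArg Subtype.val h))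

end

/-- The two types of localizations of a stable order at a maximal ideal `P`, according to the number
of primes of `S` over `P`. In the second case, `r = s` holds in particular if `P` does not contain
the conductor, as then `R` and `S` have the same localization at `P`. -/
theorem IsOrderIn.splitData_or_nonsplitData.{u, v} {R : Type u} [CommRing R] [IsDomain R]
    {S : Type v} [CommRing S] [IsDedekindDomain S] [Algebra R S] (h : IsOrderIn R S)
    (hR : IsStableDomain R) (P : Ideal R) [hP : P.IsMaximal] (hP0 : P ≠ ⊥) :
    ((∃ Q Q' : Ideal S, Q.IsPrime ∧ Q'.IsPrime ∧ Q ≠ Q' ∧ Q.comap (algebraMap R S) = P ∧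
        Q'.comap (algebraMap R S) = P) ∧
      ∃ κ : Type v, Nonempty (SplitData (invertibleIdeals (Localization.AtPrime P)) κ)) ∨
    ((∀ Q Q' : Ideal S, Q.IsPrime → Q'.IsPrime → Q.comap (algebraMap R S) = P →
        Q'.comap (algebraMap R S) = P → Q = Q') ∧
      ∃ D : NonsplitData (invertibleIdeals (Localization.AtPrime P)),
        (∀ d ∉ P, (∀ s : S, ∃ r : R, algebraMap R S r = algebraMap R S d * s) → D.r = D.s) ∧
        (D.r = D.s → TwoConnected (nonzeroIdeals (Localization.AtPrime P)))) := by
  have hno := h.isNoetherianRing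
  have hfinS := h.finite
  set Rp := Localization.AtPrime P
  set Sp := Localization (Algebra.algebraMapSubmonoid S P.primeCompl)
  let _ : Algebra Rp Sp := localizationAlgebra P.primeCompl S
  have : IsScalarTower R Rp Sp := IsScalarTower.of_algebraMap_eq fun x => by
    rw [IsScalarTower.algebraMap_apply R S Sp]
    exact (IsLocalization.map_eq (T := Algebra.algebraMapSubmonoid S P.primeCompl)
        (Submonoid.le_comap_map _) x).symm
  have hle : Algebra.algebraMapSubmonoid S P.primeCompl ≤ S⁰ :=
    map_le_nonZeroDivisors_of_injective _ h.injective P.primeCompl_le_nonZeroDivisors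
  have hord : IsStableLocalOrder Rp Sp := h.isStableLocalOrder P Rp Sp hR hP0
  have hdom : IsDomain Sp :=
    IsLocalization.isDomain_of_le_nonZeroDivisors (M := Algebra.algebraMapSubmonoid S P.primeCompl)
      Sp hle
  have hded : IsDedekindDomain Sp := IsLocalization.isDedekindDomain S hle Sp
  have hint := hord.integral
  have hfin : Finite (MaximalSpectrum Sp) := finite_maximalSpectrum (S := S) P Rp Sp
  have hpid : IsPrincipalIdealRing Sp := by
    refine IsPrincipalIdealRing.of_finite_maximals ?_
    refine (Set.finite_range fun Q : MaximalSpectrum Sp => Q.asIdeal).subset fun Q hQ => ?_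
    exact ⟨⟨Q, hQ⟩, rfl⟩
  obtain ⟨g, hg, hga⟩ := exists_monoidHom_invertibleIdeals Rp
  by_cases hQ : ∃ Q Q' : MaximalSpectrum Sp, Q ≠ Q'
  · obtain ⟨Q, Q', hne⟩ := hQ
    have := Q.isMaximal
    have := Q'.isMaximal
    left
    refine ⟨⟨Q.asIdeal.comap (algebraMap S Sp), Q'.asIdeal.comap (algebraMap S Sp),
      Ideal.comap_isPrime _ _, Ideal.comap_isPrime _ _, fun e => hne (MaximalSpectrum.ext
        (comap_injective_of_isLocalization (Algebra.algebraMapSubmonoid S P.primeCompl) e)),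
      comap_comap_of_isMaximal P Rp Sp _, comap_comap_of_isMaximal P Rp Sp _⟩,
      MaximalSpectrum Sp, ?_⟩
    obtain ⟨D⟩ := hord.exists_splitData hne
    exact exists_splitData_of_associated D g hg hga
  · push Not at hQ
    right
    obtain ⟨Q, hQm⟩ := Ideal.exists_maximal Sp
    have hQ : ∀ Q', Q' = (⟨Q, hQm⟩ : MaximalSpectrum Sp) := fun Q' => hQ _ _
    constructor
    · have key : ∀ A : Ideal S, A.IsPrime → A.comap (algebraMap R S) = P →
          A = Q.comap (algebraMap S Sp) := by
        intro A hA hAP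
        have hdisj : Disjoint (Algebra.algebraMapSubmonoid S P.primeCompl : Set S) A := by
          rw [Set.disjoint_left]
          rintro _ ⟨t, ht, rfl⟩ htA
          refine ht ?_
          rw [← hAP]
          exact htA
        have h1 := IsLocalization.isPrime_of_isPrime_disjoint
          (Algebra.algebraMapSubmonoid S P.primeCompl) Sp A hA hdisj
        have h2 := IsLocalization.under_map_of_isPrime_disjoint
          (Algebra.algebraMapSubmonoid S P.primeCompl) Sp hA hdisj
        have h3 : A.map (algebraMap S Sp) ≠ ⊥ := by
          intro h0
          have h4 : A = ⊥ := by
            rw [← h2, h0]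
            exact Ideal.comap_bot_of_injective _ (IsLocalization.injective Sp hle)
          rw [h4] at hAP
          refine hP0 (hAP ▸ Ideal.comap_bot_of_injective _ h.injective)
        have h4 := h1.isMaximal h3
        have h5 := congrArg MaximalSpectrum.asIdeal (hQ ⟨_, h4⟩)
        change A.map (algebraMap S Sp) = Q at h5
        rw [← h5]
        exact h2.symm
      intro A A' hA hA' hAP hAP'
      rw [key A hA hAP, key A' hA' hAP']
    · obtain ⟨D, hD1, hD2⟩ := hord.exists_nonsplitData hQ
      obtain ⟨D', hr, hs⟩ := exists_nonsplitData_of_associated D g hg hga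
      refine ⟨D', fun d hd hdS => ?_, fun e => ?_⟩
      · rw [hr, hs]
        refine hD1 fun x => ?_
        obtain ⟨⟨s, ⟨_, t, ht, rfl⟩⟩, e⟩ :=
          IsLocalization.surj (Algebra.algebraMapSubmonoid S P.primeCompl) x
        obtain ⟨r, hr⟩ := hdS s
        have hu : IsUnit (algebraMap R Rp (d * t)) :=
          IsLocalization.map_units Rp (⟨d * t, P.primeCompl.mul_mem hd ht⟩ : P.primeCompl)
        obtain ⟨y, hy⟩ := hu.exists_right_inv
        refine ⟨algebraMap R Rp r * y, ?_⟩
        have h1 : ∀ r : R, algebraMap Rp Sp (algebraMap R Rp r) =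
            algebraMap S Sp (algebraMap R S r) := fun r => by
          rw [← IsScalarTower.algebraMap_apply R Rp Sp, ← IsScalarTower.algebraMap_apply R S Sp]
        have h2 := congrArg (algebraMap Rp Sp) hy
        rw [map_mul, map_one, h1, map_mul, map_mul] at h2
        have e' : x * algebraMap S Sp (algebraMap R S t) = algebraMap S Sp s := e
        rw [map_mul, h1, hr, map_mul, ← e']
        linear_combination x * h2
      · exact hord.twoConnected_nonzeroIdeals hQ (hD2 (by rw [← hr, ← hs, e]))

end Localization

end OrderIdeals

/-! ### Decomposition of ideals into local components -/

namespace OrderIdeals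

open MonoidArith IsLocalRing

/-- The non-zero maximal ideals of `R`. -/
abbrev NonzeroMaximal (R : Type*) [CommRing R] : Type _ := {P : Ideal R // P.IsMaximal ∧ P ≠ ⊥}

instance {R : Type*} [CommRing R] (P : NonzeroMaximal R) : P.1.IsMaximal := P.2.1

section Decomp

variable {R : Type*} [CommRing R] [IsDomain R]

theorem map_eq_top_of_not_le (P : Ideal R) [P.IsPrime] {I : Ideal R} (h : ¬ I ≤ P) :
    I.map (algebraMap R (Localization.AtPrime P)) = ⊤ := by
  obtain ⟨x, hx, hxP⟩ := Set.not_subset.1 h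
  exact Ideal.eq_top_of_isUnit_mem _ (Ideal.mem_map_of_mem _ hx)
    (IsLocalization.map_units (Localization.AtPrime P) (⟨x, hxP⟩ : P.primeCompl))

theorem map_ne_bot (P : Ideal R) [P.IsPrime] {I : Ideal R} (h : I ≠ ⊥) :
    I.map (algebraMap R (Localization.AtPrime P)) ≠ ⊥ := by
  rwa [Ne, Ideal.map_eq_bot_iff_of_injective
    (IsLocalization.injective _ P.primeCompl_le_nonZeroDivisors)]

theorem comap_ne_bot (P : Ideal R) [P.IsPrime] {J : Ideal (Localization.AtPrime P)} (h : J ≠ ⊥) :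
    J.comap (algebraMap R (Localization.AtPrime P)) ≠ ⊥ := by
  intro h0
  have h1 : (J.under R).map (algebraMap R (Localization.AtPrime P)) = J :=
    IsLocalization.map_under P.primeCompl _ J
  rw [← h1] at h
  refine h ?_
  change Ideal.map _ (J.comap (algebraMap R (Localization.AtPrime P))) = ⊥
  rw [h0, Ideal.map_bot]

variable [Ring.DimensionLEOne R]

/-- The ideal of `R` below a non-zero ideal of the localization at `P` contains a power of each element of `P`,
so it is contained in no other maximal ideal. -/
theorem not_comap_le (P Q : Ideal R) [P.IsMaximal] [Q.IsMaximal] (hPQ : P ≠ Q)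
    {J : Ideal (Localization.AtPrime P)} (hJ : J ≠ ⊥) :
    ¬ J.comap (algebraMap R (Localization.AtPrime P)) ≤ Q := by
  intro hle
  have hnot : ¬ P ≤ Q := fun h => hPQ (Ideal.IsMaximal.eq_of_le ‹_› (Ideal.IsMaximal.ne_top ‹_›) h)
  obtain ⟨x, hx, hxQ⟩ := Set.not_subset.1 hnot
  have hdim : Ring.DimensionLEOne (Localization.AtPrime P) :=
    Ring.DimensionLEOne.localization _ P.primeCompl_le_nonZeroDivisors
  have hrad : algebraMap R (Localization.AtPrime P) x ∈ J.radical := by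
    rw [Ideal.radical_eq_sInf, Ideal.mem_sInf]
    rintro A ⟨hJA, hA⟩
    have hA0 : A ≠ ⊥ := fun h0 => hJ (le_bot_iff.1 (h0 ▸ hJA))
    rw [eq_maximalIdeal (hA.isMaximal hA0)]
    exact (IsLocalization.AtPrime.to_map_mem_maximal_iff _ P x).2 hx
  obtain ⟨n, hn⟩ := hrad
  rw [← map_pow] at hn
  exact hxQ (Ideal.IsPrime.mem_of_pow_mem (Ideal.IsMaximal.isPrime ‹_›) n (hle hn))

theorem eq_of_forall_map_eq {I J : Ideal R} (hI : I ≠ ⊥) (hJ : J ≠ ⊥)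
    (h : ∀ P : NonzeroMaximal R, I.map (algebraMap R (Localization.AtPrime P.1)) =
      J.map (algebraMap R (Localization.AtPrime P.1))) : I = J := by
  refine Ideal.eq_of_localization_maximal fun P hP => ?_
  by_cases hP0 : P = ⊥
  · rw [map_eq_top_of_not_le P fun hle => hI (le_bot_iff.1 (hP0 ▸ hle)),
      map_eq_top_of_not_le P fun hle => hJ (le_bot_iff.1 (hP0 ▸ hle))]
  · exact h ⟨P, hP, hP0⟩

theorem map_comap_eq_top (P Q : NonzeroMaximal R) (hPQ : P ≠ Q)
    {J : Ideal (Localization.AtPrime P.1)} (hJ : J ≠ ⊥) :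
    (J.comap (algebraMap R (Localization.AtPrime P.1))).map
      (algebraMap R (Localization.AtPrime Q.1)) = ⊤ :=
  map_eq_top_of_not_le _ (not_comap_le P.1 Q.1 (fun h => hPQ (Subtype.ext h)) hJ)

theorem map_comap_eq_self (P : NonzeroMaximal R) (J : Ideal (Localization.AtPrime P.1)) :
    (J.comap (algebraMap R (Localization.AtPrime P.1))).map
      (algebraMap R (Localization.AtPrime P.1)) = J :=
  IsLocalization.map_under P.1.primeCompl _ J

theorem comap_mul_of_ne_bot (P : NonzeroMaximal R) {I J : Ideal (Localization.AtPrime P.1)}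
    (hI : I ≠ ⊥) (hJ : J ≠ ⊥) :
    (I * J).comap (algebraMap R (Localization.AtPrime P.1)) =
      I.comap (algebraMap R (Localization.AtPrime P.1)) *
        J.comap (algebraMap R (Localization.AtPrime P.1)) := by
  have hIJ : I * J ≠ ⊥ := mul_ne_zero (M₀ := Ideal (Localization.AtPrime P.1)) hI hJ
  refine eq_of_forall_map_eq (comap_ne_bot P.1 hIJ)
    (mul_ne_zero (M₀ := Ideal R) (comap_ne_bot P.1 hI) (comap_ne_bot P.1 hJ)) fun Q => ?_
  rw [Ideal.map_mul]
  by_cases hPQ : P = Q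
  · subst hPQ
    rw [map_comap_eq_self, map_comap_eq_self, map_comap_eq_self]
  · rw [map_comap_eq_top P Q hPQ hI, map_comap_eq_top P Q hPQ hJ, map_comap_eq_top P Q hPQ hIJ,
      Ideal.top_mul]

/-- Monoids of non-zero ideals which are compatible with localization decompose into their
localizations at the non-zero maximal ideals. -/
noncomputable def idealDecomp [IsNoetherianRing R] (H : Submonoid (Ideal R))
    (E : ∀ P : NonzeroMaximal R, Submonoid (Ideal (Localization.AtPrime P.1)))
    (hH : ∀ I ∈ H, I ≠ ⊥) (hE : ∀ P, ∀ J ∈ E P, J ≠ ⊥)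
    (hmap : ∀ P, ∀ I ∈ H, I.map (algebraMap R (Localization.AtPrime P.1)) ∈ E P)
    (hcomap : ∀ P, ∀ J ∈ E P, J.comap (algebraMap R (Localization.AtPrime P.1)) ∈ H) :
    Decomp H (fun P => E P) where
  π P :=
    { toFun := fun I => ⟨_, hmap P I I.2⟩
      map_one' := Subtype.ext (by
        change Ideal.map _ (1 : Ideal R) = 1
        rw [Ideal.one_eq_top, Ideal.map_top]
        exact Ideal.one_eq_top.symm)
      map_mul' := fun I J => Subtype.ext
        (Ideal.map_mul (algebraMap R (Localization.AtPrime P.1)) (I : Ideal R) J) }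
  σ P :=
    { toFun := fun J => ⟨_, hcomap P J J.2⟩
      map_one' := Subtype.ext (by
        change Ideal.comap _ (1 : Ideal (Localization.AtPrime P.1)) = 1
        rw [Ideal.one_eq_top, Ideal.comap_top]
        exact Ideal.one_eq_top.symm)
      map_mul' := fun I J => Subtype.ext
        (comap_mul_of_ne_bot P (hE P _ I.2) (hE P _ J.2)) }
  π_σ P J := Subtype.ext (map_comap_eq_self P _)
  π_σ_ne P Q J hPQ := Subtype.ext
    ((map_comap_eq_top P Q hPQ (hE P J J.2)).trans Ideal.one_eq_top.symm)
  ext I J h := Subtype.ext (eq_of_forall_map_eq (hH I I.2) (hH J J.2) fun P =>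
    congrArg Subtype.val (h P))
  finite I := by
    refine Set.Finite.of_finite_image (f := Subtype.val) ?_ Subtype.val_injective.injOn
    refine (finite_isMaximal_of_le (hH I I.2)).subset ?_
    rintro _ ⟨P, hP, rfl⟩
    refine ⟨P.2.1, ?_⟩
    by_contra hle
    exact hP (Subtype.ext
      ((map_eq_top_of_not_le P.1 hle).trans Ideal.one_eq_top.symm))

variable (R) in
/-- The monoid of non-zero ideals is the coproduct of its localizations. -/
noncomputable def nonzeroIdealsDecomp [IsNoetherianRing R] :
    Decomp (nonzeroIdeals R)
      (fun P : NonzeroMaximal R => nonzeroIdeals (Localization.AtPrime P.1)) :=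
  idealDecomp _ (fun P => nonzeroIdeals (Localization.AtPrime P.1)) (fun _ h => h)
    (fun _ _ h => h) (fun _ _ h => map_ne_bot _ h) (fun _ _ h => comap_ne_bot _ h)

theorem coe_nonzeroIdealsDecomp_π [IsNoetherianRing R] (P : NonzeroMaximal R)
    (I : nonzeroIdeals R) : ((nonzeroIdealsDecomp R).π P I : Ideal (Localization.AtPrime P.1)) =
      (I : Ideal R).map (algebraMap R (Localization.AtPrime P.1)) := rfl

theorem coe_nonzeroIdealsDecomp_σ [IsNoetherianRing R] (P : NonzeroMaximal R)
    (J : nonzeroIdeals (Localization.AtPrime P.1)) : ((nonzeroIdealsDecomp R).σ P J : Ideal R) =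
      (J : Ideal (Localization.AtPrime P.1)).comap (algebraMap R (Localization.AtPrime P.1)) := rfl

variable (R) in
/-- The monoid of invertible ideals is the coproduct of its localizations. -/
noncomputable def invertibleIdealsDecomp [IsNoetherianRing R] :
    Decomp (invertibleIdeals R)
      (fun P : NonzeroMaximal R => invertibleIdeals (Localization.AtPrime P.1)) :=
  idealDecomp _ (fun P => invertibleIdeals (Localization.AtPrime P.1))
    (fun _ h => ne_bot_of_mem_invertibleIdeals h) (fun _ _ h => ne_bot_of_mem_invertibleIdeals h)
    (fun P I h => by
      obtain ⟨J, a, ha, e⟩ := mem_invertibleIdeals_iff.1 h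
      refine mem_invertibleIdeals_iff.2 ⟨J.map (algebraMap R (Localization.AtPrime P.1)),
        algebraMap R _ a, ?_, ?_⟩
      · exact (map_ne_zero_iff _
          (IsLocalization.injective _ P.1.primeCompl_le_nonZeroDivisors)).2 ha
      · rw [← Ideal.map_mul, e, Ideal.map_span, Set.image_singleton])
    (fun P J h => by
      classical
      obtain ⟨J', x, hx, e⟩ := mem_invertibleIdeals_iff.1 h
      obtain ⟨⟨r, t⟩, er⟩ := IsLocalization.surj P.1.primeCompl x
      have hu : IsUnit (algebraMap R (Localization.AtPrime P.1) t) :=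
        IsLocalization.map_units (Localization.AtPrime P.1) t
      have hr : r ≠ 0 := by
        rintro rfl
        have e2 : x * algebraMap R (Localization.AtPrime P.1) t = 0 := by rw [er, map_zero]
        exact hx ((hu.mul_left_eq_zero).1 e2)
      have hJ : J ≠ ⊥ := ne_bot_of_mem_invertibleIdeals h
      have hJ' : J' ≠ ⊥ := by
        rintro rfl
        rw [Ideal.mul_bot, eq_comm, Ideal.span_singleton_eq_bot] at e
        exact hx e
      have hspan : J * J' = (Ideal.span {r}).map (algebraMap R (Localization.AtPrime P.1)) := by
        rw [e, Ideal.map_span, Set.image_singleton, Ideal.span_singleton_eq_span_singleton]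
        exact ⟨hu.unit, er⟩
      let D := nonzeroIdealsDecomp R
      let a : nonzeroIdeals R := ⟨Ideal.span {r}, by simpa [nonzeroIdeals] using hr⟩
      let j : nonzeroIdeals (Localization.AtPrime P.1) := ⟨J, hJ⟩
      let j' : nonzeroIdeals (Localization.AtPrime P.1) := ⟨J', hJ'⟩
      have h1 : D.π P a = j * j' :=
        Subtype.ext ((coe_nonzeroIdealsDecomp_π P a).trans hspan.symm)
      have h2 : D.σ P j ∣ a := by
        rw [D.eq_prod a (insert P (D.finite a).toFinset) fun i hi =>
          Finset.mem_insert_of_mem ((D.finite a).mem_toFinset.2 hi)]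
        refine Dvd.dvd.trans ?_ (Finset.dvd_prod_of_mem _ (Finset.mem_insert_self P _))
        rw [h1, map_mul]
        exact dvd_mul_right _ _
      have h3 : J.comap (algebraMap R (Localization.AtPrime P.1)) ∣ Ideal.span {r} := by
        have h4 := map_dvd (nonzeroIdeals R).subtype h2
        rwa [Submonoid.subtype_apply, Submonoid.subtype_apply, coe_nonzeroIdealsDecomp_σ] at h4
      exact mem_invertibleIdeals_of_dvd (span_singleton_mem_invertibleIdeals hr) h3)

end Decomp

/-! ### Primes of the integral closure -/

section Primes

theorem mem_minimalNonzeroPrimes_iff {A : Type*} [CommRing A] [IsDomain A]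
    [Ring.DimensionLEOne A] {P : Ideal A} : P ∈ minimalNonzeroPrimes A ↔ P.IsPrime ∧ P ≠ ⊥ := by
  refine ⟨fun h => h.1, fun h => ⟨h, fun Q hQ hQP => ?_⟩⟩
  exact ((hQ.1.isMaximal hQ.2).eq_of_le h.1.ne_top hQP).ge

/-- In an integral extension of one-dimensional domains, bijectivity on non-zero primes means that at most
one prime lies over each maximal ideal, as lying over is automatic. -/
theorem bijOn_minimalNonzeroPrimes_iff (A B : Type*) [CommRing A] [IsDomain A] [CommRing B]
    [IsDomain B] [Algebra A B] [Algebra.IsIntegral A B] [Ring.DimensionLEOne A]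
    (hinj : Function.Injective (algebraMap A B)) :
    Set.BijOn (fun P : Ideal B => P.comap (algebraMap A B)) (minimalNonzeroPrimes B)
        (minimalNonzeroPrimes A) ↔
      ∀ P : NonzeroMaximal A, ∀ Q Q' : Ideal B, Q.IsPrime → Q'.IsPrime →
        Q.comap (algebraMap A B) = P.1 → Q'.comap (algebraMap A B) = P.1 → Q = Q' := by
  have hdim : Ring.DimensionLEOne B := Ring.DimensionLEOne.of_isIntegral A B
  have hbot : (⊥ : Ideal B).comap (algebraMap A B) = ⊥ := Ideal.comap_bot_of_injective _ hinj
  have hmaps : ∀ Q : Ideal B, Q.IsPrime → Q ≠ ⊥ →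
      (Q.comap (algebraMap A B)).IsPrime ∧ Q.comap (algebraMap A B) ≠ ⊥ := fun Q hQ hQ0 =>
    ⟨Ideal.comap_isPrime _ _, mt Ideal.eq_bot_of_comap_eq_bot hQ0⟩
  constructor
  · intro h P Q Q' hQ hQ' e e'
    have hne : ∀ Q : Ideal B, Q.comap (algebraMap A B) = P.1 → Q ≠ ⊥ := by
      rintro _ e rfl
      exact P.2.2 (e ▸ hbot)
    exact h.injOn (mem_minimalNonzeroPrimes_iff.2 ⟨hQ, hne Q e⟩)
      (mem_minimalNonzeroPrimes_iff.2 ⟨hQ', hne Q' e'⟩) (e.trans e'.symm)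
  · intro h
    refine ⟨fun Q hQ => ?_, fun Q hQ Q' hQ' e => ?_, fun P hP => ?_⟩
    · rw [mem_minimalNonzeroPrimes_iff] at hQ
      exact mem_minimalNonzeroPrimes_iff.2 (hmaps Q hQ.1 hQ.2)
    · rw [mem_minimalNonzeroPrimes_iff] at hQ hQ'
      have h1 := hmaps Q hQ.1 hQ.2
      exact h ⟨_, h1.1.isMaximal h1.2, h1.2⟩ Q Q' hQ.1 hQ'.1 rfl e.symm
    · rw [mem_minimalNonzeroPrimes_iff] at hP
      have := hP.1
      obtain ⟨Q, -, hQ, e⟩ := Ideal.exists_ideal_over_prime_of_isIntegral (S := B) P ⊥ (by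
        rw [hbot]; exact bot_le)
      refine ⟨Q, mem_minimalNonzeroPrimes_iff.2 ⟨hQ, ?_⟩, e⟩
      rintro rfl
      exact hP.2 (e ▸ hbot)

/-- A Dedekind domain in which `R` is an order is the integral closure of `R`. -/
theorem IsOrderIn.exists_algEquiv {R : Type*} [CommRing R] [IsDomain R] {S : Type*} [CommRing S]
    [IsDedekindDomain S] [Algebra R S] (h : IsOrderIn R S) : Nonempty (S ≃ₐ[R] intClosure R) := by
  have hint := h.isIntegral
  have hf : FaithfulSMul R S := (faithfulSMul_iff_algebraMap_injective R S).2 h.injective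
  have hinj : Function.Injective (algebraMap R (FractionRing S)) := by
    rw [IsScalarTower.algebraMap_eq R S (FractionRing S)]
    exact (IsFractionRing.injective S (FractionRing S)).comp h.injective
  have hf' : FaithfulSMul R (FractionRing S) :=
    (faithfulSMul_iff_algebraMap_injective R _).2 hinj
  have hnum : ∀ s : S, ∃ a b : R, b ≠ 0 ∧ algebraMap S (FractionRing S) s =
      algebraMap R (FractionRing S) a / algebraMap R (FractionRing S) b := by
    intro s
    obtain ⟨a, b, hb, e⟩ := h.isFraction s
    refine ⟨a, b, hb, ?_⟩
    rw [eq_div_iff ((map_ne_zero_iff _ hinj).2 hb), mul_comm,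
      IsScalarTower.algebraMap_apply R S (FractionRing S) b, ← map_mul, e,
      ← IsScalarTower.algebraMap_apply]
  have hfr : IsFractionRing R (FractionRing S) := by
    refine IsFractionRing.of_field R _ fun z => ?_
    obtain ⟨s, t, ht, rfl⟩ := IsFractionRing.div_surjective (A := S) z
    obtain ⟨a, b, hb, e⟩ := hnum s
    obtain ⟨a', b', hb', e'⟩ := hnum t
    exact ⟨a * b', b * a', by rw [e, e', map_mul, map_mul, div_div_div_eq]⟩
  have hcl : IsIntegralClosure S R (FractionRing S) :=
    IsIntegralClosure.of_isIntegrallyClosed S R (FractionRing S)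
  exact ⟨(IsIntegralClosure.equiv R S (FractionRing S)
    (integralClosure R (FractionRing S))).trans
      (AlgEquiv.mapIntegralClosure (FractionRing.algEquiv R (FractionRing S)).symm)⟩

theorem eq_of_comap_eq_of_algEquiv {R A B : Type*} [CommRing R] [CommRing A] [CommRing B]
    [Algebra R A] [Algebra R B] (e : A ≃ₐ[R] B) (P : Ideal R)
    (hA : ∀ Q Q' : Ideal A, Q.IsPrime → Q'.IsPrime →
      Q.comap (algebraMap R A) = P → Q'.comap (algebraMap R A) = P → Q = Q') :
    ∀ Q Q' : Ideal B, Q.IsPrime → Q'.IsPrime →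
      Q.comap (algebraMap R B) = P → Q'.comap (algebraMap R B) = P → Q = Q' := by
  intro Q Q' hQ hQ' h1 h2
  have hc : ∀ Q : Ideal B, (Q.comap (e : A →+* B)).comap (algebraMap R A) =
      Q.comap (algebraMap R B) := by
    intro Q
    ext x
    simp [Ideal.mem_comap]
  have h3 := hA (Q.comap (e : A →+* B)) (Q'.comap (e : A →+* B)) (Ideal.comap_isPrime _ _)
    (Ideal.comap_isPrime _ _) ((hc Q).trans h1) ((hc Q').trans h2)
  exact Ideal.comap_injective_of_surjective (e : A →+* B) e.surjective h3

/-- Bijectivity for the integral closure can be tested on `S`. -/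
theorem IsOrderIn.bijOn_iff {R : Type*} [CommRing R] [IsDomain R] {S : Type*} [CommRing S]
    [IsDedekindDomain S] [Algebra R S] (h : IsOrderIn R S) :
    Set.BijOn (fun P : Ideal (intClosure R) => P.comap (algebraMap R (intClosure R)))
        (minimalNonzeroPrimes (intClosure R)) (minimalNonzeroPrimes R) ↔
      ∀ P : NonzeroMaximal R, ∀ Q Q' : Ideal S, Q.IsPrime → Q'.IsPrime →
        Q.comap (algebraMap R S) = P.1 → Q'.comap (algebraMap R S) = P.1 → Q = Q' := by
  obtain ⟨e⟩ := h.exists_algEquiv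
  have hdim := h.dimensionLEOne
  have hinj : Function.Injective (algebraMap R (intClosure R)) := by
    have h1 : Function.Injective (e ∘ algebraMap R S) := e.injective.comp h.injective
    convert h1 using 1
    ext x
    simp
  rw [bijOn_minimalNonzeroPrimes_iff R (intClosure R) hinj]
  exact ⟨fun H P => eq_of_comap_eq_of_algEquiv e.symm P.1 (H P),
    fun H P => eq_of_comap_eq_of_algEquiv e P.1 (H P)⟩

end Primes

end OrderIdeals

/-! ### Ideal monoids of stable orders -/

namespace OrderIdeals

open MonoidArith IsLocalRing

/-- The inclusion of the invertible ideals into the non-zero ideals. -/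
def invertibleToNonzero (R : Type*) [CommRing R] [IsDomain R] :
    invertibleIdeals R →* nonzeroIdeals R :=
  Submonoid.inclusion fun _ h => ne_bot_of_mem_invertibleIdeals h

/-- Divisors of invertible ideals are invertible, so atoms stay atoms. -/
theorem irreducible_invertibleToNonzero {R : Type*} [CommRing R] [IsDomain R]
    {I : invertibleIdeals R} (hI : Irreducible I) : Irreducible (invertibleToNonzero R I) := by
  have hcoe : ∀ J, ((invertibleToNonzero R J : nonzeroIdeals R) : Ideal R) = J := fun _ => rfl
  have hinv : ∀ J : nonzeroIdeals R, J ∣ invertibleToNonzero R I →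
      (J : Ideal R) ∈ invertibleIdeals R := fun J hJ =>
    mem_invertibleIdeals_of_dvd I.2 (map_dvd (nonzeroIdeals R).subtype hJ)
  have hunit : ∀ J : invertibleIdeals R, IsUnit (invertibleToNonzero R J) → IsUnit J := by
    intro J hJ
    have h1 : invertibleToNonzero R J = 1 := isUnit_iff_eq_one.1 hJ
    have h2 : J = 1 := Subtype.ext ((hcoe J).symm.trans (congrArg Subtype.val h1))
    exact h2 ▸ isUnit_one
  refine ⟨fun h => hI.not_isUnit (hunit I h), fun A B e => ?_⟩
  have hA := hinv A (Dvd.intro _ e.symm)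
  have hB := hinv B (Dvd.intro_left _ e.symm)
  have e' : I = (⟨A, hA⟩ : invertibleIdeals R) * ⟨B, hB⟩ :=
    Subtype.ext ((hcoe I).symm.trans (congrArg Subtype.val e))
  exact (hI.isUnit_or_isUnit e').imp (fun h => h.map (invertibleToNonzero R))
    fun h => h.map (invertibleToNonzero R)

end OrderIdeals

open MonoidArith OrderIdeals in
theorem theorem5p10 (R : Type*) [CommRing R] [IsDomain R]
    (S : Type*) [CommRing S] [IsDedekindDomain S] [Algebra R S]
    (hRS : IsOrderIn R S) (hR : IsStableDomain R) :
    -- the two ideal monoids are unit-cancellative and atomic, so that all notions below apply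
    (IsUnitCancellative (nonzeroIdeals R) ∧ IsUnitCancellative (invertibleIdeals R) ∧
      IsAtomicMonoid (nonzeroIdeals R) ∧ IsAtomicMonoid (invertibleIdeals R)) ∧
    [IsTransferKrull (nonzeroIdeals R),
      IsTransferKrull (invertibleIdeals R),
      IsHalfFactorial (invertibleIdeals R),
      IsHalfFactorial (nonzeroIdeals R),
      catenaryDegree (nonzeroIdeals R) ≤ 2,
      catenaryDegree (invertibleIdeals R) ≤ 2].TFAE ∧
    monotoneCatenaryDegree (invertibleIdeals R) < ⊤ ∧
    (elasticity (invertibleIdeals R) < ⊤ ↔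
      Set.BijOn (fun P : Ideal (intClosure R) => P.comap (algebraMap R (intClosure R)))
        (minimalNonzeroPrimes (intClosure R)) (minimalNonzeroPrimes R)) ∧
    (Set.BijOn (fun P : Ideal (intClosure R) => P.comap (algebraMap R (intClosure R)))
        (minimalNonzeroPrimes (intClosure R)) (minimalNonzeroPrimes R) →
      ElasticityAccepted (invertibleIdeals R)) := by
  classical
  have hno := hRS.isNoetherianRing
  have hdim := hRS.dimensionLEOne
  have hnz : ∀ I ∈ nonzeroIdeals R, I ≠ ⊥ := fun _ h => h
  have hinv : ∀ I ∈ invertibleIdeals R, I ≠ ⊥ := fun _ h => ne_bot_of_mem_invertibleIdeals h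
  have hatN := isAtomicMonoid_of_ideals hnz
  have hatI := isAtomicMonoid_of_ideals hinv
  let DN := nonzeroIdealsDecomp R
  let DI := invertibleIdealsDecomp R
  obtain ⟨d, hd0, hdS⟩ := hRS.exists_conductor
  have hloc := fun P : NonzeroMaximal R => hRS.splitData_or_nonsplitData hR P.1 P.2.2
  -- the arithmetic is trivial at the good maximal ideals, and all six properties fail as soon as one
  -- maximal ideal is not good
  let good : NonzeroMaximal R → Prop := fun P =>
    TwoConnected (invertibleIdeals (Localization.AtPrime P.1)) ∧
      TwoConnected (nonzeroIdeals (Localization.AtPrime P.1))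
  have hbad : ∀ P, ¬ good P → HasBadRelation (invertibleIdeals (Localization.AtPrime P.1)) ∧
      CloseLengths (invertibleIdeals (Localization.AtPrime P.1)) ∧
      ∃ Δ, 1 ≤ Δ ∧ ∀ q, 1 ≤ q →
        Shiftable (invertibleIdeals (Localization.AtPrime P.1)) (q * Δ) := by
    intro P hP
    rcases hloc P with ⟨-, κ, ⟨D⟩⟩ | ⟨-, D, -, hD⟩
    · exact ⟨D.hasBadRelation, D.closeLengths, D.f + 2, by omega, fun q hq => D.shiftable q hq⟩
    · have hrs : D.r < D.s := by
        refine lt_of_le_of_ne D.r_le_s fun e => hP ⟨D.twoConnected e, hD e⟩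
      exact ⟨D.hasBadRelation hrs, D.closeLengths hrs, 2 * (D.s - D.r), by omega,
        fun q hq => D.shiftable hrs q hq⟩
  -- only the maximal ideals which contain the conductor can be bad
  have hfin : {P : NonzeroMaximal R | d ∈ P.1}.Finite := by
    refine Set.Finite.of_finite_image (f := Subtype.val) ?_ Subtype.val_injective.injOn
    refine (finite_isMaximal_of_le (I := Ideal.span {d})
      (mt Ideal.span_singleton_eq_bot.1 hd0)).subset ?_
    rintro _ ⟨P, hP, rfl⟩
    exact ⟨P.2.1, (Ideal.span_singleton_le_iff_mem _).2 hP⟩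
  have hgood : ∀ P : NonzeroMaximal R, d ∉ P.1 → good P := by
    intro P hP
    rcases hloc P with ⟨⟨Q, Q', hQ, hQ', hne, e, e'⟩, -⟩ | ⟨-, D, hD1, hD⟩
    · -- `d S ⊆ R` determines the primes of `S` over `P`
      have key : ∀ A B : Ideal S, B.IsPrime → A.comap (algebraMap R S) = P.1 →
          B.comap (algebraMap R S) = P.1 → A ≤ B := by
        intro A B hB eA eB x hx
        obtain ⟨r, hr⟩ := hdS x
        have h1 : r ∈ P.1 := by
          rw [← eA]
          change algebraMap R S r ∈ A
          rw [hr]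
          exact A.mul_mem_left _ hx
        rw [← eB] at h1
        change algebraMap R S r ∈ B at h1
        rw [hr] at h1
        exact (hB.mem_or_mem h1).resolve_left fun h2 => hP (eB ▸ h2)
      exact absurd (le_antisymm (key Q Q' hQ' e e') (key Q' Q hQ e' e)) hne
    · have e := hD1 d hP hdS
      exact ⟨D.twoConnected e, hD e⟩
  have hfin' : {P | ¬ good P}.Finite := hfin.subset fun P hP => by
    by_contra hdP
    exact hP (hgood P hdP)
  set F := hfin'.toFinset with hF
  have hmemF : ∀ P, P ∈ F ↔ ¬ good P := fun P => hfin'.mem_toFinset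
  refine ⟨⟨isUnitCancellative_of_ideals hnz, isUnitCancellative_of_ideals hinv, hatN, hatI⟩,
    ?_, ?_, ?_⟩
  · by_cases hall : ∀ P, good P
    · have h1 : TwoConnected (nonzeroIdeals R) := DN.twoConnected fun P => (hall P).2
      have h2 : TwoConnected (invertibleIdeals R) := DI.twoConnected fun P => (hall P).1
      have h3 := isHalfFactorial_of_twoConnected hatN h1
      have h4 := isHalfFactorial_of_twoConnected hatI h2
      refine List.tfae_of_forall True _ ?_
      simp only [List.forall_mem_cons, iff_true]
      exact ⟨isTransferKrull_of_isHalfFactorial h3, isTransferKrull_of_isHalfFactorial h4, h4, h3,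
        catenaryDegree_le_two_of_twoConnected h1, catenaryDegree_le_two_of_twoConnected h2,
        by simp⟩
    · push Not at hall
      obtain ⟨P, hP⟩ := hall
      obtain ⟨hb, -, -⟩ := hbad P hP
      have hσ : ∀ u, Irreducible u → Irreducible (DI.σ P u) := fun u hu => DI.irreducible_σ P hu
      have hσ' : ∀ u, Irreducible u → Irreducible (((invertibleToNonzero R).comp (DI.σ P)) u) :=
        fun u hu => irreducible_invertibleToNonzero (hσ u hu)
      refine List.tfae_of_forall False _ ?_
      simp only [List.forall_mem_cons, iff_false]
      refine ⟨not_isTransferKrull_of_hasBadRelation hb _ hσ',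
        not_isTransferKrull_of_hasBadRelation hb _ hσ,
        not_isHalfFactorial_of_hasBadRelation hb _ hσ,
        not_isHalfFactorial_of_hasBadRelation hb _ hσ',
        not_catenaryDegree_le_two_of_hasBadRelation hb _ hσ' fun a x y y' h h' => ?_,
        not_catenaryDegree_le_two_of_hasBadRelation hb _ hσ fun a x y y' h h' => ?_, by simp⟩
      -- `nonzeroIdeals R` need not be cancellative, but divisors of invertible ideals can be cancelled
      · have hx : (x : Ideal R) ∈ invertibleIdeals R := by
          refine mem_invertibleIdeals_of_dvd (DI.σ P a).2 ?_
          exact map_dvd (nonzeroIdeals R).subtype (Dvd.intro _ h)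
        exact Subtype.ext (mul_left_cancel_of_mem_invertibleIdeals hx
          (congrArg Subtype.val (h.trans h'.symm)))
      · exact Subtype.ext (mul_left_cancel_of_mem_invertibleIdeals x.2
          (congrArg Subtype.val (h.trans h'.symm)))
  · obtain ⟨N, hN⟩ := DI.exists_upConn F
      (fun P hP => (not_not.1 (mt (hmemF P).2 hP)).1)
      (fun P hP => (hbad P ((hmemF P).1 hP)).2.1)
      (fun P hP => (hbad P ((hmemF P).1 hP)).2.2)
    exact monotoneCatenaryDegree_lt_top hN
  · rw [hRS.bijOn_iff]
    have hns : (∀ P : NonzeroMaximal R, ∀ Q Q' : Ideal S, Q.IsPrime → Q'.IsPrime →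
        Q.comap (algebraMap R S) = P.1 → Q'.comap (algebraMap R S) = P.1 → Q = Q') →
        elasticity (invertibleIdeals R) < ⊤ ∧ ElasticityAccepted (invertibleIdeals R) := by
      intro huniq
      have hD : ∀ P : NonzeroMaximal R,
          ∃ D : NonsplitData (invertibleIdeals (Localization.AtPrime P.1)),
            d ∉ P.1 → D.r = D.s := by
        intro P
        rcases hloc P with ⟨⟨Q, Q', hQ, hQ', hne, e, e'⟩, -⟩ | ⟨-, D, hD, -⟩
        · exact absurd (huniq P Q Q' hQ hQ' e e') hne
        · exact ⟨D, fun h => hD d h hdS⟩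
      choose D hD using hD
      exact DI.elasticity_nonsplit hfin.toFinset D fun P hP =>
        hD P fun h => hP (hfin.mem_toFinset.2 h)
    refine ⟨⟨fun hlt P => ?_, fun h => (hns h).1⟩, fun h => (hns h).2⟩
    rcases hloc P with ⟨-, κ, ⟨D⟩⟩ | ⟨h, -⟩
    · exact absurd (DI.elasticity_eq_top P D) hlt.ne
    · exact h
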